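/- **Theorem.** There does not exist a (secret-key) quantum functional encryption scheme that is correct and $\mathsf{M}\text{-}1\text{-}\mathsf{AD}$ (many-message, single-query, adaptive) simulation-secure. No computational assumption is made. Here the notions are as follows; $n\in\mathbb N$ is the security parameter, and a function $f:\mathbb N\to\mathbb R$ is negligible if $n^c f(n)\to 0$ for every $c$. *QPT algorithms.* A QPT algorithm is a uniform quantum algorithm with classical control (it computes on classical data, allocates qubits in state $|0\rangle$, applies the gates $H$, $T=\mathrm{diag}(1,e^{i\pi/4})$, $\mathrm{CNOT}$, and measures), whose number of steps is bounded, on all inputs and for all measurement outcomes, by a polynomial in the size of the input. Inputs and outputs may consist of classical and quantum data. *Circuits.* A quantum circuit $C$ has a number of input wires, of ancilla wires initialised to $|0\rangle$, a finite list of gates from $\{H,T,\mathrm{CNOT}\}$, and an ordered list of distinct output wires; the other wires are traced out. It has a classical description, and $C(m)$ is the result of applying it to a register $m$ of as many qubits as $C$ has input wires ($C(m)$ is the empty register if the number of qubits is different). *Schemes.* A quantum functional encryption scheme consists of QPT algorithms $\mathsf{Setup}(1^n)\to mk$ (a classical master key), $\mathsf{KeyGen}(1^n,mk,C)\to \mathsf{fk}_C$,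 $\mathsf{Enc}(1^n,mk,m)\to \mathsf{ct}$ and $\mathsf{Dec}(1^n,\mathsf{fk}_C,\mathsf{ct})$, where messages are registers of qubits of any length and functional keys and ciphertexts may be quantum. It is *correct* if for every family of circuits $C_n$ with descriptions of polynomial size and every family of states $(m_n,z_n)$, $m_n$ being a message of the input length of $C_n$ and $z_n$ a side register that may be entangled with it, there is a negligible $\varepsilon$ such that for all $n$, with probability at least $1-\varepsilon(n)$ over $mk\leftarrow\mathsf{Setup}(1^n)$, $$\mathsf T\bigl((C_n(m_n),z_n),\ (\mathsf{Dec}(1^n,\mathsf{fk},\mathsf{ct}),z_n)\bigr)\le \varepsilon(n),\qquad \mathsf{fk}\leftarrow\mathsf{KeyGen}(1^n,mk,C_n),\ \mathsf{ct}\leftarrow\mathsf{Enc}(1^n,mk,m_n),$$ where $\mathsf T(\rho,\sigma)=\frac12\|\rho-\sigma\|_1$. *Experiments.* Let $\mathcal A=(\mathcal A_1,\mathcal A_2)$ be an adversary that makes at most one key query in total, and $\mathsf{Sim}=(\mathsf{Sim}_1,\mathsf{Sim}_2)$ a stateful simulator. In both experiments $mk\leftarrow \mathsf{Setup}(1^n)$,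 and $\mathcal A_1(1^n)$, which may query a circuit $C$ to $\mathsf{KeyGen}(1^n,mk,\cdot)$, outputs a list of messages $m_1,\dots,m_N$, of number and lengths of its choice, and a state $\mathsf{st}$. - Real: $\mathsf{ct}_i\leftarrow\mathsf{Enc}(1^n,mk,m_i)$ for all $i$; then $\mathcal A_2$, on $1^n$, $(\mathsf{ct}_i)_i$ and $\mathsf{st}$, may, if $\mathcal A_1$ made no query, query a circuit $C$ to $\mathsf{KeyGen}(1^n,mk,\cdot)$. The output is the final state $\alpha$ of $\mathcal A_2$. - Ideal: the list of ciphertexts is produced by $\mathsf{Sim}_1(1^n,mk,\mathcal V)$, where $\mathcal V=(C,(C(m_i))_i,(1^{|m_i|})_i)$ if $\mathcal A_1$ queried $C$ and $\mathcal V=(1^{|m_i|})_i$ otherwise; then $\mathcal A_2$ runs as before, but its query $C$ is answered by $\mathsf{Sim}_2(1^n,mk,C,(C(m_i))_i,(1^{|m_i|})_i)$, which also has the state left by $\mathsf{Sim}_1$. The output is the final state $\alpha$ of $\mathcal A_2$. *Security.* The scheme is $\mathsf{M}\text{-}1\text{-}\mathsf{AD}$ SIM-secure if for every QPT adversary $\mathcal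 A$ making at most one key query there is a QPT simulator $\mathsf{Sim}$ such that for every QPT distinguisher $D$ the difference $\bigl|\Pr[D(1^n,\alpha_{\mathrm{real}})=1]-\Pr[D(1^n,\alpha_{\mathrm{ideal}})=1]\bigr|$ is negligible in $n$. -/

import Mathlib

/-! Quantum functional encryption and its simulation-based security, over an explicit model of
uniform quantum polynomial time: a small programming language with classical control, qubits that
can be moved but not copied, and a step counter. -/

noncomputable section

namespace QFun

/-! ### Quantum memory -/

/-- A (not necessarily normalised) pure state of finitely many of the qubits `0, 1, 2, …`.
The basis vector `s` is the one in which exactly the qubits in `s` are in state `1`. -/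
abbrev State := Finset ℕ →₀ ℂ

/-- Squared Euclidean norm. -/
def State.normSq (ψ : State) : ℝ := ψ.sum fun _ a => ‖a‖ ^ 2

/-- The linear operator with prescribed values on the basis vectors. -/
def operator (f : Finset ℕ → State) : State →ₗ[ℂ] State := Finsupp.linearCombination ℂ f

/-- Hadamard gate on qubit `q`. -/
def hadamard (q : ℕ) : State →ₗ[ℂ] State := operator fun s =>
  ((√2 : ℝ) : ℂ)⁻¹ •
    (Finsupp.single (s.erase q) 1 + Finsupp.single (insert q s) (if q ∈ s then -1 else 1))

/-- The gate `diag(1, exp(i π / 4))` on qubit `q`. -/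
def tGate (q : ℕ) : State →ₗ[ℂ] State := operator fun s =>
  Finsupp.single s (if q ∈ s then Complex.exp (Real.pi / 4 * Complex.I) else 1)

/-- Controlled NOT with control `c` and target `t` (the identity when `c = t`). -/
def cnot (c t : ℕ) : State →ₗ[ℂ] State := operator fun s =>
  Finsupp.single (if c ∈ s ∧ c ≠ t then symmDiff s {t} else s) 1

/-- The global quantum memory: the qubits `0, …, next - 1` are in use, all others are untouched and
in state `0`; `time` counts the steps executed so far. -/
structure Mem where
  next : ℕ
  amp : State
  time : ℕ

/-- No qubit in use yet. -/
def Mem.init : Mem := ⟨0, Finsupp.single ∅ 1, 0⟩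

/-- A quantum process with outcome in `α`: it turns a memory into the list of its branches, one for
every sequence of measurement outcomes. The state in a branch is not normalised: its squared norm is
the probability of the branch. Qubits whose names are forgotten are thereby traced out. -/
abbrev QM := StateT Mem List

def tick (n : ℕ) : QM Unit := fun μ => [((), { μ with time := μ.time + n })]

/-- Allocates a qubit in state `0`. -/
def newQubit : QM ℕ := fun μ => [(μ.next, { μ with next := μ.next + 1 })]

def apply (U : State →ₗ[ℂ] State) : QM Unit := fun μ => [((), { μ with amp := U μ.amp })]

/-- Measures a qubit in the computational basis. -/
def measure (q : ℕ) : QM Bool := fun μ =>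
  [(false, { μ with amp := μ.amp.filter fun s => q ∉ s }),
   (true, { μ with amp := μ.amp.filter fun s => q ∈ s })]

open Classical in
/-- Probability that the outcome of `x`, started in memory `μ`, satisfies `E`. -/
def prob {α : Type} (x : QM α) (μ : Mem) (E : α → Prop) : ℝ :=
  ((x.run μ).map fun o => if E o.1 then o.2.amp.normSq else 0).sum

/-! ### Data and programs -/

/-- Binary trees whose leaves are `nil` or (the name of) a qubit. -/
inductive Data where
  | nil
  | qubit (q : ℕ)
  | pair (a b : Data)

namespace Data

def size : Data → ℕ
  | nil => 1
  | qubit _ => 1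
  | pair a b => 1 + a.size + b.size

/-- The classical part: every qubit is replaced by `nil`. -/
def classical : Data → Data
  | nil => nil
  | qubit _ => nil
  | pair a b => pair a.classical b.classical

def fst : Data → Data
  | pair a _ => a
  | _ => nil

def snd : Data → Data
  | pair _ b => b
  | _ => nil

def bit : Bool → Data
  | false => nil
  | true => pair nil nil

/-- The list `[a, b, …]` as `pair a (pair b (…))`. -/
def ofList : List Data → Data
  | [] => nil
  | a :: l => pair a (ofList l)

def toList : Data → List Data
  | pair a b => a :: b.toList
  | _ => []

/-- Unary numbers. -/
def ofNat (n : ℕ) : Data := ofList (List.replicate n nil)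

/-- A register, i.e. a list of qubits. -/
def ofReg (w : List ℕ) : Data := ofList (w.map qubit)

def toReg : Data → List ℕ
  | pair (qubit q) b => q :: b.toReg
  | _ => []

end Data

/-- Programs, in point-free form. A program can only touch qubits that occur in its input or that it
allocates itself, and `dup` copies classical information only, so a qubit that is handed over to
another party is no longer accessible to the sender. -/
inductive Prog where
  | id
  | comp (g f : Prog)
  | par (f g : Prog)
  | nil
  | fst
  | snd
  | swap
  | assoc
  | dup
  | size
  | ite (f g : Prog)
  | loop (f : Prog)
  | new
  | gateH
  | gateT
  | gateCNOT
  | meas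

/-- `n`-fold repetition of a process. -/
def repeatM (f : Data → QM Data) : ℕ → Data → QM Data
  | 0, d => pure d
  | n + 1, d => f d >>= repeatM f n

open Data in
/-- Big-step semantics. Every instruction takes one step; `dup` and `size` are charged in addition
for the size of the datum that they traverse. The number of rounds of a `loop` is the length of a
list that is known on entry. -/
def Prog.eval : Prog → Data → QM Data
  | .id, d => do tick 1; pure d
  | .comp g f, d => do tick 1; let e ← f.eval d; g.eval e
  | .par f g, d => do
      tick 1; let a ← f.eval d.fst; let b ← g.eval d.snd; pure (pair a b)
  | .nil, _ => do tick 1; pure Data.nil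
  | .fst, d => do tick 1; pure d.fst
  | .snd, d => do tick 1; pure d.snd
  | .swap, d => do tick 1; pure (pair d.snd d.fst)
  | .assoc, d => do tick 1; pure (pair d.fst.fst (pair d.fst.snd d.snd))
  | .dup, d => do tick (1 + d.size); pure (pair d d.classical)
  | .size, d => do tick (1 + d.size); pure (ofNat d.size)
  | .ite f g, d => do
      tick 1
      match d.fst with
      | Data.nil => g.eval d
      | _ => f.eval d
  | .loop f, d => do
      tick (1 + d.fst.toList.length)
      repeatM (fun e => f.eval e) d.fst.toList.length d.snd
  | .new, _ => do tick 1; let q ← newQubit; pure (qubit q)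
  | .gateH, d => do
      tick 1
      match d with
      | qubit q => do apply (hadamard q); pure d
      | _ => pure d
  | .gateT, d => do
      tick 1
      match d with
      | qubit q => do apply (tGate q); pure d
      | _ => pure d
  | .gateCNOT, d => do
      tick 1
      match d with
      | pair (qubit c) (qubit t) => do apply (cnot c t); pure d
      | _ => pure d
  | .meas, d => do
      tick 1
      match d with
      | qubit q => do let b ← measure q; pure (pair (bit b) d)
      | _ => pure (pair Data.nil d)

/-- Quantum polynomial time: on every input and in every branch, the number of steps is bounded by a
polynomial in the size of the input. -/
def Prog.IsQPT (p : Prog) : Prop :=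
  ∃ P : Polynomial ℕ, ∀ (d : Data) (μ : Mem), ∀ o ∈ (p.eval d).run μ,
    o.2.time ≤ μ.time + P.eval d.size

/-! ### Quantum circuits -/

/-- Gates of the universal set `H, T, CNOT`, on numbered wires. -/
inductive Gate where
  | H (w : ℕ)
  | T (w : ℕ)
  | CNOT (c t : ℕ)

/-- A quantum circuit: the wires `0, …, inputs - 1` carry the input, the next `ancillas` wires start
in state `0`, the gates are listed in an order compatible with the topology, `outputs` is the ordered
list of the output wires that are kept, and all others are traced out. -/
structure Circuit where
  inputs : ℕ
  ancillas : ℕ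
  gates : List Gate
  outputs : List ℕ

namespace Gate

def WellFormed (n : ℕ) : Gate → Prop
  | H w => w < n
  | T w => w < n
  | CNOT c t => c < n ∧ t < n ∧ c ≠ t

def encode : Gate → Data
  | H w => .pair (.ofNat 0) (.ofNat w)
  | T w => .pair (.ofNat 1) (.ofNat w)
  | CNOT c t => .pair (.ofNat 2) (.pair (.ofNat c) (.ofNat t))

/-- The gate, where wire `i` is the qubit `w i`. -/
def unitary (w : ℕ → ℕ) : Gate → State →ₗ[ℂ] State
  | H a => hadamard (w a)
  | T a => tGate (w a)
  | CNOT c t => cnot (w c) (w t)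

end Gate

namespace Circuit

def WellFormed (C : Circuit) : Prop :=
  (∀ g ∈ C.gates, g.WellFormed (C.inputs + C.ancillas)) ∧
  (∀ w ∈ C.outputs, w < C.inputs + C.ancillas) ∧ C.outputs.Nodup

/-- The classical description of a circuit. -/
def encode (C : Circuit) : Data :=
  .pair (.ofNat C.inputs) (.pair (.ofNat C.ancillas)
    (.pair (.ofList (C.gates.map Gate.encode)) (.ofList (C.outputs.map Data.ofNat))))

/-- Applies the circuit to the register `m` and returns the output register. If `m` does not have
the number of qubits on which the circuit is defined, the result is the empty register. -/
def run (C : Circuit) (m : List ℕ) : QM (List ℕ) :=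
  if m.length = C.inputs then do
    let anc ← (List.replicate C.ancillas ()).mapM fun _ => newQubit
    let w : ℕ → ℕ := fun i => (m ++ anc).getD i 0
    let _ ← C.gates.mapM fun g => apply (g.unitary w)
    pure (C.outputs.map w)
  else pure []

end Circuit

theorem Data.ofList_injective : Function.Injective Data.ofList := by
  intro l
  induction l with
  | nil => intro l' h; cases l' with
    | nil => rfl
    | cons b t => simp [Data.ofList] at h
  | cons a s ih => intro l' h; cases l' with
    | nil => simp [Data.ofList] at h
    | cons b t =>
      simp only [Data.ofList, Data.pair.injEq] at h
      rw [h.1, ih h.2]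

theorem Data.ofNat_injective : Function.Injective Data.ofNat := by
  intro a b h
  simpa using congrArg List.length (Data.ofList_injective h)

theorem Gate.encode_injective : Function.Injective Gate.encode := by
  intro a b h
  cases a <;> cases b <;>
    simp only [Gate.encode, Data.pair.injEq, Data.ofNat_injective.eq_iff] at h <;> simp_all

theorem Circuit.encode_injective : Function.Injective Circuit.encode := by
  rintro ⟨i, a, g, o⟩ ⟨i', a', g', o'⟩ h
  simp only [Circuit.encode, Data.pair.injEq, Data.ofNat_injective.eq_iff,
    Data.ofList_injective.eq_iff, (List.map_injective_iff.2 Gate.encode_injective).eq_iff,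
    (List.map_injective_iff.2 Data.ofNat_injective).eq_iff] at h
  simp_all

open Classical in
/-- The well-formed circuit described by a datum, if there is one. -/
def Circuit.decode (d : Data) : Option Circuit :=
  if h : ∃ C : Circuit, C.WellFormed ∧ C.encode = d then some h.choose else none

theorem Circuit.decode_encode {C : Circuit} (hC : C.WellFormed) :
    Circuit.decode C.encode = some C := by
  have h : ∃ C' : Circuit, C'.WellFormed ∧ C'.encode = C.encode := ⟨C, hC, rfl⟩
  rw [Circuit.decode, dif_pos h, Circuit.encode_injective h.choose_spec.2]

/-! ### Density matrices and trace distance -/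

/-- Matrices on `k` qubits. -/
abbrev QMat (k : ℕ) := Matrix (Fin k → Bool) (Fin k → Bool) ℂ

/-- The reduced density matrix of `ψ` on the (distinct) qubits `w 0, …, w (k - 1)`. -/
def reduced {k : ℕ} (w : Fin k → ℕ) (ψ : State) : QMat k := fun a b =>
  ∑ e ∈ ψ.support.image (· \ Finset.univ.image w),
    ψ (e ∪ (Finset.univ.filter (a · = true)).image w) *
      star (ψ (e ∪ (Finset.univ.filter (b · = true)).image w))

/-- The density matrix of the register of `k` qubits that `x` produces from memory `μ`. A branch in
which the register has a wrong number of qubits contributes nothing, so that its probability is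
missing from the trace. -/
def density (k : ℕ) (x : QM (List ℕ)) (μ : Mem) : QMat k :=
  ((x.run μ).map fun o =>
    if o.1.length = k then reduced (fun i : Fin k => o.1.getD i 0) o.2.amp else 0).sum

/-- `Tr √(Aᴴ A)`. -/
def traceNorm {k : ℕ} (A : QMat k) : ℝ :=
  ∑ i, √((Matrix.isHermitian_conjTranspose_mul_self A).eigenvalues i)

def traceDist {k : ℕ} (ρ σ : QMat k) : ℝ := traceNorm (ρ - σ) / 2

/-! ### Quantum functional encryption -/

/-- Negligible functions of the security parameter. -/
def Negligible (f : ℕ → ℝ) : Prop :=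
  Asymptotics.SuperpolynomialDecay Filter.atTop (fun n : ℕ => (n : ℝ)) f

/-- The algorithms of a secret-key quantum functional encryption scheme. -/
structure QFE where
  setup : Prog
  keyGen : Prog
  enc : Prog
  dec : Prog

namespace QFE

def IsQPT (S : QFE) : Prop :=
  S.setup.IsQPT ∧ S.keyGen.IsQPT ∧ S.enc.IsQPT ∧ S.dec.IsQPT

/-- `Setup(1^n)`; the master key is classical. -/
def runSetup (S : QFE) (n : ℕ) : QM Data := do
  let mk ← S.setup.eval (.ofNat n)
  pure mk.classical

/-- `KeyGen(1^n, mk, C)`; the functional key may be quantum. -/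
def runKeyGen (S : QFE) (n : ℕ) (mk : Data) (C : Circuit) : QM Data :=
  S.keyGen.eval (.pair (.ofNat n) (.pair mk C.encode))

/-- `Enc(1^n, mk, m)` for a register `m` of qubits; the ciphertext may be quantum. -/
def runEnc (S : QFE) (n : ℕ) (mk : Data) (m : List ℕ) : QM Data :=
  S.enc.eval (.pair (.ofNat n) (.pair mk (.ofReg m)))

/-- `Dec(1^n, fk, ct)`. -/
def runDec (S : QFE) (n : ℕ) (fk ct : Data) : QM (List ℕ) := do
  let out ← S.dec.eval (.pair (.ofNat n) (.pair fk ct))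
  pure out.toReg

/-- Key generation, encryption and decryption under the master key `mk`. -/
def roundTrip (S : QFE) (n : ℕ) (mk : Data) (C : Circuit) (m : List ℕ) : QM (List ℕ) := do
  let fk ← S.runKeyGen n mk C
  let ct ← S.runEnc n mk m
  S.runDec n fk ct

/-- Correctness. For every family of polynomial-size circuits and of states `(m, z)`, where the
message `m` consists of the qubits `0, …, inputs - 1` and the side register `z` of the next `r`
qubits, with probability `1 - negl` over the master key the decrypted state together with `z` is
`negl`-close in trace distance to `(C(m), z)`. (Mixed states `(m, z)` are covered by purification,
with the purifying system in `z`.) -/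
def IsCorrect (S : QFE) : Prop :=
  ∀ (C : ℕ → Circuit) (r : ℕ → ℕ) (ψ : ℕ → State),
    (∀ n, (C n).WellFormed) →
    (∃ P : Polynomial ℕ, ∀ n, (C n).encode.size ≤ P.eval n) →
    (∀ n, (ψ n).normSq = 1 ∧
      ∀ s ∈ (ψ n).support, s ⊆ Finset.range ((C n).inputs + r n)) →
    ∃ ε : ℕ → ℝ, Negligible ε ∧ ∀ n,
      let m := List.range (C n).inputs
      let z := List.range' (C n).inputs (r n)
      let μ : Mem := ⟨(C n).inputs + r n, ψ n, 0⟩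
      let k := (C n).outputs.length + r n
      1 - ε n ≤ prob (S.runSetup n) Mem.init fun mk =>
        traceDist
          (density k ((· ++ z) <$> (C n).run m) μ)
          (density k ((· ++ z) <$> S.roundTrip n mk (C n) m) μ) ≤ ε n

end QFE

/-! ### Adaptive simulation security with many messages and a single key query -/

/-- An adversary `(A₁, A₂)`, where each of the two parts is cut at its (possible) key query:
`A₁` runs `query₁`, may get a key, and then runs `challenge`;
`A₂` runs `query₂`, may get a key, and then runs `finish`. -/
structure Adversary where
  query₁ : Prog
  challenge : Prog
  query₂ : Prog
  finish : Prog

def Adversary.IsQPT (A : Adversary) : Prop :=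
  A.query₁.IsQPT ∧ A.challenge.IsQPT ∧ A.query₂.IsQPT ∧ A.finish.IsQPT

/-- A stateful simulator. -/
structure Simulator where
  sim₁ : Prog
  sim₂ : Prog

def Simulator.IsQPT (Sim : Simulator) : Prop := Sim.sim₁.IsQPT ∧ Sim.sim₂.IsQPT

/-- The phase in which the adversary chooses its challenge messages; it is the same in both
experiments. Returns the circuit queried, if any, the messages and the state of the adversary. -/
def firstPhase (S : QFE) (A : Adversary) (n : ℕ) (mk : Data) :
    QM (Option Circuit × List (List ℕ) × Data) := do
  let a ← A.query₁.eval (.ofNat n)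
  let q := Circuit.decode a.fst
  let fk ← match q with
    | some C => S.runKeyGen n mk C
    | none => pure .nil
  let b ← A.challenge.eval (.pair (.ofNat n) (.pair fk a.snd))
  pure (q, b.fst.toList.map Data.toReg, b.snd)

/-- The phase after the adversary has got the ciphertexts `cts`; `key C` is the answer to a key query
`C`. The query is answered only if there was none in the first phase. -/
def secondPhase (A : Adversary) (n : ℕ) (q₁ : Option Circuit) (cts st : Data)
    (key : Circuit → QM Data) : QM Data := do
  let a ← A.query₂.eval (.pair (.ofNat n) (.pair cts st))
  let fk ← match q₁, Circuit.decode a.fst with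
    | none, some C => key C
    | _, _ => pure .nil
  A.finish.eval (.pair (.ofNat n) (.pair fk a.snd))

/-- The real experiment. -/
def realExp (S : QFE) (A : Adversary) (n : ℕ) : QM Data := do
  let mk ← S.runSetup n
  let (q₁, msgs, st) ← firstPhase S A n mk
  let cts ← msgs.mapM (S.runEnc n mk)
  secondPhase A n q₁ (.ofList cts) st fun C => S.runKeyGen n mk C

/-- The values `C(m₁), …, C(mₙ)`. -/
def evalAll (C : Circuit) (msgs : List (List ℕ)) : QM Data := do
  let outs ← msgs.mapM C.run
  pure (.ofList (outs.map Data.ofReg))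

/-- The ideal experiment. The first simulator gets `(1^n, mk, C, (C(mᵢ))ᵢ, (1^|mᵢ|)ᵢ)` if the
adversary queried `C` in the first phase and `(1^n, mk, nil, nil, (1^|mᵢ|)ᵢ)` otherwise; the second
one gets `(1^n, mk, C, (C(mᵢ))ᵢ, (1^|mᵢ|)ᵢ)` and the state of the first. -/
def idealExp (S : QFE) (A : Adversary) (Sim : Simulator) (n : ℕ) : QM Data := do
  let mk ← S.runSetup n
  let (q₁, msgs, st) ← firstPhase S A n mk
  let lens := Data.ofList (msgs.map fun m => .ofNat m.length)
  let view (c vals : Data) : Data := .pair (.ofNat n) (.pair mk (.pair c (.pair vals lens)))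
  let v ← match q₁ with
    | some C => do
        let vals ← evalAll C msgs
        pure (view C.encode vals)
    | none => pure (view .nil .nil)
  let t ← Sim.sim₁.eval v
  secondPhase A n q₁ t.fst st fun C => do
    let vals ← evalAll C msgs
    Sim.sim₂.eval (.pair (view C.encode vals) t.snd)

/-- The probability that the distinguisher `D` outputs `1` on the output of an experiment. -/
def accept (D : Prog) (n : ℕ) (x : QM Data) : ℝ :=
  prob (x >>= fun α => D.eval (.pair (.ofNat n) α)) Mem.init fun d => d = .bit true

/-- Computational indistinguishability of families of quantum outputs. -/
def CompIndist (x y : ℕ → QM Data) : Prop :=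
  ∀ D : Prog, D.IsQPT → Negligible fun n => |accept D n (x n) - accept D n (y n)|

/-- Many-message, single-query, adaptive simulation security. -/
def QFE.IsM1ADSimSecure (S : QFE) : Prop :=
  ∀ A : Adversary, A.IsQPT → ∃ Sim : Simulator, Sim.IsQPT ∧
    CompIndist (realExp S A) (idealExp S A Sim)

end QFun

end

/-!
A simulator would have to compress random bits into a short functional key.

The attack sends `N` messages, each a random bit, keeps the bits, obtains the ciphertexts, and only
then asks for the functional key of the identity circuit on one qubit. It decrypts the ciphertext
at a random position and outputs whether the result is the bit that was sent there. In the real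
experiment this succeeds with overwhelming probability, by correctness (`real_ge`); keys have size
less than a polynomial `B` in the security parameter (`exists_key_bound`), so that nothing changes
if longer keys are thrown away. `N` is chosen polynomially larger than `B`.

In the ideal experiment the simulated ciphertexts are produced without any information on the bits;
the simulator learns these when it answers the key query, and has to put them into a key of size
less than `B`. Suppose that the attack still succeeds with probability `1 - δ` for a small `δ`. The
tests at the `N₀` positions in the middle then succeed one after the other, up to an error
proportional to `N₀ * N * δ`, since a test that is passed with high probability hardly disturbs the
state (`norm_sq_le_prod`, `norm_sq_le_tests`). The position is a sum of fair coins, which are the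
only source of randomness of programs, and hence has a binomial distribution; in the middle it
takes each value with probability at least of order `1 / N` (`choose_center_ge`). On the other
hand, a key of size at most `B` may be replaced by a guess that is independent of the bits, namely
one of the at most `4 ^ B` shapes of a datum, filled with qubits in random basis states, at the
cost of a factor `2 ^ (4 * B)` in the probability (`OpFam.norm_sq_le`, `sum_key_le`). The `N₀`
tests with a guessed key all succeed with probability at most `2 ^ (-N₀)` over the choice of the
bits (`sum_prod_le`). Hence they all succeed with probability at most `2 ^ (4 * B - N₀)`
(`sum_tests_le`), which is small for `N₀ ≥ 4 * B + 2`, and `δ` is at least an inverse polynomial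
(`ideal_core`, `ideal_le`). So the output of the attack itself distinguishes the two experiments.

The simulator is an arbitrary program, of which only two things are used: it is a quantum operation
(`sem_complete`), and it acts on the qubits it has been given and on those it allocates
(`sem_linear`). No bound on its running time enters. To make this precise, programs get a symbolic
semantics `sem`: a list of branches, each of which is a sequence of gates and measurement outcomes
on named qubits, with the names of the fresh qubits taken from a given stream. It is equivalent to
the original one (`impl_eval`), equivariant under renaming (`sem_map`), and turns independence of
parts of an experiment into commutation of operators on disjoint sets of qubits
(`commute_of_disjoint`, `Eff.val_bind`, `Eff.val_swap`).
-/

noncomputable section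

namespace QFun

open scoped ComplexConjugate InnerProductSpace

/-! ### The inner product space of states -/

/-- The standard Hermitian form on states, conjugate-linear in the first argument. -/
def State.ip (x y : State) : ℂ := y.sum fun s a => a * conj (x s)

theorem State.ip_eq_sum (x y : State) {t : Finset (Finset ℕ)} (h : y.support ⊆ t) :
    State.ip x y = ∑ s ∈ t, y s * conj (x s) :=
  Finsupp.sum_of_support_subset _ h _ (by simp)

theorem State.ip_self (x : State) : State.ip x x = (State.normSq x : ℂ) := by
  simp only [State.ip, State.normSq, Finsupp.sum, Complex.ofReal_sum]
  refine Finset.sum_congr rfl fun s _ => ?_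
  rw [Complex.mul_conj, Complex.normSq_eq_norm_sq]

theorem State.normSq_nonneg (x : State) : 0 ≤ State.normSq x :=
  Finset.sum_nonneg fun _ _ => by positivity

@[reducible] def State.core : InnerProductSpace.Core ℂ State where
  inner := State.ip
  conj_inner_symm x y := by
    classical
    rw [State.ip_eq_sum y x (t := x.support ∪ y.support) Finset.subset_union_left,
      State.ip_eq_sum x y (t := x.support ∪ y.support) Finset.subset_union_right, map_sum]
    refine Finset.sum_congr rfl fun s _ => ?_
    simp [mul_comm]
  re_inner_nonneg x := by
    rw [State.ip_self]; simpa using State.normSq_nonneg x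
  add_left x y z := by
    simp [State.ip, Finsupp.sum, mul_add, Finset.sum_add_distrib]
  smul_left x y r := by
    simp only [State.ip, Finsupp.sum, Finsupp.smul_apply, smul_eq_mul, map_mul, Finset.mul_sum]
    refine Finset.sum_congr rfl fun s _ => by ring
  definite x h := by
    rw [State.ip_self, Complex.ofReal_eq_zero, State.normSq, Finsupp.sum,
      Finset.sum_eq_zero_iff_of_nonneg fun _ _ => by positivity] at h
    ext s
    by_contra hs
    exact hs (by simpa using h s (Finsupp.mem_support_iff.2 hs))

instance : NormedAddCommGroup State :=
  @InnerProductSpace.Core.toNormedAddCommGroup ℂ State _ _ _ State.core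

instance : InnerProductSpace ℂ State := InnerProductSpace.ofCore State.core.toCore

theorem State.inner_eq (x y : State) : ⟪x, y⟫_ℂ = y.sum fun s a => a * conj (x s) := rfl

theorem State.normSq_eq (x : State) : State.normSq x = ‖x‖ ^ 2 := by
  have h : ⟪x, x⟫_ℂ = (State.normSq x : ℂ) := State.ip_self x
  rw [inner_self_eq_norm_sq_to_K] at h
  exact Complex.ofReal_injective (by rw [← h]; simp)

/-- The computational basis vector `s`. -/
abbrev ket (s : Finset ℕ) : State := Finsupp.single s 1

theorem operator_ket (f : Finset ℕ → State) (s : Finset ℕ) : operator f (ket s) = f s := by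
  simp [operator]

theorem State.hom_ext {K L : State →ₗ[ℂ] State} (h : ∀ s, K (ket s) = L (ket s)) : K = L := by
  refine Finsupp.lhom_ext' fun s => LinearMap.ext_ring ?_
  simpa using h s

theorem norm_ket (s : Finset ℕ) : ‖ket s‖ = 1 := by
  have : ‖ket s‖ ^ 2 = 1 := by rw [← State.normSq_eq]; simp [State.normSq]
  nlinarith [norm_nonneg (ket s)]

/-! ### Elementary operators -/

/-- The operator that permutes the basis vectors along `f`. -/
def moveKets (f : Finset ℕ → Finset ℕ) : State →ₗ[ℂ] State := Finsupp.lmapDomain ℂ ℂ f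

theorem moveKets_ket (f : Finset ℕ → Finset ℕ) (s : Finset ℕ) :
    moveKets f (ket s) = ket (f s) := by
  simp [moveKets, Finsupp.mapDomain_single]

theorem inner_moveKets {f : Finset ℕ → Finset ℕ} (hf : Function.Injective f) (x y : State) :
    ⟪moveKets f x, moveKets f y⟫_ℂ = ⟪x, y⟫_ℂ := by
  rw [State.inner_eq, State.inner_eq]
  simp only [moveKets, Finsupp.lmapDomain_apply]
  rw [Finsupp.sum_mapDomain_index (by simp) (by intros; ring)]
  simp [Finsupp.mapDomain_apply hf]

theorem norm_moveKets {f : Finset ℕ → Finset ℕ} (hf : Function.Injective f) (x : State) :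
    ‖moveKets f x‖ = ‖x‖ := by
  have := inner_moveKets hf x x
  rw [inner_self_eq_norm_sq_to_K, inner_self_eq_norm_sq_to_K] at this
  have h : ‖moveKets f x‖ ^ 2 = ‖x‖ ^ 2 := by exact_mod_cast this
  exact (sq_eq_sq₀ (norm_nonneg _) (norm_nonneg _)).1 h

/-- Flips all qubits in `t`. -/
def flip (t : Finset ℕ) : State →ₗ[ℂ] State := moveKets (symmDiff · t)

theorem flip_ket (t s : Finset ℕ) : flip t (ket s) = ket (symmDiff s t) := moveKets_ket _ _

theorem norm_flip (t : Finset ℕ) (x : State) : ‖flip t x‖ = ‖x‖ :=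
  norm_moveKets (symmDiff_left_injective t) x

theorem flip_mul (t u : Finset ℕ) : flip t * flip u = flip (symmDiff t u) := by
  refine State.hom_ext fun s => ?_
  rw [Module.End.mul_apply, flip_ket, flip_ket, flip_ket, symmDiff_assoc, symmDiff_comm u t]

theorem symmDiff_empty (s : Finset ℕ) : symmDiff s ∅ = s := symmDiff_bot s

theorem empty_symmDiff (s : Finset ℕ) : symmDiff ∅ s = s := bot_symmDiff s

theorem flip_empty : flip ∅ = 1 := by
  refine State.hom_ext fun s => ?_
  rw [flip_ket, symmDiff_empty]; simp

/-- Renames the qubits along a permutation. -/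
def rename (σ : Equiv.Perm ℕ) : State →ₗ[ℂ] State := moveKets (Finset.map σ.toEmbedding)

theorem rename_ket (σ : Equiv.Perm ℕ) (s : Finset ℕ) :
    rename σ (ket s) = ket (s.map σ.toEmbedding) := moveKets_ket _ _

theorem norm_rename (σ : Equiv.Perm ℕ) (x : State) : ‖rename σ x‖ = ‖x‖ :=
  norm_moveKets (Finset.map_injective _) x

/-- The projector onto the states in which qubit `q` has the value `b`; it is the effect of the
outcome `b` of a measurement. -/
def proj (q : ℕ) (b : Bool) : State →ₗ[ℂ] State :=
  operator fun s => if decide (q ∈ s) = b then ket s else 0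

theorem proj_ket (q : ℕ) (b : Bool) (s : Finset ℕ) :
    proj q b (ket s) = if decide (q ∈ s) = b then ket s else 0 := operator_ket _ _

theorem proj_apply (q : ℕ) (b : Bool) (x : State) (s : Finset ℕ) :
    proj q b x s = if decide (q ∈ s) = b then x s else 0 := by
  induction x using Finsupp.induction_linear with
  | zero => simp
  | add f g hf hg => rw [map_add, Finsupp.add_apply, hf, hg]; split_ifs <;> simp
  | single t a =>
    have : Finsupp.single t a = a • ket t := by simp
    rw [this, map_smul, proj_ket]
    by_cases hts : t = s
    · subst hts; split_ifs <;> simp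
    · split_ifs <;> simp [hts]

theorem proj_eq_filter (q : ℕ) (x : State) :
    proj q true x = x.filter (fun s => q ∈ s) ∧ proj q false x = x.filter (fun s => q ∉ s) := by
  constructor <;> ext s <;> rw [proj_apply, Finsupp.filter_apply] <;> simp

theorem inner_proj_left (q : ℕ) (b : Bool) (x y : State) :
    ⟪proj q b x, y⟫_ℂ = ⟪x, proj q b y⟫_ℂ := by
  classical
  have e1 := State.ip_eq_sum (proj q b x) y (t := y.support ∪ (proj q b y).support)
    Finset.subset_union_left
  have e2 := State.ip_eq_sum x (proj q b y) (t := y.support ∪ (proj q b y).support)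
    Finset.subset_union_right
  refine e1.trans (Eq.trans (Finset.sum_congr rfl fun s _ => ?_) e2.symm)
  rw [proj_apply, proj_apply]; split_ifs <;> simp

theorem proj_add (q : ℕ) : proj q false + proj q true = 1 := by
  refine State.hom_ext fun s => ?_
  rw [LinearMap.add_apply, proj_ket, proj_ket]
  by_cases h : q ∈ s <;> simp [h]

theorem proj_mul (q : ℕ) (b : Bool) : proj q b * proj q b = proj q b := by
  refine State.hom_ext fun s => ?_
  rw [Module.End.mul_apply, proj_ket]
  split_ifs with h
  · rw [proj_ket, if_pos h]
  · simp

theorem proj_mul_flip_singleton (q : ℕ) (b : Bool) :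
    proj q b * flip {q} = flip {q} * proj q (!b) := by
  refine State.hom_ext fun s => ?_
  have : q ∈ symmDiff s {q} ↔ q ∉ s := by simp [Finset.mem_symmDiff]
  simp only [Module.End.mul_apply, proj_ket, flip_ket, this]
  by_cases h : q ∈ s <;> cases b <;> simp [h, flip_ket]

theorem norm_proj_add (q : ℕ) (x : State) :
    ‖proj q false x‖ ^ 2 + ‖proj q true x‖ ^ 2 = ‖x‖ ^ 2 := by
  have h (b : Bool) : ((‖proj q b x‖ ^ 2 : ℝ) : ℂ) = ⟪x, proj q b x⟫_ℂ := by
    have h1 := inner_self_eq_norm_sq_to_K (𝕜 := ℂ) (proj q b x)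
    rw [inner_proj_left, ← Module.End.mul_apply, proj_mul] at h1
    rw [h1]; simp
  have h2 := inner_self_eq_norm_sq_to_K (𝕜 := ℂ) x
  have : (((‖proj q false x‖ ^ 2 + ‖proj q true x‖ ^ 2 : ℝ)) : ℂ) = ((‖x‖ ^ 2 : ℝ) : ℂ) := by
    rw [Complex.ofReal_add, h, h, ← inner_add_right, ← LinearMap.add_apply, proj_add]
    simp
  exact_mod_cast this

theorem norm_proj_le (q : ℕ) (b : Bool) (x : State) : ‖proj q b x‖ ≤ ‖x‖ := by
  have h := norm_proj_add q x
  have : ‖proj q b x‖ ^ 2 ≤ ‖x‖ ^ 2 := by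
    cases b <;> nlinarith [sq_nonneg ‖proj q false x‖, sq_nonneg ‖proj q true x‖]
  exact abs_le_of_sq_le_sq' this (norm_nonneg _) |>.2

/-! ### The algebra of operators on a set of qubits -/

/-- The operators that act on the qubits in `A` only. There may be infinitely many qubits in `A`,
but every operator in the algebra involves finitely many of them. -/
def localAlg (A : Set ℕ) : Subalgebra ℂ (Module.End ℂ State) :=
  Algebra.adjoin ℂ {K | ∃ q ∈ A, K = flip {q} ∨ ∃ b, K = proj q b}

theorem localAlg_mono {A B : Set ℕ} (h : A ⊆ B) : localAlg A ≤ localAlg B :=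
  Algebra.adjoin_mono fun _ ⟨q, hq, h'⟩ => ⟨q, h hq, h'⟩

theorem flip_singleton_mem {A : Set ℕ} {q : ℕ} (hq : q ∈ A) : flip {q} ∈ localAlg A :=
  Algebra.subset_adjoin ⟨q, hq, .inl rfl⟩

theorem proj_mem {A : Set ℕ} {q : ℕ} (hq : q ∈ A) (b : Bool) : proj q b ∈ localAlg A :=
  Algebra.subset_adjoin ⟨q, hq, .inr ⟨b, rfl⟩⟩

theorem flip_mem {A : Set ℕ} {t : Finset ℕ} (ht : ∀ q ∈ t, q ∈ A) : flip t ∈ localAlg A := by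
  induction t using Finset.induction_on with
  | empty => rw [flip_empty]; exact one_mem _
  | insert q t hq ih =>
    have : symmDiff {q} t = insert q t := by
      ext x; simp only [Finset.mem_symmDiff, Finset.mem_singleton, Finset.mem_insert]
      constructor
      · tauto
      · rintro (rfl | h)
        · exact .inl ⟨rfl, hq⟩
        · exact .inr ⟨h, fun e => hq (e ▸ h)⟩
    rw [← this, ← flip_mul]
    exact mul_mem (flip_singleton_mem (ht q (by simp))) (ih fun x hx => ht x (by simp [hx]))

theorem commute_of_disjoint {A B : Set ℕ} (hAB : Disjoint A B) {K L : Module.End ℂ State}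
    (hK : K ∈ localAlg A) (hL : L ∈ localAlg B) : Commute K L := by
  have gen : ∀ K ∈ {K | ∃ q ∈ A, K = flip {q} ∨ ∃ b, K = proj q b},
      ∀ L ∈ {K | ∃ q ∈ B, K = flip {q} ∨ ∃ b, K = proj q b}, Commute K L := by
    rintro K ⟨q, hq, hK⟩ L ⟨r, hr, hL⟩
    have hne : q ≠ r := fun h => hAB.ne_of_mem hq hr h
    have fp : ∀ (q r : ℕ) (b : Bool), q ≠ r → Commute (flip {q}) (proj r b) := by
      intro q r b hne
      refine State.hom_ext fun s => ?_
      simp only [Module.End.mul_apply, proj_ket, flip_ket]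
      have : r ∈ symmDiff s {q} ↔ r ∈ s := by
        simp [Finset.mem_symmDiff, hne.symm]
      simp only [this]
      split_ifs
      · rw [flip_ket]
      · simp
    rcases hK with rfl | ⟨b, rfl⟩ <;> rcases hL with rfl | ⟨b', rfl⟩
    · show _ * _ = _ * _
      rw [flip_mul, flip_mul, symmDiff_comm]
    · exact fp _ _ _ hne
    · exact (fp _ _ _ hne.symm).symm
    · refine State.hom_ext fun s => ?_
      simp only [Module.End.mul_apply, proj_ket]
      split_ifs <;> simp_all [proj_ket]
  have h1 : ∀ K ∈ {K | ∃ q ∈ A, K = flip {q} ∨ ∃ b, K = proj q b}, Commute K L := by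
    intro K hK
    induction hL using Algebra.adjoin_induction with
    | mem L hL => exact gen K hK L hL
    | algebraMap r => exact (Algebra.commutes r K).symm
    | add _ _ _ _ h1 h2 => exact h1.add_right h2
    | mul _ _ _ _ h1 h2 => exact h1.mul_right h2
  induction hK using Algebra.adjoin_induction with
  | mem K hK => exact h1 K hK
  | algebraMap r => exact Algebra.commutes r L
  | add _ _ _ _ h1 h2 => exact h1.add_left h2
  | mul _ _ _ _ h1 h2 => exact h1.mul_left h2

theorem inner_flip_left (t : Finset ℕ) (x y : State) :
    ⟪flip t x, y⟫_ℂ = ⟪x, flip t y⟫_ℂ := by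
  have h : y = flip t (flip t y) := by
    rw [← Module.End.mul_apply, flip_mul]; simp [flip_empty]
  conv_lhs => rw [h]
  exact inner_moveKets (symmDiff_left_injective t) _ _

/-- The algebra is closed under adjoints. Since `State` is not complete, adjoints have to be
exhibited; the generators are self-adjoint. -/
theorem exists_adjoint {A : Set ℕ} {K : Module.End ℂ State} (hK : K ∈ localAlg A) :
    ∃ L ∈ localAlg A, ∀ x y : State, ⟪K x, y⟫_ℂ = ⟪x, L y⟫_ℂ := by
  induction hK using Algebra.adjoin_induction with
  | mem K hK =>
    refine ⟨K, Algebra.subset_adjoin hK, ?_⟩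
    obtain ⟨q, -, rfl | ⟨b, rfl⟩⟩ := hK
    · exact inner_flip_left _
    · exact inner_proj_left _ _
  | algebraMap r =>
    refine ⟨algebraMap _ _ (conj r), algebraMap_mem _ _, fun x y => ?_⟩
    simp [Module.algebraMap_end_apply, mul_comm]
  | add K K' _ _ h1 h2 =>
    obtain ⟨L, hL, h⟩ := h1
    obtain ⟨L', hL', h'⟩ := h2
    exact ⟨L + L', add_mem hL hL', fun x y => by
      simp [h, h']⟩
  | mul K K' _ _ h1 h2 =>
    obtain ⟨L, hL, h⟩ := h1
    obtain ⟨L', hL', h'⟩ := h2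
    exact ⟨L' * L, mul_mem hL' hL, fun x y => by
      simp [h, h']⟩

/-! ### Gates -/

/-- The elementary operations of a process: gates and outcomes of measurements. -/
inductive Op where
  | H (q : ℕ)
  | T (q : ℕ)
  | CNOT (c t : ℕ)
  | M (q : ℕ) (b : Bool)

namespace Op

/-- The operator of an operation; the outcome of a measurement acts as a projector, so that the
squared norm of a state is the probability with which the outcomes so far have occurred. -/
def lin : Op → Module.End ℂ State
  | H q => hadamard q
  | T q => tGate q
  | CNOT c t => cnot c t
  | M q b => proj q b

/-- The qubits on which an operation acts. -/
def names : Op → List ℕ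
  | H q => [q]
  | T q => [q]
  | CNOT c t => [c, t]
  | M q _ => [q]

/-- Renames the qubits on which an operation acts. -/
def map (f : ℕ → ℕ) : Op → Op
  | H q => H (f q)
  | T q => T (f q)
  | CNOT c t => CNOT (f c) (f t)
  | M q b => M (f q) b

end Op

theorem hadamard_eq (q : ℕ) : hadamard q =
    ((√2 : ℝ) : ℂ)⁻¹ • (flip {q} + proj q false - proj q true) := by
  refine State.hom_ext fun s => ?_
  simp only [hadamard, operator_ket, LinearMap.smul_apply, LinearMap.sub_apply,
    LinearMap.add_apply, proj_ket, flip_ket]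
  congr 1
  by_cases h : q ∈ s
  · have : symmDiff s {q} = s.erase q := by
      ext x; simp only [Finset.mem_symmDiff, Finset.mem_singleton, Finset.mem_erase]
      constructor
      · rintro (h1 | ⟨rfl, h1⟩)
        · exact ⟨h1.2, h1.1⟩
        · exact absurd h h1
      · exact fun h1 => .inl ⟨h1.2, h1.1⟩
    simp [h, this, ket, sub_eq_add_neg, Finsupp.single_neg]
  · have : symmDiff s {q} = insert q s := by
      ext x; simp only [Finset.mem_symmDiff, Finset.mem_singleton, Finset.mem_insert]
      constructor
      · tauto
      · rintro (rfl | h1)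
        · exact .inr ⟨rfl, h⟩
        · exact .inl ⟨h1, fun e => h (e ▸ h1)⟩
    simp [h, this, ket, add_comm]

theorem tGate_eq (q : ℕ) : tGate q =
    proj q false + Complex.exp (Real.pi / 4 * Complex.I) • proj q true := by
  refine State.hom_ext fun s => ?_
  simp only [tGate, operator_ket, LinearMap.smul_apply, LinearMap.add_apply, proj_ket]
  by_cases h : q ∈ s <;> simp [h, ket]

theorem cnot_eq (c t : ℕ) : cnot c t =
    if c = t then 1 else proj c false + flip {t} * proj c true := by
  refine State.hom_ext fun s => ?_
  simp only [cnot, operator_ket]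
  split_ifs with h1 h2 h2
  · exact absurd h2 h1.2
  · simp [Module.End.mul_apply, proj_ket, h1.1, flip_ket]
  · simp
  · have : c ∉ s := fun h => h1 ⟨h, h2⟩
    simp [Module.End.mul_apply, proj_ket, this]

theorem Op.lin_mem {A : Set ℕ} {o : Op} (h : ∀ q ∈ o.names, q ∈ A) : o.lin ∈ localAlg A := by
  cases o with
  | H q =>
    have hq := h q (by simp [Op.names])
    show hadamard q ∈ _
    rw [hadamard_eq]
    exact Subalgebra.smul_mem _ (sub_mem (add_mem (flip_singleton_mem hq) (proj_mem hq _))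
      (proj_mem hq _)) _
  | T q =>
    have hq := h q (by simp [Op.names])
    show tGate q ∈ _
    rw [tGate_eq]
    exact add_mem (proj_mem hq _) (Subalgebra.smul_mem _ (proj_mem hq _) _)
  | CNOT c t =>
    have hc := h c (by simp [Op.names])
    have ht := h t (by simp [Op.names])
    show cnot c t ∈ _
    rw [cnot_eq]
    split_ifs
    · exact one_mem _
    · exact add_mem (proj_mem hc _) (mul_mem (flip_singleton_mem ht) (proj_mem hc _))
  | M q b => exact proj_mem (h q (by simp [Op.names])) b

/-- A sequence of operations, the first one at the head. -/
abbrev Word := List Op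

namespace Word

/-- The product of the operators, with the head of the list applied first. -/
def lin : Word → Module.End ℂ State
  | [] => 1
  | o :: w => lin w * o.lin

/-- The qubits on which the operations act. -/
def names (w : Word) : List ℕ := w.flatMap Op.names

theorem lin_append (w w' : Word) : lin (w ++ w') = lin w' * lin w := by
  induction w with
  | nil => simp [lin]
  | cons o w ih => simp [lin, ih, mul_assoc]

theorem lin_mem {A : Set ℕ} {w : Word} (h : ∀ q ∈ w.names, q ∈ A) : w.lin ∈ localAlg A := by
  induction w with
  | nil => exact one_mem _
  | cons o w ih =>
    refine mul_mem (ih fun q hq => h q ?_) (Op.lin_mem fun q hq => h q ?_)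
    · simp only [names, List.flatMap_cons, List.mem_append]; exact .inr hq
    · simp only [names, List.flatMap_cons, List.mem_append]; exact .inl hq

end Word

theorem norm_hadamard (q : ℕ) (x : State) : ‖hadamard q x‖ = ‖x‖ := by
  -- With `x = x₀ + x₁` split by the value of `q`, the two summands `flip x` and `x₀ - x₁`
  -- of `√2 • hadamard q x` have the norm of `x` and inner product with vanishing real part.
  have hs : (0 : ℝ) < √2 := by positivity
  set a := proj q false x
  set b := proj q true x
  have hx : x = a + b := by
    simp only [a, b, ← LinearMap.add_apply, proj_add, Module.End.one_apply]
  have horth : ∀ (c : Bool) (u v : State), ⟪proj q c u, proj q (!c) v⟫_ℂ = 0 := by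
    intro c u v
    rw [inner_proj_left, ← Module.End.mul_apply]
    have : proj q c * proj q (!c) = 0 := by
      refine State.hom_ext fun s => ?_
      by_cases h : q ∈ s <;> cases c <;> simp [Module.End.mul_apply, proj_ket, h]
    simp [this]
  have hfa : flip {q} a = proj q true (flip {q} x) := by
    have := LinearMap.congr_fun (proj_mul_flip_singleton q true) x
    simpa [Module.End.mul_apply, a] using this.symm
  have hfb : flip {q} b = proj q false (flip {q} x) := by
    have := LinearMap.congr_fun (proj_mul_flip_singleton q false) x
    simpa [Module.End.mul_apply, b] using this.symm
  have e1 : ‖flip {q} x‖ ^ 2 = ‖x‖ ^ 2 := by rw [norm_flip]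
  have e2 : ‖a - b‖ ^ 2 = ‖x‖ ^ 2 := by
    have h0 : ⟪a, b⟫_ℂ = 0 := horth false x x
    have := norm_sub_sq (𝕜 := ℂ) a b
    have h2 := norm_add_sq (𝕜 := ℂ) a b
    rw [h0] at this h2
    rw [this, hx, h2]; simp
  have e3 : RCLike.re ⟪flip {q} x, a - b⟫_ℂ = 0 := by
    have h1 : ⟪flip {q} a, a⟫_ℂ = 0 := by rw [hfa]; exact horth true _ _
    have h2 : ⟪flip {q} b, b⟫_ℂ = 0 := by rw [hfb]; exact horth false _ _
    have h3 : ⟪flip {q} x, a - b⟫_ℂ = ⟪flip {q} b, a⟫_ℂ - ⟪flip {q} a, b⟫_ℂ := by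
      rw [hx, map_add, inner_add_left, inner_sub_right, inner_sub_right, h1, h2]; ring
    rw [h3, inner_flip_left {q} a b, ← inner_conj_symm (flip {q} b) a, map_sub,
      RCLike.conj_re, sub_self]
  have e4 : ‖flip {q} x + (a - b)‖ ^ 2 = 2 * ‖x‖ ^ 2 := by
    rw [norm_add_sq (𝕜 := ℂ), e1, e2, e3]; ring
  have e5 : hadamard q x = ((√2 : ℝ) : ℂ)⁻¹ • (flip {q} x + (a - b)) := by
    rw [hadamard_eq]
    simp only [LinearMap.smul_apply, LinearMap.sub_apply, LinearMap.add_apply, a, b]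
    congr 1; abel
  have e6 : ‖hadamard q x‖ ^ 2 = ‖x‖ ^ 2 := by
    rw [e5, norm_smul, mul_pow, e4]
    have : ‖((√2 : ℝ) : ℂ)⁻¹‖ ^ 2 = 1 / 2 := by
      rw [norm_inv, Complex.norm_real, Real.norm_of_nonneg hs.le, inv_pow,
        Real.sq_sqrt (by norm_num)]; norm_num
    rw [this]; ring
  exact (sq_eq_sq₀ (norm_nonneg _) (norm_nonneg _)).1 e6

/-- An operator that multiplies both components with respect to a qubit by phases is an isometry. -/
theorem norm_eq_of_proj {K : Module.End ℂ State} (q : ℕ) (c : Bool → ℂ) (hc : ∀ b, ‖c b‖ = 1)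
    (h : ∀ b x, ‖proj q b (K x)‖ = ‖c b • proj q b x‖) (x : State) : ‖K x‖ = ‖x‖ := by
  have h1 := norm_proj_add q x
  have h2 := norm_proj_add q (K x)
  rw [h, h, norm_smul, norm_smul, hc, hc, one_mul, one_mul, h1] at h2
  exact (sq_eq_sq₀ (norm_nonneg _) (norm_nonneg _)).1 h2.symm

theorem norm_tGate (q : ℕ) (x : State) : ‖tGate q x‖ = ‖x‖ := by
  refine norm_eq_of_proj (K := tGate q) q
    (fun b => if b then Complex.exp (Real.pi / 4 * Complex.I) else 1) ?_ ?_ x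
  · intro b
    cases b
    · simp
    · have : (Real.pi / 4 * Complex.I : ℂ) = ((Real.pi / 4 : ℝ) : ℂ) * Complex.I := by
        push_cast; ring
      simp only [if_true, this, Complex.norm_exp_ofReal_mul_I]
  · intro b x
    congr 1
    ext s
    rw [tGate_eq]
    simp only [LinearMap.add_apply, LinearMap.smul_apply, proj_apply, Finsupp.add_apply,
      Finsupp.smul_apply]
    by_cases h : q ∈ s <;> cases b <;> simp [h]

theorem norm_cnot (c t : ℕ) (x : State) : ‖cnot c t x‖ = ‖x‖ := by
  have : cnot c t = moveKets fun s => if c ∈ s ∧ c ≠ t then symmDiff s {t} else s :=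
    State.hom_ext fun s => by rw [moveKets_ket, cnot, operator_ket]
  rw [this]
  refine norm_moveKets (Function.Involutive.injective fun s => ?_) x
  by_cases h : c ∈ s ∧ c ≠ t
  · have : c ∈ symmDiff s {t} := by simp [Finset.mem_symmDiff, h.1, h.2]
    simp [h.1, h.2, this]
  · simp [h]

/-! ### Renaming -/

theorem rename_flip (σ : Equiv.Perm ℕ) (t : Finset ℕ) :
    rename σ * flip t = flip (t.map σ.toEmbedding) * rename σ := by
  refine State.hom_ext fun s => ?_
  simp only [Module.End.mul_apply, flip_ket, rename_ket]
  congr 1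
  ext x; simp [Finset.mem_symmDiff]

theorem rename_proj (σ : Equiv.Perm ℕ) (q : ℕ) (b : Bool) :
    rename σ * proj q b = proj (σ q) b * rename σ := by
  refine State.hom_ext fun s => ?_
  simp only [Module.End.mul_apply, proj_ket, rename_ket]
  have : σ q ∈ s.map σ.toEmbedding ↔ q ∈ s := by simp
  simp only [this]
  split_ifs
  · rw [rename_ket]
  · simp

theorem rename_op (σ : Equiv.Perm ℕ) (o : Op) :
    rename σ * o.lin = (o.map σ).lin * rename σ := by
  have hf : ∀ q, rename σ * flip {q} = flip {σ q} * rename σ := fun q => by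
    rw [rename_flip]; simp
  cases o with
  | H q =>
    show rename σ * hadamard q = hadamard (σ q) * rename σ
    rw [hadamard_eq, hadamard_eq, mul_smul_comm, smul_mul_assoc, mul_sub, mul_add, sub_mul,
      add_mul, rename_proj, rename_proj, hf]
  | T q =>
    show rename σ * tGate q = tGate (σ q) * rename σ
    rw [tGate_eq, tGate_eq, mul_add, add_mul, mul_smul_comm, smul_mul_assoc, rename_proj,
      rename_proj]
  | CNOT c t =>
    show rename σ * cnot c t = cnot (σ c) (σ t) * rename σ
    rw [cnot_eq, cnot_eq]
    simp only [σ.injective.eq_iff]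
    split_ifs
    · simp
    · rw [mul_add, add_mul, rename_proj, ← mul_assoc, hf, mul_assoc, rename_proj, mul_assoc]
  | M q b => exact rename_proj σ q b

/-- Renames the qubits in a sequence of operations. -/
def Word.map (f : ℕ → ℕ) (w : Word) : Word := List.map (Op.map f) w

theorem rename_word (σ : Equiv.Perm ℕ) (w : Word) :
    rename σ * w.lin = (w.map σ).lin * rename σ := by
  induction w with
  | nil => simp [Word.lin, Word.map]
  | cons o w ih =>
    simp only [Word.map, List.map_cons, Word.lin] at ih ⊢
    rw [← mul_assoc, ih, mul_assoc, rename_op, mul_assoc]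

/-! ### Supports -/

/-- The state involves the qubits in `A` only: all others are `0`. -/
def State.SuppIn (A : Set ℕ) (x : State) : Prop := ∀ s ∈ x.support, ∀ q ∈ s, q ∈ A

namespace State.SuppIn

theorem mono {A B : Set ℕ} {x : State} (h : A ⊆ B) (hx : x.SuppIn A) : x.SuppIn B :=
  fun s hs q hq => h (hx s hs q hq)

theorem add {A : Set ℕ} {x y : State} (hx : x.SuppIn A) (hy : y.SuppIn A) :
    (x + y).SuppIn A := by
  classical
  intro s hs
  rcases Finset.mem_union.1 (Finsupp.support_add hs) with h | h
  exacts [hx s h, hy s h]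

theorem smul {A : Set ℕ} {x : State} (c : ℂ) (hx : x.SuppIn A) : (c • x).SuppIn A :=
  fun s hs => hx s (Finsupp.support_smul hs)

theorem ket {A : Set ℕ} {s : Finset ℕ} (h : ∀ q ∈ s, q ∈ A) : (ket s).SuppIn A := by
  intro t ht
  rw [Finset.mem_singleton.1 (Finsupp.support_single_subset ht)]
  exact h

theorem zero (A : Set ℕ) : (0 : State).SuppIn A := fun s hs => by simp at hs

theorem sum {ι : Type*} {A : Set ℕ} (t : Finset ι) {x : ι → State}
    (h : ∀ i ∈ t, (x i).SuppIn A) : (∑ i ∈ t, x i).SuppIn A :=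
  Finset.sum_induction _ _ (fun _ _ => add) (zero A) h

theorem apply {A : Set ℕ} {K : Module.End ℂ State} (hK : K ∈ localAlg A) {x : State}
    (hx : x.SuppIn A) : (K x).SuppIn A := by
  induction hK using Algebra.adjoin_induction generalizing x with
  | mem K hK =>
    obtain ⟨q, hq, rfl | ⟨b, rfl⟩⟩ := hK
    · rw [← Finsupp.sum_single x, Finsupp.sum, map_sum]
      refine sum _ fun s hs => ?_
      have : Finsupp.single s (x s) = x s • QFun.ket s := by simp
      rw [this, map_smul, flip_ket]
      refine smul _ (ket fun r hr => ?_)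
      rw [Finset.mem_symmDiff] at hr
      rcases hr with hr | hr
      · exact hx s hs r hr.1
      · rw [Finset.mem_singleton.1 hr.1]; exact hq
    · intro s hs
      refine hx s ?_
      rw [Finsupp.mem_support_iff, proj_apply] at hs
      rw [Finsupp.mem_support_iff]
      intro h; simp [h] at hs
  | algebraMap r => simpa [Module.algebraMap_end_apply] using smul r hx
  | add K L _ _ h1 h2 => exact add (h1 hx) (h2 hx)
  | mul K L _ _ h1 h2 => exact h1 (h2 hx)

theorem word {A : Set ℕ} {w : Word} (hw : ∀ q ∈ w.names, q ∈ A) {x : State}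
    (hx : x.SuppIn A) : (w.lin x).SuppIn A := apply (Word.lin_mem hw) hx

end State.SuppIn

theorem rename_eq_self {A : Set ℕ} {x : State} (hx : x.SuppIn A) {σ : Equiv.Perm ℕ}
    (hσ : ∀ q ∈ A, σ q = q) : rename σ x = x := by
  conv_lhs => rw [← Finsupp.sum_single x]
  conv_rhs => rw [← Finsupp.sum_single x]
  rw [Finsupp.sum, map_sum]
  refine Finset.sum_congr rfl fun s hs => ?_
  have : Finsupp.single s (x s) = x s • ket s := by simp
  rw [this, map_smul, rename_ket]
  congr 2
  ext q
  simp only [Finset.mem_map_equiv]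
  constructor
  · intro h
    have := hσ _ (hx s hs _ h)
    rw [Equiv.apply_symm_apply] at this
    rwa [← this] at h
  · intro h
    have := hσ _ (hx s hs _ h)
    have h2 : σ.symm q = q := by rw [Equiv.symm_apply_eq]; exact this.symm
    rwa [h2]

/-- Operators on one set of qubits, applied to a state of others, act independently. -/
theorem norm_word_frame {A B : Set ℕ} (hAB : Disjoint A B) {K : Module.End ℂ State}
    (hK : K ∈ localAlg A) {x : State} (hx : x.SuppIn B) :
    ‖K x‖ ^ 2 = ‖x‖ ^ 2 * ‖K (ket ∅)‖ ^ 2 := by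
  set v := K (ket ∅)
  have hv : v.SuppIn A := State.SuppIn.apply hK (State.SuppIn.ket (by simp))
  have e : K x = ∑ s ∈ x.support, x s • flip s v := by
    conv_lhs => rw [← Finsupp.sum_single x]
    rw [Finsupp.sum, map_sum]
    refine Finset.sum_congr rfl fun s hs => ?_
    have h1 : Finsupp.single s (x s) = x s • flip s (ket ∅) := by
      rw [flip_ket, empty_symmDiff]; simp
    have h2 : Commute K (flip s) := commute_of_disjoint hAB hK (flip_mem (hx s hs))
    rw [h1, map_smul, ← Module.End.mul_apply, h2.eq, Module.End.mul_apply]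
  -- The qubits outside of `A` have in `flip s v` the values given by `s`.
  have orth : ∀ s ∈ x.support, ∀ t ∈ x.support, s ≠ t → ⟪flip s v, flip t v⟫_ℂ = 0 := by
    intro s hs t ht hst
    obtain ⟨q, hq⟩ : ∃ q, ¬ (q ∈ s ↔ q ∈ t) := by
      by_contra! h; exact hst (Finset.ext h)
    have hqA : q ∉ A := by
      intro hqA
      rcases not_iff.1 hq with h
      by_cases h1 : q ∈ t
      · exact hAB.ne_of_mem hqA (hx t ht q h1) rfl
      · exact hAB.ne_of_mem hqA (hx s hs q (by tauto)) rfl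
    have hp : ∀ u, flip u v = proj q (decide (q ∈ u)) (flip u v) := by
      intro u
      conv_lhs => rw [← Finsupp.sum_single v]
      conv_rhs => rw [← Finsupp.sum_single v]
      rw [Finsupp.sum, map_sum, map_sum]
      refine Finset.sum_congr rfl fun r hr => ?_
      have h1 : Finsupp.single r (v r) = v r • ket r := by simp
      have h2 : q ∉ r := fun h => hqA (hv r hr q h)
      have h3 : q ∈ symmDiff r u ↔ q ∈ u := by simp [Finset.mem_symmDiff, h2]
      rw [h1, map_smul, map_smul, flip_ket, proj_ket]
      simp [h3]
    rw [hp s, inner_proj_left, hp t, ← Module.End.mul_apply (proj q _)]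
    have : proj q (decide (q ∈ s)) * proj q (decide (q ∈ t)) = 0 := by
      refine State.hom_ext fun r => ?_
      rw [Module.End.mul_apply, proj_ket]
      split_ifs with h
      · rw [proj_ket, if_neg, LinearMap.zero_apply]
        intro h'; rw [h] at h'
        exact hq (by simpa using h'.symm)
      · simp
    simp [this]
  have key : ((‖K x‖ ^ 2 : ℝ) : ℂ) = ((‖x‖ ^ 2 * ‖v‖ ^ 2 : ℝ) : ℂ) := by
    have h1 := inner_self_eq_norm_sq_to_K (𝕜 := ℂ) (K x)
    have h2 : ((‖K x‖ ^ 2 : ℝ) : ℂ) = ⟪K x, K x⟫_ℂ := by rw [h1]; simp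
    rw [h2, e, sum_inner, ← State.normSq_eq, State.normSq, Finsupp.sum, Finset.sum_mul,
      Complex.ofReal_sum]
    refine Finset.sum_congr rfl fun s hs => ?_
    rw [inner_sum, Finset.sum_eq_single_of_mem s hs]
    · rw [inner_smul_left, inner_smul_right, inner_self_eq_norm_sq_to_K, norm_flip, ← mul_assoc,
        mul_comm (conj _), Complex.mul_conj, Complex.normSq_eq_norm_sq]
      push_cast; rfl
    · intro t ht hne
      rw [inner_smul_left, inner_smul_right, orth s hs t ht hne.symm]; simp
  exact_mod_cast key

/-! ### Symbolic semantics -/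

namespace Data

/-- The qubits in a datum, from left to right. -/
def names : Data → List ℕ
  | nil => []
  | qubit q => [q]
  | pair a b => a.names ++ b.names

/-- Renames the qubits in a datum. -/
def map (f : ℕ → ℕ) : Data → Data
  | nil => nil
  | qubit q => qubit (f q)
  | pair a b => pair (a.map f) (b.map f)

theorem classical_map (f : ℕ → ℕ) (d : Data) : (d.map f).classical = d.classical := by
  induction d <;> simp_all [map, classical]

theorem map_classical (f : ℕ → ℕ) (d : Data) : d.classical.map f = d.classical := by
  induction d <;> simp_all [map, classical]

theorem size_map (f : ℕ → ℕ) (d : Data) : (d.map f).size = d.size := by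
  induction d <;> simp_all [map, size]

theorem fst_map (f : ℕ → ℕ) (d : Data) : (d.map f).fst = d.fst.map f := by
  cases d <;> rfl

theorem snd_map (f : ℕ → ℕ) (d : Data) : (d.map f).snd = d.snd.map f := by
  cases d <;> rfl

theorem toList_map (f : ℕ → ℕ) (d : Data) : (d.map f).toList = d.toList.map (map f) := by
  induction d <;> simp_all [map, toList]

theorem names_map (f : ℕ → ℕ) (d : Data) : (d.map f).names = d.names.map f := by
  induction d <;> simp_all [map, names]

theorem map_congr {f g : ℕ → ℕ} {d : Data} (h : ∀ q ∈ d.names, f q = g q) :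
    d.map f = d.map g := by
  induction d with
  | nil => rfl
  | qubit q => simp [map, h q (by simp [names])]
  | pair a b iha ihb =>
    rw [map, map, iha fun q hq => h q (by simp [names, hq]),
      ihb fun q hq => h q (by simp [names, hq])]

theorem map_eq_self {f : ℕ → ℕ} {d : Data} (h : ∀ q ∈ d.names, f q = q) : d.map f = d := by
  have : d.map _root_.id = d := by induction d <;> simp_all [map, names]
  rw [map_congr (g := _root_.id) h, this]

theorem names_classical (d : Data) : d.classical.names = [] := by
  induction d <;> simp_all [classical, names]

theorem names_ofList (l : List Data) : (ofList l).names = l.flatMap names := by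
  induction l <;> simp_all [names, ofList]

theorem names_ofNat (n : ℕ) : (ofNat n).names = [] := by
  rw [ofNat, names_ofList]
  induction n <;> simp_all [List.replicate_succ, names]

theorem ofNat_map (f : ℕ → ℕ) (n : ℕ) : (ofNat n).map f = ofNat n :=
  map_eq_self (by simp [names_ofNat])

theorem toList_ofList (l : List Data) : (ofList l).toList = l := by
  induction l <;> simp_all [toList, ofList]

theorem toList_ofNat (n : ℕ) : (ofNat n).toList.length = n := by
  simp [ofNat, toList_ofList]

theorem size_ofNat (n : ℕ) : (ofNat n).size = 2 * n + 1 := by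
  induction n with
  | zero => rfl
  | succ n ih =>
    have : ofNat (n + 1) = pair nil (ofNat n) := rfl
    rw [this, size, ih, size]; ring

theorem names_fst_snd (d : Data) : (d.fst.names ++ d.snd.names).Sublist d.names := by
  cases d <;> simp [fst, snd, names]

theorem size_pos (d : Data) : 0 < d.size := by cases d <;> simp [size]

theorem size_fst_snd (d : Data) : d.fst.size + d.snd.size ≤ d.size + 1 := by
  cases d <;> simp [fst, snd, size]; omega

theorem length_names_le (d : Data) : d.names.length ≤ d.size := by
  induction d <;> simp_all [names, size]; omega

theorem length_toList_le (d : Data) : d.toList.length ≤ d.size := by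
  induction d <;> simp_all [toList, size]; omega

theorem size_classical (d : Data) : d.classical.size = d.size := by
  induction d <;> simp_all [classical, size]

end Data

/-- A branch of a process: its result, the operations applied in it, the number of qubits allocated
and the number of steps. -/
structure Br (α : Type) where
  val : α
  word : Word
  used : ℕ
  cost : ℕ

/-- The branches of a process whose fresh qubits are named by the given stream. -/
abbrev SM (α : Type) := (ℕ → ℕ) → List (Br α)

namespace SM

variable {α β : Type}

/-- A single branch that takes `c` steps. -/
def ret (c : ℕ) (a : α) : SM α := fun _ => [⟨a, [], 0, c⟩]

/-- Prepends a branch to a branch of its continuation. -/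
def _root_.QFun.Br.andThen (b : Br α) (c : Br β) : Br β :=
  ⟨c.val, b.word ++ c.word, b.used + c.used, b.cost + c.cost⟩

/-- Sequential composition; the continuation takes its fresh qubits from the rest of the stream. -/
def bind (x : SM α) (k : α → SM β) : SM β := fun ν =>
  (x ν).flatMap fun b => (k b.val fun i => ν (b.used + i)).map b.andThen

/-- Iterates a process. -/
def iter (f : Data → SM Data) : ℕ → Data → SM Data
  | 0, d => ret 0 d
  | n + 1, d => bind (f d) (iter f n)

end SM

open SM Data in
/-- The branches of a program, as sequences of operations on named qubits. -/
def sem : Prog → Data → SM Data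
  | .id, d => ret 1 d
  | .comp g f, d => bind (ret 1 d) fun d => bind (sem f d) fun e => sem g e
  | .par f g, d => bind (ret 1 d) fun d =>
      bind (sem f d.fst) fun a => bind (sem g d.snd) fun b => ret 0 (pair a b)
  | .nil, _ => ret 1 Data.nil
  | .fst, d => ret 1 d.fst
  | .snd, d => ret 1 d.snd
  | .swap, d => ret 1 (pair d.snd d.fst)
  | .assoc, d => ret 1 (pair d.fst.fst (pair d.fst.snd d.snd))
  | .dup, d => ret (1 + d.size) (pair d d.classical)
  | .size, d => ret (1 + d.size) (ofNat d.size)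
  | .ite f g, d => bind (ret 1 d) fun d =>
      match d.fst with
      | Data.nil => sem g d
      | _ => sem f d
  | .loop f, d => bind (ret (1 + d.fst.toList.length) d) fun d =>
      iter (fun e => sem f e) d.fst.toList.length d.snd
  | .new, _ => fun ν => [⟨qubit (ν 0), [], 1, 1⟩]
  | .gateH, d =>
      match d with
      | qubit q => fun _ => [⟨qubit q, [.H q], 0, 1⟩]
      | d => ret 1 d
  | .gateT, d =>
      match d with
      | qubit q => fun _ => [⟨qubit q, [.T q], 0, 1⟩]
      | d => ret 1 d
  | .gateCNOT, d =>
      match d with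
      | pair (qubit c) (qubit t) => fun _ => [⟨pair (qubit c) (qubit t), [.CNOT c t], 0, 1⟩]
      | d => ret 1 d
  | .meas, d =>
      match d with
      | qubit q => fun _ => [⟨pair (bit false) (qubit q), [.M q false], 0, 1⟩,
          ⟨pair (bit true) (qubit q), [.M q true], 0, 1⟩]
      | d => ret 1 (pair Data.nil d)

/-! ### Soundness of the symbolic semantics -/

/-- `X` lists the branches of `x`: started on any memory, `x` names its fresh qubits by the
successive numbers that are not in use, and applies the operators of the words to the state. -/
def Impl {α : Type} (x : QM α) (X : SM α) : Prop :=
  ∀ μ : Mem, x.run μ = (X (μ.next + ·)).map fun b =>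
    (b.val, ⟨μ.next + b.used, b.word.lin μ.amp, μ.time + b.cost⟩)

namespace Impl

variable {α β : Type}

theorem bind {x : QM α} {X : SM α} (hx : Impl x X) {k : α → QM β} {K : α → SM β}
    (hk : ∀ a, Impl (k a) (K a)) : Impl (x >>= k) (X.bind K) := by
  intro μ
  rw [StateT.run_bind, hx μ, SM.bind, List.map_flatMap]
  show List.flatMap _ _ = _
  rw [List.flatMap_map]
  refine congrArg (List.flatMap · (X _)) (funext fun b => ?_)
  rw [hk, List.map_map]
  simp only [add_assoc]
  refine List.map_congr_left fun c _ => ?_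
  simp [Br.andThen, Word.lin_append, Module.End.mul_apply]

theorem tick_run (c : ℕ) (y : QM β) (μ : Mem) :
    (do tick c; y : QM β).run μ = y.run { μ with time := μ.time + c } := by
  have h : (tick c).run μ = [((), { μ with time := μ.time + c })] := rfl
  rw [StateT.run_bind, h]
  simp

theorem ret (c : ℕ) (a : α) : Impl (do tick c; pure a : QM α) (SM.ret c a) := fun μ => by
  rw [tick_run]; simp [SM.ret, Word.lin]

theorem pure (a : α) : Impl (Pure.pure a : QM α) (SM.ret 0 a) := fun μ => by
  simp [SM.ret, Word.lin]

theorem tick_bind (c : ℕ) (d : Data) {y : QM β} {Y : Data → SM β} (h : Impl y (Y d)) :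
    Impl (do tick c; y) ((SM.ret c d).bind Y) := by
  intro μ
  rw [tick_run, h]
  simp [SM.bind, SM.ret, Br.andThen, add_assoc]

theorem iter {f : Data → QM Data} {F : Data → SM Data} (h : ∀ d, Impl (f d) (F d)) (n : ℕ)
    (d : Data) : Impl (repeatM f n d) (SM.iter F n d) := by
  induction n generalizing d with
  | zero => exact pure d
  | succ n ih => exact (h d).bind ih

end Impl

/-- The symbolic semantics of a program lists the branches of its evaluation. -/
theorem impl_eval (p : Prog) (d : Data) : Impl (p.eval d) (sem p d) := by
  have hm : ∀ (U : Module.End ℂ State) (o : Op) (e : Data), o.lin = U →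
      Impl (do tick 1; apply U; pure e : QM Data) (fun _ => [⟨e, [o], 0, 1⟩]) := by
    rintro _ o e rfl μ
    simp [Word.lin]; rfl
  induction p generalizing d with
  | id => exact Impl.ret _ _
  | comp g f ihg ihf => exact Impl.tick_bind 1 d ((ihf d).bind fun e => ihg e)
  | par f g ihf ihg =>
    exact Impl.tick_bind 1 d (Y := fun d => SM.bind (sem f d.fst) fun a =>
      SM.bind (sem g d.snd) fun b => SM.ret 0 (Data.pair a b))
      ((ihf _).bind fun a => (ihg _).bind fun b => Impl.pure (Data.pair a b))
  | nil => exact Impl.ret _ _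
  | fst => exact Impl.ret _ _
  | snd => exact Impl.ret _ _
  | swap => exact Impl.ret _ _
  | assoc => exact Impl.ret _ _
  | dup => exact Impl.ret _ _
  | size => exact Impl.ret _ _
  | ite f g ihf ihg =>
    refine Impl.tick_bind 1 d (Y := fun d => match d.fst with
      | Data.nil => sem g d
      | _ => sem f d) ?_
    cases d.fst with
    | nil => exact ihg d
    | _ => exact ihf d
  | loop f ih =>
    exact Impl.tick_bind _ d (Y := fun d => SM.iter (fun e => sem f e) d.fst.toList.length d.snd)
      (Impl.iter ih _ _)
  | new =>
    intro μ
    simp [Prog.eval, sem, Word.lin]; rfl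
  | gateH =>
    cases d with
    | qubit q => exact hm _ (.H q) _ rfl
    | _ => exact Impl.ret _ _
  | gateT =>
    cases d with
    | qubit q => exact hm _ (.T q) _ rfl
    | _ => exact Impl.ret _ _
  | gateCNOT =>
    rcases d with _ | _ | ⟨_ | c | _, _ | t | _⟩
    case pair.qubit.qubit => exact hm _ (.CNOT c t) _ rfl
    all_goals exact Impl.ret _ _
  | meas =>
    cases d with
    | qubit q =>
      intro μ
      simp [sem, Word.lin, Op.lin, proj_eq_filter]; rfl
    | _ => exact Impl.ret _ _

/-! ### Renaming, locality, completeness and growth -/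

/-- Renames the qubits in a branch. -/
def Br.map (f : ℕ → ℕ) (b : Br Data) : Br Data := ⟨b.val.map f, b.word.map f, b.used, b.cost⟩

theorem Word.map_append (f : ℕ → ℕ) (w w' : Word) :
    Word.map f (w ++ w') = w.map f ++ w'.map f := List.map_append

theorem SM.bind_map {f : ℕ → ℕ} {x x' : SM Data} {k k' : Data → SM Data}
    (hx : ∀ ν, x' (f ∘ ν) = (x ν).map (Br.map f))
    (hk : ∀ a ν, k' (a.map f) (f ∘ ν) = (k a ν).map (Br.map f)) (ν : ℕ → ℕ) :
    x'.bind k' (f ∘ ν) = (x.bind k ν).map (Br.map f) := by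
  rw [SM.bind, SM.bind, hx, List.flatMap_map, List.map_flatMap]
  refine congrArg (List.flatMap · (x ν)) (funext fun b => ?_)
  have := hk b.val fun i => ν (b.used + i)
  simp only [Br.map]
  rw [show (fun i => (f ∘ ν) (b.used + i)) = f ∘ fun i => ν (b.used + i) from rfl, this,
    List.map_map, List.map_map]
  refine List.map_congr_left fun c _ => ?_
  simp [Br.andThen, Br.map, Word.map_append]

theorem SM.iter_map {f : ℕ → ℕ} {F : Data → SM Data}
    (h : ∀ a ν, F (a.map f) (f ∘ ν) = (F a ν).map (Br.map f)) (n : ℕ) (d : Data) (ν : ℕ → ℕ) :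
    SM.iter F n (d.map f) (f ∘ ν) = (SM.iter F n d ν).map (Br.map f) := by
  induction n generalizing d ν with
  | zero => rfl
  | succ n ih => exact SM.bind_map (fun ν => h d ν) ih ν

/-- Programs do not see the names of qubits, hence commute with arbitrary renamings, injective or
not. -/
theorem sem_map (f : ℕ → ℕ) (p : Prog) (d : Data) (ν : ℕ → ℕ) :
    sem p (d.map f) (f ∘ ν) = (sem p d ν).map (Br.map f) := by
  have hr : ∀ (c : ℕ) (a : Data) (ν : ℕ → ℕ),
      SM.ret c (a.map f) (f ∘ ν) = (SM.ret c a ν).map (Br.map f) := fun _ _ _ => rfl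
  induction p generalizing d ν with
  | comp g f' ihg ihf =>
    exact SM.bind_map (hr 1 d) (fun d ν => SM.bind_map (ihf d) ihg ν) ν
  | par f' g ihf ihg =>
    refine SM.bind_map (hr 1 d) (fun d ν => ?_) ν
    rw [Data.fst_map, Data.snd_map]
    exact SM.bind_map (ihf _) (fun a ν => SM.bind_map (ihg _) (fun b ν => hr 0 (.pair a b) ν) ν) ν
  | fst => simp only [sem, Data.fst_map]; exact hr _ _ _
  | snd => simp only [sem, Data.snd_map]; exact hr _ _ _
  | swap => simp only [sem, Data.fst_map, Data.snd_map]; exact hr _ (.pair _ _) _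
  | assoc => simp only [sem, Data.fst_map, Data.snd_map]; exact hr _ (.pair _ (.pair _ _)) _
  | dup =>
    simp only [sem, Data.classical_map, Data.size_map]
    conv_lhs => rw [← Data.map_classical f]
    exact hr _ (.pair _ _) _
  | size =>
    simp only [sem, Data.size_map]
    conv_lhs => rw [← Data.ofNat_map f]
    exact hr _ _ _
  | ite f' g ihf ihg =>
    refine SM.bind_map (hr 1 d) (fun d ν => ?_) ν
    rw [Data.fst_map]
    cases d.fst with
    | nil => exact ihg d ν
    | _ => exact ihf d ν
  | loop f' ih =>
    simp only [sem]
    have hl : (d.map f).fst.toList.length = d.fst.toList.length := by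
      rw [Data.fst_map, Data.toList_map, List.length_map]
    rw [hl]
    refine SM.bind_map (hr _ d) (fun d ν => ?_) ν
    have hl : (d.map f).fst.toList.length = d.fst.toList.length := by
      rw [Data.fst_map, Data.toList_map, List.length_map]
    rw [hl, Data.snd_map]
    exact SM.iter_map ih _ _ _
  | gateCNOT => rcases d with _ | _ | ⟨_ | c | _, _ | t | _⟩ <;> rfl
  | gateH | gateT | meas => cases d <;> rfl
  | id | nil | new => rfl

/-- Started on the qubits in `l`, the process only touches these and its fresh ones, and its result
contains each of them at most as often as they were there before. -/
def SM.Linear (l : List ℕ) (x : SM Data) : Prop :=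
  ∀ ν, ∀ b ∈ x ν, b.val.names.Subperm (l ++ (List.range b.used).map ν) ∧
    ∀ q ∈ b.word.names, q ∈ l ++ (List.range b.used).map ν

namespace SM.Linear

theorem ret {c : ℕ} {l : List ℕ} {d : Data} (h : d.names.Subperm l) : (SM.ret c d).Linear l := by
  intro ν b hb
  simp only [SM.ret, List.mem_singleton] at hb
  subst hb
  simpa [Word.names] using h

theorem mono {l l' : List ℕ} {x : SM Data} (hx : x.Linear l) (h : l.Subperm l') :
    x.Linear l' := fun ν b hb =>
    ⟨(hx ν b hb).1.trans ((List.subperm_append_right _).2 h), fun q hq =>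
      ((List.subperm_append_right _).2 h).subset ((hx ν b hb).2 q hq)⟩

theorem bind_append {l r : List ℕ} {x : SM Data} {k : Data → SM Data} (hx : x.Linear l)
    (hk : ∀ a, (k a).Linear (a.names ++ r)) : (x.bind k).Linear (l ++ r) := by
  intro ν b hb
  simp only [SM.bind, List.mem_flatMap, List.mem_map] at hb
  obtain ⟨b₁, h₁, b₂, h₂, rfl⟩ := hb
  obtain ⟨hv₁, hw₁⟩ := hx ν b₁ h₁
  obtain ⟨hv₂, hw₂⟩ := hk _ _ b₂ h₂
  have hp : (b₁.val.names ++ r ++ (List.range b₂.used).map fun i => ν (b₁.used + i)).Subperm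
      (l ++ r ++ (List.range (b₁.used + b₂.used)).map ν) := by
    rw [List.range_add, List.map_append, List.map_map, ← List.append_assoc]
    refine (List.subperm_append_right _).2 ?_
    refine ((List.subperm_append_right r).2 hv₁).trans (List.Perm.subperm ?_)
    rw [List.append_assoc, List.append_assoc]
    exact (List.perm_append_left_iff _).2 List.perm_append_comm
  refine ⟨hv₂.trans hp, fun q hq => ?_⟩
  simp only [Br.andThen, Word.names, List.flatMap_append, List.mem_append] at hq
  rcases hq with hq | hq
  · have := hw₁ q hq
    simp only [Br.andThen, List.mem_append, List.range_add, List.map_append] at this ⊢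
    tauto
  · exact hp.subset (hw₂ q hq)

theorem bind {l : List ℕ} {x : SM Data} {k : Data → SM Data} (hx : x.Linear l)
    (hk : ∀ a, (k a).Linear a.names) : (x.bind k).Linear l := by
  simpa using bind_append (r := []) hx (by simpa using hk)

theorem iter {F : Data → SM Data} (h : ∀ a, (F a).Linear a.names) (n : ℕ) (d : Data) :
    (SM.iter F n d).Linear d.names := by
  induction n generalizing d with
  | zero => exact ret (List.Subperm.refl _)
  | succ n ih => exact bind (h d) ih

end SM.Linear

/-- Programs cannot duplicate qubits. -/
theorem sem_linear (p : Prog) (d : Data) : (sem p d).Linear d.names := by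
  have hfs := fun d : Data => (Data.names_fst_snd d).subperm
  have hf : ∀ d : Data, d.fst.names.Subperm d.names := fun d =>
    (List.sublist_append_left _ _).subperm.trans (hfs d)
  have hs : ∀ d : Data, d.snd.names.Subperm d.names := fun d =>
    (List.sublist_append_right _ _).subperm.trans (hfs d)
  have hr : ∀ d : Data, (SM.ret 1 d).Linear d.names := fun d => SM.Linear.ret (List.Subperm.refl _)
  induction p generalizing d with
  | comp g f ihg ihf => exact SM.Linear.bind (hr d) fun d => SM.Linear.bind (ihf d) ihg
  | par f g ihf ihg =>
    refine SM.Linear.bind (hr d) fun d => SM.Linear.mono ?_ (hfs d)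
    refine SM.Linear.bind_append (ihf _) fun a => SM.Linear.mono ?_ List.perm_append_comm.subperm
    exact SM.Linear.bind_append (ihg _) fun b =>
      SM.Linear.ret List.perm_append_comm.subperm
  | ite f g ihf ihg =>
    refine SM.Linear.bind (hr d) fun d => ?_
    cases d.fst with
    | nil => exact ihg d
    | _ => exact ihf d
  | loop f ih =>
    exact SM.Linear.bind (SM.Linear.ret (List.Subperm.refl _)) fun d =>
      SM.Linear.mono (SM.Linear.iter ih _ _) (hs d)
  | id => exact hr d
  | nil => exact SM.Linear.ret (List.nil_subperm)
  | fst => exact SM.Linear.ret (hf d)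
  | snd => exact SM.Linear.ret (hs d)
  | swap =>
    exact SM.Linear.ret (List.perm_append_comm.subperm.trans (hfs d))
  | assoc =>
    refine SM.Linear.ret (List.Subperm.trans ?_ (hfs d))
    simp only [Data.names]
    rw [← List.append_assoc]
    exact (List.subperm_append_right _).2 (hfs _)
  | dup => exact SM.Linear.ret (by
    simp [Data.names, Data.names_classical, List.Subperm.refl])
  | size => exact SM.Linear.ret (by simp [Data.names_ofNat])
  | new =>
    intro ν b hb
    simp only [sem, List.mem_singleton] at hb
    subst hb
    simp [Data.names, Word.names]
  | gateH =>
    cases d with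
    | qubit q => intro ν b hb; simp only [sem, List.mem_singleton] at hb; subst hb
                 simp [Data.names, Word.names, Op.names]
    | _ => exact hr _
  | gateT =>
    cases d with
    | qubit q => intro ν b hb; simp only [sem, List.mem_singleton] at hb; subst hb
                 simp [Data.names, Word.names, Op.names]
    | _ => exact hr _
  | gateCNOT =>
    rcases d with _ | _ | ⟨_ | c | _, _ | t | _⟩
    case pair.qubit.qubit =>
      intro ν b hb; simp only [sem, List.mem_singleton] at hb; subst hb
      simp [Data.names, Word.names, Op.names, List.Subperm.refl]
    all_goals exact hr _
  | meas =>
    cases d with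
    | qubit q =>
      intro ν b hb
      simp only [sem, List.mem_cons, List.not_mem_nil, or_false] at hb
      rcases hb with rfl | rfl <;> simp [Data.names, Word.names, Op.names, Data.bit]
    | _ => exact SM.Linear.ret (by simp [Data.names, List.Subperm.refl])

/-- The probabilities of the branches add up to one. -/
def SM.Complete {α : Type} (x : SM α) : Prop :=
  ∀ ν (ψ : State), ((x ν).map fun b => ‖b.word.lin ψ‖ ^ 2).sum = ‖ψ‖ ^ 2

theorem sum_flatMap {α β : Type} (l : List α) (f : α → List β) (g : β → ℝ) :
    ((l.flatMap f).map g).sum = (l.map fun a => ((f a).map g).sum).sum := by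
  induction l <;> simp_all

namespace SM.Complete

variable {α β : Type}

theorem ret (c : ℕ) (a : α) : (SM.ret c a).Complete := fun ν ψ => by simp [SM.ret, Word.lin]

theorem bind {x : SM α} {k : α → SM β} (hx : x.Complete) (hk : ∀ a, (k a).Complete) :
    (x.bind k).Complete := by
  intro ν ψ
  rw [SM.bind, sum_flatMap, ← hx ν ψ]
  congr 1
  refine List.map_congr_left fun b _ => ?_
  rw [List.map_map, ← hk b.val (fun i => ν (b.used + i)) (b.word.lin ψ)]
  simp [Br.andThen, Word.lin_append, Function.comp_def]

theorem iter {F : Data → SM Data} (h : ∀ a, (F a).Complete) (n : ℕ) (d : Data) :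
    (SM.iter F n d).Complete := by
  induction n generalizing d with
  | zero => exact ret _ _
  | succ n ih => exact bind (h d) ih

end SM.Complete

theorem sem_complete (p : Prog) (d : Data) : (sem p d).Complete := by
  have hr := fun (c : ℕ) (d : Data) => SM.Complete.ret c d
  induction p generalizing d with
  | comp g f ihg ihf => exact (hr _ _).bind fun d => (ihf d).bind ihg
  | par f g ihf ihg =>
    exact (hr _ _).bind fun d => (ihf _).bind fun a => (ihg _).bind fun b => hr _ _
  | ite f g ihf ihg =>
    refine (hr _ _).bind fun d => ?_
    cases d.fst with
    | nil => exact ihg d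
    | _ => exact ihf d
  | loop f ih => exact (hr _ _).bind fun d => SM.Complete.iter ih _ _
  | id | nil | fst | snd | swap | assoc | dup | size => exact hr _ _
  | new => intro ν ψ; simp [sem, Word.lin]
  | gateH =>
    cases d with
    | qubit q => intro ν ψ; simp [sem, Word.lin, Op.lin, norm_hadamard]
    | _ => exact hr _ _
  | gateT =>
    cases d with
    | qubit q => intro ν ψ; simp [sem, Word.lin, Op.lin, norm_tGate]
    | _ => exact hr _ _
  | gateCNOT =>
    rcases d with _ | _ | ⟨_ | c | _, _ | t | _⟩
    case pair.qubit.qubit => intro ν ψ; simp [sem, Word.lin, Op.lin, norm_cnot]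
    all_goals exact hr _ _
  | meas =>
    cases d with
    | qubit q => intro ν ψ; simpa [sem, Word.lin, Op.lin] using norm_proj_add q ψ
    | _ => exact hr _ _

/-- The results of the process have size at most `n`, up to four times the number of steps. -/
def SM.Sized (n : ℕ) (x : SM Data) : Prop := ∀ ν, ∀ b ∈ x ν, b.val.size ≤ n + 4 * b.cost

namespace SM.Sized

theorem ret {c n : ℕ} {d : Data} (h : d.size ≤ n + 4 * c) : (SM.ret c d).Sized n := by
  intro ν b hb
  simp only [SM.ret, List.mem_singleton] at hb
  subst hb
  exact h

theorem bind {n m : ℕ} {x : SM Data} {k : Data → SM Data} (hx : x.Sized n)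
    (hk : ∀ a, (k a).Sized (a.size + m)) : (x.bind k).Sized (n + m) := by
  intro ν b hb
  simp only [SM.bind, List.mem_flatMap, List.mem_map] at hb
  obtain ⟨b₁, h₁, b₂, h₂, rfl⟩ := hb
  have := hx ν b₁ h₁
  have := hk _ _ b₂ h₂
  simp only [Br.andThen]
  omega

theorem mono {n m : ℕ} {x : SM Data} (hx : x.Sized n) (h : n ≤ m) : x.Sized m :=
  fun ν b hb => (hx ν b hb).trans (by omega)

theorem iter {F : Data → SM Data} (h : ∀ a, (F a).Sized a.size) (n : ℕ) (d : Data) :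
    (SM.iter F n d).Sized d.size := by
  induction n generalizing d with
  | zero => exact ret (by omega)
  | succ n ih => exact bind (m := 0) (h d) ih

/-- A step that is charged pays for a growth of the datum by four. -/
theorem ret_bind {c n : ℕ} {d : Data} {k : Data → SM Data} (h : (k d).Sized (n + 4 * c)) :
    ((SM.ret c d).bind k).Sized n := by
  intro ν b hb
  simp only [SM.bind, SM.ret, List.flatMap_cons, List.flatMap_nil, List.append_nil,
    List.mem_map] at hb
  obtain ⟨b₂, h₂, rfl⟩ := hb
  have := h _ b₂ h₂
  simp only [Br.andThen]
  omega

end SM.Sized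

theorem sem_sized (p : Prog) (d : Data) : (sem p d).Sized d.size := by
  have hfs := Data.size_fst_snd d
  have hpos := d.size_pos
  have h1 := d.fst.size_pos
  have h2 := d.snd.size_pos
  induction p generalizing d with
  | comp g f ihg ihf =>
    refine SM.Sized.ret_bind (SM.Sized.mono (m := d.size + 4 * 1)
      (SM.Sized.bind (m := 0) (ihf d hfs hpos h1 h2) fun e => ?_) (by omega))
    exact ihg e (Data.size_fst_snd e) e.size_pos e.fst.size_pos e.snd.size_pos
  | par f g ihf ihg =>
    have ihf := fun e => ihf e (Data.size_fst_snd e) e.size_pos e.fst.size_pos e.snd.size_pos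
    have ihg := fun e => ihg e (Data.size_fst_snd e) e.size_pos e.fst.size_pos e.snd.size_pos
    refine SM.Sized.ret_bind (SM.Sized.mono (n := d.fst.size + (d.snd.size + 1)) ?_ (by omega))
    refine SM.Sized.bind (ihf _) fun a => ?_
    refine SM.Sized.mono (n := d.snd.size + (a.size + 1)) ?_ (by omega)
    exact SM.Sized.bind (ihg _) fun b => SM.Sized.ret (by simp [Data.size]; omega)
  | ite f g ihf ihg =>
    refine SM.Sized.ret_bind ?_
    cases hd : d.fst with
    | nil => exact SM.Sized.mono (ihg d hfs hpos h1 h2) (by omega)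
    | _ => exact SM.Sized.mono (ihf d hfs hpos h1 h2) (by omega)
  | loop f ih =>
    refine SM.Sized.ret_bind (SM.Sized.mono (n := d.snd.size) (SM.Sized.iter (fun e =>
      ih e (Data.size_fst_snd e) e.size_pos e.fst.size_pos e.snd.size_pos) _ _) (by omega))
  | id | fst | snd => exact SM.Sized.ret (by omega)
  | nil => exact SM.Sized.ret (by simp [Data.size])
  | swap => exact SM.Sized.ret (by simp [Data.size]; omega)
  | assoc =>
    have := Data.size_fst_snd d.fst
    exact SM.Sized.ret (by simp [Data.size]; omega)
  | dup => exact SM.Sized.ret (by simp [Data.size, Data.size_classical]; omega)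
  | size => exact SM.Sized.ret (by rw [Data.size_ofNat]; omega)
  | new =>
    intro ν b hb
    simp only [sem, List.mem_singleton] at hb
    subst hb
    simp [Data.size]
  | gateH =>
    cases d with
    | qubit q => intro ν b hb; simp only [sem, List.mem_singleton] at hb; subst hb
                 simp [Data.size]
    | _ => exact SM.Sized.ret (by omega)
  | gateT =>
    cases d with
    | qubit q => intro ν b hb; simp only [sem, List.mem_singleton] at hb; subst hb
                 simp [Data.size]
    | _ => exact SM.Sized.ret (by omega)
  | gateCNOT =>
    rcases d with _ | _ | ⟨_ | c | _, _ | t | _⟩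
    case pair.qubit.qubit =>
      intro ν b hb; simp only [sem, List.mem_singleton] at hb; subst hb
      simp [Data.size]
    all_goals exact SM.Sized.ret (by omega)
  | meas =>
    cases d with
    | qubit q =>
      intro ν b hb
      simp only [sem, List.mem_cons, List.not_mem_nil, or_false] at hb
      rcases hb with rfl | rfl <;> simp [Data.size, Data.bit]
    | _ => exact SM.Sized.ret (by simp [Data.size] <;> omega)

/-! ### Effects -/

/-- The words of the accepting branches of a process. Since the operators of a word are given by
their names, this determines the probability of acceptance on every state. -/
abbrev Eff := (ℕ → ℕ) → List Word

/-- `ν` is a stream of distinct names outside `B`. -/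
def Fresh (ν : ℕ → ℕ) (B : Set ℕ) : Prop := Function.Injective ν ∧ ∀ i, ν i ∉ B

theorem Fresh.mono {ν : ℕ → ℕ} {A B : Set ℕ} (h : Fresh ν B) (hAB : A ⊆ B) : Fresh ν A :=
  ⟨h.1, fun i hi => h.2 i (hAB hi)⟩

theorem fresh_add (n : ℕ) : Fresh (n + ·) (Set.Iio n) :=
  ⟨fun a b h => by simpa using h, fun i h => by simp at h⟩

theorem Fresh.shift {ν : ℕ → ℕ} {B : Set ℕ} (h : Fresh ν B) (k : ℕ) :
    Fresh (fun i => ν (k + i)) (B ∪ ν '' Set.Iio k) := by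
  refine ⟨fun a b hab => by simpa using h.1 hab, fun i hi => ?_⟩
  rcases hi with hi | ⟨j, hj, e⟩
  · exact h.2 _ hi
  · have := h.1 e
    simp at hj; omega

namespace Eff

/-- The probability of acceptance on the state `ψ`. -/
def val (P : Eff) (ν : ℕ → ℕ) (ψ : State) : ℝ := ((P ν).map fun w => ‖w.lin ψ‖ ^ 2).sum

theorem val_nonneg (P : Eff) (ν : ℕ → ℕ) (ψ : State) : 0 ≤ P.val ν ψ :=
  List.sum_nonneg (by simp only [List.mem_map]; rintro _ ⟨w, -, rfl⟩; positivity)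

/-- An effect depending on a datum is local and uniform: it touches only qubits in `A`, in the datum
and fresh ones, and is equivariant under renamings that fix `A`. -/
structure Fam (A : Set ℕ) (K : Data → Eff) : Prop where
  names : ∀ a ν, ∀ w ∈ K a ν, ∀ q ∈ w.names, q ∈ A ∨ q ∈ a.names ∨ q ∈ Set.range ν
  map : ∀ f : ℕ → ℕ, (∀ q ∈ A, f q = q) → ∀ a ν,
    K (a.map f) (f ∘ ν) = (K a ν).map (Word.map f)

/-- A map on data that is local and uniform in the same sense. -/
structure Unif (A : Set ℕ) (g : Data → Data) : Prop where
  names : ∀ a, ∀ q ∈ (g a).names, q ∈ A ∨ q ∈ a.names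
  map : ∀ f : ℕ → ℕ, (∀ q ∈ A, f q = q) → ∀ a, g (a.map f) = (g a).map f

theorem Unif.const {A : Set ℕ} {d : Data} (h : ∀ q ∈ d.names, q ∈ A) : Unif A fun _ => d :=
  ⟨fun _ q hq => .inl (h q hq), fun _ hf _ => (Data.map_eq_self fun q hq => hf q (h q hq)).symm⟩

theorem Unif.id (A : Set ℕ) : Unif A fun d => d := ⟨fun _ _ hq => .inr hq, fun _ _ _ => rfl⟩

theorem Unif.pair {A : Set ℕ} {g h : Data → Data} (hg : Unif A g) (hh : Unif A h) :
    Unif A fun d => .pair (g d) (h d) := by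
  refine ⟨fun a q hq => ?_, fun f hf a => ?_⟩
  · rcases List.mem_append.1 hq with hq | hq
    · exact hg.names a q hq
    · exact hh.names a q hq
  · simp only [Data.map, hg.map f hf, hh.map f hf]

theorem Unif.fst {A : Set ℕ} {g : Data → Data} (hg : Unif A g) : Unif A fun d => (g d).fst :=
  ⟨fun a q hq => hg.names a q ((Data.names_fst_snd _).subset (List.mem_append_left _ hq)),
    fun f hf a => by rw [hg.map f hf, Data.fst_map]⟩

theorem Unif.snd {A : Set ℕ} {g : Data → Data} (hg : Unif A g) : Unif A fun d => (g d).snd :=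
  ⟨fun a q hq => hg.names a q ((Data.names_fst_snd _).subset (List.mem_append_right _ hq)),
    fun f hf a => by rw [hg.map f hf, Data.snd_map]⟩

theorem Fam.mono {A B : Set ℕ} {K : Data → Eff} (hK : Fam A K) (h : A ⊆ B) : Fam B K :=
  ⟨fun a ν w hw q hq => (hK.names a ν w hw q hq).imp_left fun x => h x,
    fun f hf => hK.map f fun q hq => hf q (h hq)⟩

theorem Fam.comp {A : Set ℕ} {K : Data → Eff} (hK : Fam A K) {g : Data → Data} (hg : Unif A g) :
    Fam A fun a => K (g a) := by
  refine ⟨fun a ν w hw q hq => ?_, fun f hf a ν => by rw [hg.map f hf, hK.map f hf]⟩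
  rcases hK.names _ ν w hw q hq with h | h | h
  · exact .inl h
  · exact (hg.names a q h).imp_right .inl
  · exact .inr (.inr h)

/-- Runs a process and then an effect on its result. -/
def bind (x : SM Data) (K : Data → Eff) : Eff := fun ν =>
  (x ν).flatMap fun b => (K b.val fun i => ν (b.used + i)).map (b.word ++ ·)

theorem Fam.bind {A : Set ℕ} {T : Data → Eff} (hT : Fam A T) (p : Prog) {g : Data → Data}
    (hg : Unif A g) : Fam A fun t => Eff.bind (sem p (g t)) fun a => T (.pair a t) := by
  refine ⟨fun t ν w hw q hq => ?_, fun f hf t ν => ?_⟩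
  · simp only [Eff.bind, List.mem_flatMap, List.mem_map] at hw
    obtain ⟨b, hb, w', hw', rfl⟩ := hw
    obtain ⟨h1, h2⟩ := sem_linear p (g t) ν b hb
    have h3 : ∀ q, q ∈ (g t).names ++ (List.range b.used).map ν →
        q ∈ A ∨ q ∈ t.names ∨ q ∈ Set.range ν := by
      intro q hq
      rcases List.mem_append.1 hq with hq | hq
      · exact (hg.names t q hq).imp_right .inl
      · obtain ⟨i, -, rfl⟩ := List.mem_map.1 hq
        exact .inr (.inr ⟨i, rfl⟩)
    simp only [Word.names, List.flatMap_append, List.mem_append] at hq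
    rcases hq with hq | hq
    · exact h3 q (h2 q hq)
    · rcases hT.names _ _ w' hw' q hq with h | h | ⟨i, rfl⟩
      · exact .inl h
      · rcases List.mem_append.1 h with h | h
        · exact h3 q (h1.subset h)
        · exact .inr (.inl h)
      · exact .inr (.inr ⟨_, rfl⟩)
  · simp only [Eff.bind]
    rw [hg.map f hf, sem_map, List.flatMap_map, List.map_flatMap]
    refine congrArg (List.flatMap · (sem p (g t) ν)) (funext fun b => ?_)
    have := hT.map f hf (.pair b.val t) fun i => ν (b.used + i)
    simp only [Br.map]
    rw [show (fun i => (f ∘ ν) (b.used + i)) = f ∘ fun i => ν (b.used + i) from rfl,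
      show Data.pair (b.val.map f) (t.map f) = (Data.pair b.val t).map f from rfl, this,
      List.map_map, List.map_map]
    exact List.map_congr_left fun c _ => (Word.map_append f _ _).symm

/-- Accepts if the result of a program satisfies `E`. -/
def accept (x : SM Data) (E : Data → Bool) : Eff := fun ν =>
  ((x ν).filter fun b => E b.val).map Br.word

theorem Fam.accept (p : Prog) {A : Set ℕ} {g : Data → Data} (hg : Unif A g)
    {E : Data → Data → Bool} (hE : ∀ f t a, E (t.map f) (a.map f) = E t a) :
    Fam A fun t => Eff.accept (sem p (g t)) (E t) := by
  refine ⟨fun t ν w hw q hq => ?_, fun f hf t ν => ?_⟩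
  · simp only [Eff.accept, List.mem_map, List.mem_filter] at hw
    obtain ⟨b, ⟨hb, -⟩, rfl⟩ := hw
    rcases List.mem_append.1 ((sem_linear p (g t) ν b hb).2 q hq) with hq | hq
    · exact (hg.names t q hq).imp_right .inl
    · obtain ⟨i, -, rfl⟩ := List.mem_map.1 hq
      exact .inr (.inr ⟨i, rfl⟩)
  · simp only [Eff.accept]
    rw [hg.map f hf, sem_map, List.filter_map, List.map_map, List.map_map]
    have : ((fun b : Br Data => E (t.map f) b.val) ∘ Br.map f) = fun b => E t b.val :=
      funext fun b => hE f t b.val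
    rw [this]; rfl

end Eff

/-! ### Independence of the names of fresh qubits -/

/-- An injection on a finite set extends to a permutation, so that statements on renamings by
permutations apply to arbitrary changes of finitely many names. -/
theorem exists_perm_extending {F : Finset ℕ} {f : ℕ → ℕ} (hf : Set.InjOn f F) :
    ∃ σ : Equiv.Perm ℕ, ∀ x ∈ F, σ x = f x := by
  classical
  let G : Finset ℕ := F ∪ F.image f
  have hG : F.image f ⊆ G := Finset.subset_union_right
  obtain ⟨g, hg⟩ := Finset.exists_equiv_extend_of_card_eq (α := G) (t := G) (by simp)
    (s := F.subtype (· ∈ G)) (f := fun x => f x)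
    (by
      intro y hy
      obtain ⟨x, hx, rfl⟩ := Finset.mem_image.1 hy
      exact hG (Finset.mem_image_of_mem f (by simpa using hx)))
    (by
      intro x hx y hy h
      exact Subtype.ext (hf (by simpa using hx) (by simpa using hy) h))
  refine ⟨Equiv.Perm.ofSubtype g, fun x hx => ?_⟩
  have hxG : x ∈ G := Finset.mem_union_left _ hx
  rw [Equiv.Perm.ofSubtype_apply_of_mem g hxG]
  exact hg ⟨x, hxG⟩ (by simpa using hx)

theorem Word.map_congr {f g : ℕ → ℕ} {w : Word} (h : ∀ q ∈ w.names, f q = g q) :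
    w.map f = w.map g := by
  refine List.map_congr_left fun o ho => ?_
  have : ∀ q ∈ o.names, f q = g q := fun q hq => h q (List.mem_flatMap.2 ⟨o, ho, hq⟩)
  cases o <;> simp_all [Op.map, Op.names]

/-- The qubits that occur in the support of a state. -/
def State.names (ψ : State) : Finset ℕ := ψ.support.biUnion fun s => s

theorem State.suppIn_names (ψ : State) : ψ.SuppIn ψ.names := fun s hs _ hq =>
  Finset.mem_coe.2 (Finset.mem_biUnion.2 ⟨s, hs, hq⟩)

theorem State.SuppIn.names_subset {ψ : State} {A : Set ℕ} (h : ψ.SuppIn A) :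
    ∀ q ∈ ψ.names, q ∈ A := fun q hq => by
  obtain ⟨s, hs, hq⟩ := Finset.mem_biUnion.1 hq
  exact h s hs q hq

/-- Renaming along a map that is injective on the qubits involved preserves probabilities. -/
theorem norm_word_map {f : ℕ → ℕ} {w : Word} {ψ : State}
    (hf : Set.InjOn f (w.names.toFinset ∪ ψ.names : Finset ℕ)) (hψ : ∀ q ∈ ψ.names, f q = q) :
    ‖(w.map f).lin ψ‖ = ‖w.lin ψ‖ := by
  obtain ⟨σ, hσ⟩ := exists_perm_extending hf
  have h1 : w.map f = w.map σ := Word.map_congr fun q hq => (hσ q (by simp [hq])).symm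
  have h2 : rename σ ψ = ψ := rename_eq_self ψ.suppIn_names fun q hq => by
    rw [hσ q (by simpa using Or.inr hq), hψ q hq]
  rw [h1]
  conv_lhs => rw [← h2]
  rw [← Module.End.mul_apply, ← rename_word, Module.End.mul_apply, norm_rename]

namespace Eff

/-- The effect is local to `A` and uniform. -/
def On (A : Set ℕ) (P : Eff) : Prop := Fam A fun _ => P

theorem Fam.on {A B : Set ℕ} {K : Data → Eff} (hK : Fam A K) {a : Data} (hA : A ⊆ B)
    (ha : ∀ q ∈ a.names, q ∈ B) : On B (K a) :=
  (hK.mono hA).comp (Unif.const ha)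

theorem On.names {A : Set ℕ} {P : Eff} (hP : On A P) {ν : ℕ → ℕ} {w : Word} (hw : w ∈ P ν) :
    ∀ q ∈ w.names, q ∈ A ∪ Set.range ν := fun q hq => by
  simpa [Data.names] using Fam.names hP .nil ν w hw q hq

/-- The probability of acceptance does not depend on the names of the fresh qubits. -/
theorem On.val_eq {A B : Set ℕ} {P : Eff} (hP : On A P) (hAB : A ⊆ B) {ψ : State}
    (hψ : ψ.SuppIn B) {ν ν' : ℕ → ℕ} (hν : Fresh ν B) (hν' : Fresh ν' B) :
    P.val ν ψ = P.val ν' ψ := by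
  classical
  -- The map that sends `ν i` to `ν' i` and fixes everything else is injective on all names
  -- involved.
  let f : ℕ → ℕ := fun x => if h : ∃ i, ν i = x then ν' h.choose else x
  have hfν : ∀ i, f (ν i) = ν' i := fun i => by
    have h : ∃ j, ν j = ν i := ⟨i, rfl⟩
    simp only [f, dif_pos h]
    rw [hν.1 h.choose_spec]
  have hfB : ∀ q ∈ B, f q = q := fun q hq => by
    have h : ¬ ∃ j, ν j = q := fun ⟨j, hj⟩ => hν.2 j (hj ▸ hq)
    simp only [f, dif_neg h]
  have hinj : Set.InjOn f (B ∪ Set.range ν) := by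
    rintro x (hx | ⟨i, rfl⟩) y (hy | ⟨j, rfl⟩) h
    · rwa [hfB x hx, hfB y hy] at h
    · rw [hfB x hx, hfν] at h
      exact absurd (h ▸ hx) (hν'.2 j)
    · rw [hfB y hy, hfν] at h
      exact absurd (h ▸ hy) (hν'.2 i)
    · rw [hfν, hfν] at h
      rw [hν'.1 h]
  have hcomp : f ∘ ν = ν' := funext hfν
  rw [val, val, ← hcomp, Fam.map hP f (fun q hq => hfB q (hAB hq)) .nil ν, List.map_map]
  congr 1
  refine List.map_congr_left fun w hw => ?_
  rw [Function.comp_apply, norm_word_map]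
  · refine hinj.mono fun q hq => ?_
    rcases Finset.mem_union.1 (Finset.mem_coe.1 hq) with h | h
    · exact Set.union_subset_union_left _ hAB (hP.names hw q (by simpa using h))
    · exact .inl (hψ.names_subset q h)
  · exact fun q hq => hfB q (hψ.names_subset q hq)

theorem val_bind_shift (x : SM Data) (K : Data → Eff) (ν : ℕ → ℕ) (ψ : State) :
    (bind x K).val ν ψ =
      ((x ν).map fun b => (K b.val).val (fun i => ν (b.used + i)) (b.word.lin ψ)).sum := by
  rw [val, bind, sum_flatMap]
  congr 1
  refine List.map_congr_left fun b _ => ?_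
  rw [val, List.map_map]
  simp [Word.lin_append, Function.comp_def]

/-- A branch involves only the qubits of its input and those that it has allocated. -/
theorem branch_names {p : Prog} {d : Data} {B : Set ℕ} (hd : ∀ q ∈ d.names, q ∈ B)
    {ν : ℕ → ℕ} {b : Br Data} (hb : b ∈ sem p d ν) :
    (∀ q ∈ b.val.names, q ∈ B ∪ ν '' Set.Iio b.used) ∧
      ∀ q ∈ b.word.names, q ∈ B ∪ ν '' Set.Iio b.used := by
  obtain ⟨h1, h2⟩ := sem_linear p d ν b hb
  have h3 : ∀ q, q ∈ d.names ++ (List.range b.used).map ν → q ∈ B ∪ ν '' Set.Iio b.used := by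
    intro q hq
    rcases List.mem_append.1 hq with hq | hq
    · exact .inl (hd q hq)
    · obtain ⟨i, hi, rfl⟩ := List.mem_map.1 hq
      exact .inr ⟨i, by simpa using hi, rfl⟩
  exact ⟨fun q hq => h3 q (h1.subset hq), fun q hq => h3 q (h2 q hq)⟩

/-- In a sequential composition, the two processes may take their fresh qubits from arbitrary
disjoint streams. -/
theorem val_bind {A B : Set ℕ} {p : Prog} {d : Data} {K : Data → Eff} (hK : Fam A K)
    (hAB : A ⊆ B) (hd : ∀ q ∈ d.names, q ∈ B) {ψ : State} (hψ : ψ.SuppIn B) {ν ν₁ ν₂ : ℕ → ℕ}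
    (hν : Fresh ν B) (h₁ : Fresh ν₁ B) (h₂ : Fresh ν₂ (B ∪ Set.range ν₁)) :
    (bind (sem p d) K).val ν ψ =
      ((sem p d ν₁).map fun b => (K b.val).val ν₂ (b.word.lin ψ)).sum := by
  have hon : On B (bind (sem p d) K) := by
    have h1 : Fam B fun t => K t.fst := (hK.mono hAB).comp (Unif.id B).fst
    exact Fam.bind h1 p (Unif.const hd)
  rw [hon.val_eq subset_rfl hψ hν h₁, val_bind_shift]
  congr 1
  refine List.map_congr_left fun b hb => ?_
  obtain ⟨hv, hw⟩ := branch_names hd hb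
  refine (hK.on (hAB.trans Set.subset_union_left) hv).val_eq subset_rfl
    (State.SuppIn.word hw (hψ.mono Set.subset_union_left)) (h₁.shift _) (h₂.mono ?_)
  exact Set.union_subset_union_right _ (Set.image_subset_range _ _)

theorem sum_sum_comm {α β : Type} (l : List α) (m : List β) (g : α → β → ℝ) :
    (l.map fun a => (m.map fun b => g a b).sum).sum =
      (m.map fun b => (l.map fun a => g a b).sum).sum := by
  induction l with
  | nil => simp
  | cons a l ih => simp [ih, List.sum_map_add]

theorem word_comm {A B : Set ℕ} (h : Disjoint A B) {w w' : Word} (hw : ∀ q ∈ w.names, q ∈ A)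
    (hw' : ∀ q ∈ w'.names, q ∈ B) (ψ : State) : w.lin (w'.lin ψ) = w'.lin (w.lin ψ) :=
  LinearMap.congr_fun (commute_of_disjoint h (Word.lin_mem hw) (Word.lin_mem hw')).eq ψ

/-- A process on other qubits whose result is ignored has no influence. -/
theorem val_discard {A B : Set ℕ} {p : Prog} {d : Data} {P : Eff} (hP : On A P) (hAB : A ⊆ B)
    (hd : ∀ q ∈ d.names, q ∈ B \ A) {ψ : State} (hψ : ψ.SuppIn B) {ν ν₁ ν₂ : ℕ → ℕ}
    (hν : Fresh ν B) (h₁ : Fresh ν₁ B) (h₂ : Fresh ν₂ (B ∪ Set.range ν₁)) :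
    ((sem p d ν₁).map fun b => P.val ν₂ (b.word.lin ψ)).sum = P.val ν ψ := by
  have hdis : Disjoint (A ∪ Set.range ν₂) ((B \ A) ∪ Set.range ν₁) := by
    rw [Set.disjoint_left]
    rintro q (hq | ⟨i, rfl⟩) (hq' | ⟨j, hj⟩)
    · exact hq'.2 hq
    · exact h₁.2 j (hj ▸ hAB hq)
    · exact h₂.2 i (.inl hq'.1)
    · exact h₂.2 i (.inr ⟨j, hj⟩)
  rw [hP.val_eq hAB hψ hν (h₂.mono Set.subset_union_left)]
  -- All branches of the process commute with the words of the effect, and their weights sum to one.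
  simp only [val]
  rw [sum_sum_comm]
  congr 1
  refine List.map_congr_left fun w hw => ?_
  rw [← sem_complete p d ν₁ (w.lin ψ)]
  congr 1
  refine List.map_congr_left fun b hb => ?_
  obtain ⟨-, hb⟩ := branch_names hd hb
  rw [word_comm hdis (hP.names hw)
    fun q hq => Set.union_subset_union_right _ (Set.image_subset_range _ _) (hb q hq)]

/-- There are four disjoint infinite streams of unused names. -/
theorem exists_fresh (n : ℕ) : ∃ ν₁ ν₂ ν₃ ν₄ : ℕ → ℕ, Fresh ν₁ (Set.Iio n) ∧
    Fresh ν₂ (Set.Iio n ∪ Set.range ν₁) ∧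
    Fresh ν₃ (Set.Iio n ∪ Set.range ν₁ ∪ Set.range ν₂) ∧
    Fresh ν₄ (Set.Iio n ∪ Set.range ν₁ ∪ Set.range ν₂ ∪ Set.range ν₃) := by
  refine ⟨fun i => n + 4 * i, fun i => n + 4 * i + 1, fun i => n + 4 * i + 2,
    fun i => n + 4 * i + 3, ⟨fun a b h => ?_, fun i h => ?_⟩, ⟨fun a b h => ?_, fun i h => ?_⟩,
    ⟨fun a b h => ?_, fun i h => ?_⟩, ⟨fun a b h => ?_, fun i h => ?_⟩⟩
  all_goals simp at h <;> omega

/-- Two processes on disjoint sets of qubits may be run in either order. -/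
theorem val_swap {n : ℕ} {p q : Prog} {d e : Data} {T : Data → Eff} {A : Set ℕ} (hT : Fam A T)
    (hA : A ⊆ Set.Iio n) (hd : ∀ x ∈ d.names, x < n) (he : ∀ x ∈ e.names, x < n)
    (hde : d.names.Disjoint e.names) {ψ : State} (hψ : ψ.SuppIn (Set.Iio n)) :
    (bind (sem p d) fun a => bind (sem q e) fun b => T (.pair a b)).val (n + ·) ψ =
      (bind (sem q e) fun b => bind (sem p d) fun a => T (.pair a b)).val (n + ·) ψ := by
  obtain ⟨ν₁, ν₂, ν₃, -, h₁, h₂, h₃, -⟩ := exists_fresh n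
  have hT' := hT.mono hA
  have hsw : Fam (Set.Iio n) fun t => T (.pair t.snd t.fst) :=
    hT'.comp ((Unif.id _).snd.pair (Unif.id _).fst)
  have hK₁ : Fam (Set.Iio n) fun a => bind (sem q e) fun b => T (.pair a b) :=
    Fam.bind hsw q (Unif.const he)
  have hK₂ : Fam (Set.Iio n) fun b => bind (sem p d) fun a => T (.pair a b) :=
    Fam.bind hT' p (Unif.const hd)
  have h₂' : Fresh ν₂ (Set.Iio n) := h₂.mono Set.subset_union_left
  have h₁₂ : Fresh ν₁ (Set.Iio n ∪ Set.range ν₂) := by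
    refine ⟨h₁.1, fun i hi => ?_⟩
    rcases hi with hi | ⟨j, hj⟩
    · exact h₁.2 i hi
    · exact h₂.2 j (.inr ⟨i, hj.symm⟩)
  have h₃' : Fresh ν₃ (Set.Iio n ∪ Set.range ν₂ ∪ Set.range ν₁) := by
    rwa [Set.union_right_comm] at h₃
  rw [val_bind hK₁ subset_rfl hd hψ (fresh_add n) h₁ h₂,
    val_bind hK₂ subset_rfl he hψ (fresh_add n) h₂' h₁₂]
  have e₁ : ∀ a ∈ sem p d ν₁,
      (bind (sem q e) fun b => T (.pair a.val b)).val ν₂ (a.word.lin ψ) =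
        ((sem q e ν₂).map fun b => (T (.pair a.val b.val)).val ν₃
          (b.word.lin (a.word.lin ψ))).sum := by
    intro a ha
    obtain ⟨hv, hw⟩ := branch_names hd ha
    have hsub : Set.Iio n ∪ ν₁ '' Set.Iio a.used ⊆ Set.Iio n ∪ Set.range ν₁ :=
      Set.union_subset_union_right _ (Set.image_subset_range _ _)
    refine val_bind (A := Set.Iio n ∪ Set.range ν₁) (K := fun b => T (.pair a.val b))
      ((hT'.mono Set.subset_union_left).comp
        ((Unif.const fun x hx => hsub (hv x hx)).pair (Unif.id _))) subset_rfl
      (fun x hx => .inl (he x hx))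
      (State.SuppIn.word (fun x hx => hsub (hw x hx)) (hψ.mono Set.subset_union_left)) h₂ h₂ h₃
  have e₂ : ∀ b ∈ sem q e ν₂,
      (bind (sem p d) fun a => T (.pair a b.val)).val ν₁ (b.word.lin ψ) =
        ((sem p d ν₁).map fun a => (T (.pair a.val b.val)).val ν₃
          (a.word.lin (b.word.lin ψ))).sum := by
    intro b hb
    obtain ⟨hv, hw⟩ := branch_names he hb
    have hsub : Set.Iio n ∪ ν₂ '' Set.Iio b.used ⊆ Set.Iio n ∪ Set.range ν₂ :=
      Set.union_subset_union_right _ (Set.image_subset_range _ _)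
    refine val_bind (A := Set.Iio n ∪ Set.range ν₂) (K := fun a => T (.pair a b.val))
      ((hT'.mono Set.subset_union_left).comp
        ((Unif.id _).pair (Unif.const fun x hx => hsub (hv x hx)))) subset_rfl
      (fun x hx => .inl (hd x hx))
      (State.SuppIn.word (fun x hx => hsub (hw x hx)) (hψ.mono Set.subset_union_left)) h₁₂ h₁₂ h₃'
  rw [List.map_congr_left e₁, List.map_congr_left e₂, sum_sum_comm]
  congr 1
  refine List.map_congr_left fun b hb => ?_
  congr 1
  refine List.map_congr_left fun a ha => ?_
  have hdis : Disjoint ({x | x ∈ e.names} ∪ Set.range ν₂) ({x | x ∈ d.names} ∪ Set.range ν₁) := by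
    rw [Set.disjoint_left]
    rintro x (hx | ⟨i, rfl⟩) (hx' | ⟨j, hj⟩)
    · exact hde hx' hx
    · exact h₁.2 j (hj ▸ he x hx)
    · exact h₂.2 i (.inl (hd _ hx'))
    · exact h₂.2 i (.inr ⟨j, hj⟩)
  rw [word_comm hdis
    (fun x hx => Set.union_subset_union_right _ (Set.image_subset_range _ _)
      ((branch_names (B := {x | x ∈ e.names}) (fun _ h => h) hb).2 x hx))
    (fun x hx => Set.union_subset_union_right _ (Set.image_subset_range _ _)
      ((branch_names (B := {x | x ∈ d.names}) (fun _ h => h) ha).2 x hx))]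

/-- On a product state, an effect sees only its own factor. -/
theorem val_frame {A B : Set ℕ} {P : Eff} (hP : On A P) {ν : ℕ → ℕ} (hAB : Disjoint A B)
    (hν : Fresh ν B) {L : Module.End ℂ State} (hL : L ∈ localAlg A) {ψ : State}
    (hψ : ψ.SuppIn B) : P.val ν (L ψ) = ‖ψ‖ ^ 2 * P.val ν (L (ket ∅)) := by
  rw [val, val, ← List.sum_map_mul_left]
  congr 1
  refine List.map_congr_left fun w hw => ?_
  have hdis : Disjoint (A ∪ Set.range ν) B := by
    rw [Set.disjoint_union_left]
    refine ⟨hAB, Set.disjoint_left.2 ?_⟩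
    rintro _ ⟨i, rfl⟩ h
    exact hν.2 i h
  have := norm_word_frame hdis (K := w.lin * L)
    (mul_mem (Word.lin_mem (hP.names hw)) (localAlg_mono Set.subset_union_left hL)) hψ
  simpa using this

/-- Renaming datum, fresh qubits and state simultaneously preserves the probability. -/
theorem val_rename {A : Set ℕ} {K : Data → Eff} (hK : Fam A K) {σ : Equiv.Perm ℕ}
    (hσ : ∀ q ∈ A, σ q = q) (a : Data) (ν : ℕ → ℕ) (ψ : State) :
    (K (a.map σ)).val (σ ∘ ν) (rename σ ψ) = (K a).val ν ψ := by
  rw [val, hK.map σ hσ, List.map_map, val]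
  congr 1
  refine List.map_congr_left fun w _ => ?_
  rw [Function.comp_apply, ← Module.End.mul_apply, ← rename_word, Module.End.mul_apply,
    norm_rename]

end Eff

namespace Data

theorem fst_pair (a b : Data) : (Data.pair a b).fst = a := rfl

theorem snd_pair (a b : Data) : (Data.pair a b).snd = b := rfl

end Data

/-! ### Expectations -/

namespace SM

variable {α β : Type}

/-- The sum of `F` over the branches of a process that is started on `ψ` when the first `n` qubits
are in use. -/
def exp (x : SM α) (F : α → ℕ → State → ℝ) (n : ℕ) (ψ : State) : ℝ :=
  ((x (n + ·)).map fun b => F b.val (n + b.used) (b.word.lin ψ)).sum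

theorem exp_ret (c : ℕ) (a : α) (F : α → ℕ → State → ℝ) (n : ℕ) (ψ : State) :
    (ret c a).exp F n ψ = F a n ψ := by simp [exp, ret, Word.lin]

/-- Expectations compose backwards, like weakest preconditions. -/
theorem exp_bind (x : SM α) (k : α → SM β) (F : β → ℕ → State → ℝ) (n : ℕ) (ψ : State) :
    (x.bind k).exp F n ψ = x.exp (fun a => (k a).exp F) n ψ := by
  rw [exp, bind, sum_flatMap, exp]
  congr 1
  refine List.map_congr_left fun b _ => ?_
  rw [exp, List.map_map]
  simp [Br.andThen, Word.lin_append, Function.comp_def, add_assoc]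

theorem exp_ret' (c : ℕ) (a : α) (F : α → ℕ → State → ℝ) : (ret c a).exp F = F a :=
  funext fun n => funext fun ψ => exp_ret c a F n ψ

theorem exp_bind' (x : SM α) (k : α → SM β) (F : β → ℕ → State → ℝ) :
    (x.bind k).exp F = x.exp fun a => (k a).exp F :=
  funext fun n => funext fun ψ => exp_bind x k F n ψ

theorem exp_congr {x : SM α} {F G : α → ℕ → State → ℝ} {n : ℕ} {ψ : State}
    (h : ∀ b ∈ x (n + ·), F b.val (n + b.used) (b.word.lin ψ) =
      G b.val (n + b.used) (b.word.lin ψ)) : x.exp F n ψ = x.exp G n ψ :=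
  congrArg List.sum (List.map_congr_left h)

theorem exp_iter_succ (f : Data → SM Data) (N : ℕ) (d : Data) (F : Data → ℕ → State → ℝ) (n : ℕ)
    (ψ : State) : (iter f (N + 1) d).exp F n ψ = (iter f N d).exp (fun e => (f e).exp F) n ψ := by
  induction N generalizing d n ψ with
  | zero => simp only [iter, exp_bind', exp_ret']
  | succ N ih =>
    rw [iter, exp_bind, iter, exp_bind]
    congr 1
    funext a m φ
    exact ih a m φ

/-- Runs a process on each element of a list. -/
def mapM (f : α → SM β) : List α → SM (List β)
  | [] => ret 0 []
  | a :: l => bind (f a) fun b => bind (mapM f l) fun bs => ret 0 (b :: bs)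

end SM

theorem Impl.mapM {α β : Type} {f : α → QM β} {F : α → SM β} (h : ∀ a, Impl (f a) (F a))
    (l : List α) : Impl (l.mapM f) (SM.mapM F l) := by
  induction l with
  | nil => exact Impl.pure []
  | cons a l ih =>
    rw [List.mapM_cons]
    exact (h a).bind fun b => ih.bind fun bs => Impl.pure _

open Classical in
theorem Impl.prob_eq {α : Type} {x : QM α} {X : SM α} (h : Impl x X) (μ : Mem) (E : α → Prop) :
    prob x μ E = X.exp (fun a _ φ => if E a then ‖φ‖ ^ 2 else 0) μ.next μ.amp := by
  rw [prob, h μ, List.map_map, SM.exp]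
  congr 1
  refine List.map_congr_left fun b _ => ?_
  simp [State.normSq_eq]

section expProg

open Data

variable (F : Data → ℕ → State → ℝ) (n : ℕ) (ψ : State)

theorem exp_comp (g f : Prog) (d : Data) :
    (sem (.comp g f) d).exp F n ψ = (sem f d).exp (fun e => (sem g e).exp F) n ψ := by
  simp only [sem, SM.exp_bind, SM.exp_ret]

theorem exp_par (f g : Prog) (d : Data) :
    (sem (.par f g) d).exp F n ψ =
      (sem f d.fst).exp (fun a => (sem g d.snd).exp fun b => F (pair a b)) n ψ := by
  simp only [sem, SM.exp_bind', SM.exp_ret']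

theorem exp_id (d : Data) : (sem .id d).exp F n ψ = F d n ψ := SM.exp_ret ..

theorem exp_nil (d : Data) : (sem .nil d).exp F n ψ = F .nil n ψ := SM.exp_ret ..

theorem exp_fst (d : Data) : (sem .fst d).exp F n ψ = F d.fst n ψ := SM.exp_ret ..

theorem exp_snd (d : Data) : (sem .snd d).exp F n ψ = F d.snd n ψ := SM.exp_ret ..

theorem exp_swap (d : Data) : (sem .swap d).exp F n ψ = F (pair d.snd d.fst) n ψ := SM.exp_ret ..

theorem exp_assoc (d : Data) :
    (sem .assoc d).exp F n ψ = F (pair d.fst.fst (pair d.fst.snd d.snd)) n ψ := SM.exp_ret ..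

theorem exp_dup (d : Data) : (sem .dup d).exp F n ψ = F (pair d d.classical) n ψ := SM.exp_ret ..

theorem exp_size (d : Data) : (sem .size d).exp F n ψ = F (ofNat d.size) n ψ := SM.exp_ret ..

theorem exp_loop (f : Prog) (d : Data) : (sem (.loop f) d).exp F n ψ =
    (SM.iter (fun e => sem f e) d.fst.toList.length d.snd).exp F n ψ := by
  simp only [sem, SM.exp_bind, SM.exp_ret]

theorem exp_ite (f g : Prog) (d : Data) : (sem (.ite f g) d).exp F n ψ =
    (match d.fst with
      | Data.nil => (sem g d).exp F n ψ
      | _ => (sem f d).exp F n ψ) := by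
  simp only [sem, SM.exp_bind, SM.exp_ret]
  cases d.fst <;> rfl

end expProg

/-! ### Programs -/

namespace Prog

/-- Regroups `(a, (b, c))` as `((a, b), c)`. -/
def unassoc : Prog := .comp .swap (.comp .assoc (.comp .swap (.comp .assoc .swap)))

/-- Returns the outcome of a fair coin toss, together with the qubit that has been measured. -/
def coin : Prog := .comp .meas (.comp .gateH .new)

/-- Pairs a datum with `nil`. -/
def pairNil : Prog := .comp (.par .id .nil) .dup

/-- Returns a fixed classical datum. -/
def const : Data → Prog
  | .pair a b => .par (const a) (const b)
  | _ => .nil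

/-- Pushes a copy of the first component on the list in the second one. -/
def push : Prog := .comp .assoc (.par .dup .id)

/-- Maps the unary number `k` to `2 * k ^ 2 + 2 * k + 1`, which is the size of a list of `k` copies
of it. -/
def square : Prog :=
  .comp .size (.comp .snd (.comp (.loop push) (.comp (.par .id pairNil) .dup)))

/-- The `c`-th iterate of `square`. -/
def big : ℕ → Prog
  | 0 => .id
  | c + 1 => .comp square (big c)

/-- Tosses a coin; pushes the measured qubit, as a message, on the list in the first component and
the outcome on the list in the second one. -/
def messageStep : Prog :=
  .comp (.par (.comp (.par .dup .id) .swap) .id) (.comp unassoc (.comp (.par .id .swap)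
    (.comp (.par .id (.par .swap .id)) (.comp (.par .id unassoc) (.comp .assoc
      (.comp (.par .id coin) .dup))))))

/-- Tosses a coin; on heads drops the first element of both lists. -/
def dropStep : Prog :=
  .comp (.ite (.comp (.par .snd .snd) .snd) .snd) (.comp (.par .fst .id) (.comp .swap
    (.comp (.par .id coin) .dup)))

/-- Maps `(n, d)` to `d` if the size of `d` is less than the value of `big c` at `n`, and to `nil`
otherwise. -/
def trunc (c : ℕ) : Prog :=
  .comp (.ite .snd .nil) (.comp (.par (.comp (.loop .snd) .swap) .id) (.comp unassoc
    (.comp (.par .id .swap) (.par (big c) (.comp (.par .id .size) .dup)))))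

/-- Maps `(n, (l, l'))`, where `l` and `l'` are lists, to the elements of the lists at the same
random position. -/
def pick (c : ℕ) : Prog :=
  .comp (.par .fst .fst) (.comp (.loop dropStep) (.par (.comp .snd (big c)) .id))

/-- Decrypts, measures the first qubit of the result and returns the outcome. -/
def test (dec : Prog) : Prog := .comp .fst (.comp .meas (.comp .fst dec))

/-- Compares two bits. -/
def same : Prog :=
  .ite (.comp (.ite (.par .nil .nil) .nil) .swap) (.comp (.ite .nil (.par .nil .nil)) .swap)

/-- Maps `(n, (key, (cts, st)))` to `(n, (key', (cts, st)))`, where `key'` is the truncated key. -/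
def shorten (c : ℕ) : Prog :=
  .comp (.par .id (.par (trunc c) .id)) (.comp (.par .id unassoc) (.comp .assoc (.par .dup .id)))

/-- Maps `(n, (key, (cts, st)))` to `(n, (key, (ct, m)))`, where `ct` and `m` are the elements of
`cts` and `st` at the same random position. -/
def select (c : ℕ) : Prog :=
  .comp (.par .id (.comp (.par .id (pick c)) (.comp .assoc (.comp (.par .swap .id) unassoc))))
    (.comp .assoc (.par .dup .id))

/-- Maps `(n, (key, (ct, m)))` to the bit that tells whether `ct` decrypts to `m`. -/
def verify (dec : Prog) : Prog :=
  .comp same (.comp (.par (test dec) .id) (.comp unassoc (.par .id unassoc)))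

/-- The last part of the attack: given a functional key that is not too long, decrypts the
ciphertext at a random position and compares the result with the message. -/
def finish (c c' : ℕ) (dec : Prog) : Prog :=
  .comp (verify dec) (.comp (select c') (shorten c))

end Prog

/-- The number computed by `Prog.square`. -/
def sqFun (k : ℕ) : ℕ := 2 * k ^ 2 + 2 * k + 1

open Prog Data

section expPrograms

variable (F : Data → ℕ → State → ℝ) (n : ℕ) (ψ : State)

theorem exp_unassoc (d : Data) : (sem unassoc d).exp F n ψ =
    F (pair (pair d.fst d.snd.fst) d.snd.snd) n ψ := by
  simp [unassoc, exp_comp, exp_swap, exp_assoc, Data.fst, Data.snd]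

theorem exp_const (d e : Data) (h : d.names = []) : (sem (const d) e).exp F n ψ = F d n ψ := by
  induction d generalizing e F with
  | nil => exact exp_nil ..
  | qubit q => simp [names] at h
  | pair a b iha ihb =>
    simp only [names, List.append_eq_nil_iff] at h
    rw [const, exp_par, iha _ _ h.1, ihb _ _ h.2]

theorem classical_eq_self {d : Data} (h : d.names = []) : d.classical = d := by
  induction d <;> simp_all [names, classical]

theorem exp_square (k : ℕ) : (sem square (ofNat k)).exp F n ψ = F (ofNat (sqFun k)) n ψ := by
  have hcl : (ofNat k).classical = ofNat k := classical_eq_self (names_ofNat k)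
  have hloop : ∀ (j : ℕ) (F : Data → ℕ → State → ℝ),
      (SM.iter (fun e => sem push e) j (pair (ofNat k) Data.nil)).exp F n ψ =
        F (pair (ofNat k) (ofList (List.replicate j (ofNat k)))) n ψ := by
    intro j
    induction j with
    | zero => intro F; exact SM.exp_ret ..
    | succ j ih =>
      intro F
      rw [SM.exp_iter_succ, ih]
      simp [push, exp_comp, exp_par, exp_dup, exp_id, exp_assoc, Data.fst, Data.snd, hcl,
        List.replicate_succ, ofList]
  have hsize : ∀ j, (ofList (List.replicate j (ofNat k))).size = 1 + j * (2 * k + 2) := by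
    intro j
    induction j with
    | zero => simp [ofList, Data.size]
    | succ j ih => rw [List.replicate_succ, ofList, Data.size, ih, size_ofNat]; ring
  simp only [square, pairNil, exp_comp, exp_par, exp_dup, exp_id, exp_nil, Data.fst, Data.snd,
    hcl, exp_loop, toList_ofNat, hloop, exp_snd, exp_size, hsize, sqFun]
  congr 2; ring

theorem exp_big (c k : ℕ) : (sem (big c) (ofNat k)).exp F n ψ = F (ofNat (sqFun^[c] k)) n ψ := by
  induction c generalizing F with
  | zero => exact exp_id ..
  | succ c ih => rw [big, exp_comp, ih, exp_square, Function.iterate_succ_apply']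

/-- Iterating `snd` decrements a unary number, which serves to compare two of them. -/
theorem iter_snd (k j : ℕ) (F : Data → ℕ → State → ℝ) :
    (SM.iter (fun e => sem .snd e) j (ofNat k)).exp F n ψ = F (ofNat (k - j)) n ψ := by
  induction j generalizing F with
  | zero => exact SM.exp_ret ..
  | succ j ih =>
    rw [SM.exp_iter_succ, ih, exp_snd]
    congr 1
    rw [Nat.sub_succ']
    cases k - j <;> rfl

/-- The key, replaced by `nil` if it is too long. -/
def cut (B : ℕ) (d : Data) : Data := if d.size < B then d else .nil

theorem exp_trunc (c k : ℕ) (d : Data) : (sem (trunc c) (pair (ofNat k) d)).exp F n ψ =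
    F (cut (sqFun^[c] k) d) n ψ := by
  simp only [trunc, exp_comp, exp_par, exp_dup, exp_id, exp_size, exp_big, exp_swap, exp_unassoc,
    exp_loop, Data.fst, Data.snd, size_classical, toList_ofNat, iter_snd, exp_ite, exp_snd,
    exp_nil, cut]
  split_ifs with h
  · obtain ⟨j, hj⟩ := Nat.exists_eq_succ_of_ne_zero (Nat.sub_ne_zero_of_lt h)
    rw [hj]; rfl
  · rw [Nat.sub_eq_zero_of_le (not_lt.1 h)]; rfl

theorem exp_coin (d : Data) : (sem coin d).exp F n ψ =
    F (pair (bit false) (qubit n)) (n + 1) (proj n false (hadamard n ψ)) +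
      F (pair (bit true) (qubit n)) (n + 1) (proj n true (hadamard n ψ)) := by
  simp [coin, SM.exp, sem, SM.bind, SM.ret, Br.andThen, Word.lin, Op.lin]

theorem exp_messageStep (d : Data) : (sem messageStep d).exp F n ψ =
    F (pair (pair (pair (qubit n) Data.nil) d.fst) (pair (bit false) d.snd)) (n + 1)
      (proj n false (hadamard n ψ)) +
    F (pair (pair (pair (qubit n) Data.nil) d.fst) (pair (bit true) d.snd)) (n + 1)
      (proj n true (hadamard n ψ)) := by
  simp [messageStep, exp_comp, exp_par, exp_dup, exp_id, exp_coin, exp_assoc, exp_unassoc,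
    exp_swap, Data.fst, Data.snd, Data.classical]

theorem exp_dropStep (d : Data) : (sem dropStep d).exp F n ψ =
    F d (n + 1) (proj n false (hadamard n ψ)) +
    F (pair d.fst.snd d.snd.snd) (n + 1) (proj n true (hadamard n ψ)) := by
  simp [dropStep, exp_comp, exp_par, exp_dup, exp_id, exp_coin, exp_swap, exp_fst, exp_snd,
    exp_ite, Data.fst, Data.snd, bit]

/-- Are both data `nil`, or none of them? -/
def agree : Data → Data → Bool
  | .nil, .nil => true
  | .nil, _ => false
  | _, .nil => false
  | _, _ => true

theorem exp_same (a b : Data) : (sem same (pair a b)).exp F n ψ = F (bit (agree a b)) n ψ := by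
  cases a <;> cases b <;>
  simp [same, exp_comp, exp_par, exp_nil, exp_swap, exp_ite, Data.fst, Data.snd, bit, agree]

/-! ### Coin tosses -/

/-- The result of iterating `g`, where `m` is the set of the rounds in which the coin shows heads
and the coin of round `j` is the qubit `n + j`. -/
def tosses (g : Bool → ℕ → Data → Data) (n : ℕ) (m : Finset ℕ) : ℕ → Data → Data
  | 0, d => d
  | k + 1, d => g (decide (k ∈ m)) (n + k) (tosses g n m k d)

theorem tosses_congr {g : Bool → ℕ → Data → Data} {n : ℕ} {m m' : Finset ℕ} {k : ℕ}
    (h : ∀ j < k, j ∈ m ↔ j ∈ m') (d : Data) : tosses g n m k d = tosses g n m' k d := by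
  induction k with
  | zero => rfl
  | succ k ih =>
    rw [tosses, tosses, ih fun j hj => h j (by omega)]
    simp only [h k (by omega)]

/-- The qubits of the coins that show heads. -/
def coinSet (n : ℕ) (m : Finset ℕ) : Finset ℕ := m.map (addLeftEmbedding n)

/-- A coin toss on a fresh qubit leaves the state of the others unchanged. -/
theorem proj_hadamard {ψ : State} {n : ℕ} (hψ : ψ.SuppIn (Set.Iio n)) (b : Bool) :
    proj n b (hadamard n ψ) =
      ((√2 : ℝ) : ℂ)⁻¹ • flip (if b then {n} else ∅) ψ := by
  have h0 : proj n false ψ = ψ ∧ proj n true ψ = 0 := by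
    constructor <;> ext s <;> rw [proj_apply]
    all_goals
      by_cases hs : s ∈ ψ.support
      · have : n ∉ s := fun h => by simpa using hψ s hs n h
        simp [this]
      · simp [Finsupp.notMem_support_iff.1 hs]
  have hpf : ∀ c, proj n c (flip {n} ψ) = flip {n} (proj n (!c) ψ) := fun c =>
    LinearMap.congr_fun (proj_mul_flip_singleton n c) ψ
  rw [hadamard_eq]
  simp only [LinearMap.smul_apply, LinearMap.sub_apply, LinearMap.add_apply, map_smul, map_add,
    h0.1, h0.2, sub_zero, hpf]
  cases b <;> simp [h0.1, h0.2, flip_empty]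

theorem SuppIn_flip {A : Set ℕ} {ψ : State} (h : ψ.SuppIn A) {t : Finset ℕ}
    (ht : ∀ q ∈ t, q ∈ A) : (flip t ψ).SuppIn A := State.SuppIn.apply (flip_mem ht) h

/-- A loop with one coin toss per round, summed over the outcomes. -/
theorem exp_iter_coin {f : Data → SM Data} {g : Bool → ℕ → Data → Data}
    (hf : ∀ d (F : Data → ℕ → State → ℝ) n ψ, (f d).exp F n ψ =
      F (g false n d) (n + 1) (proj n false (hadamard n ψ)) +
      F (g true n d) (n + 1) (proj n true (hadamard n ψ)))
    {ψ : State} {n : ℕ} (hψ : ψ.SuppIn (Set.Iio n)) (N : ℕ) (d : Data)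
    (F : Data → ℕ → State → ℝ) : (SM.iter f N d).exp F n ψ =
      ∑ m ∈ (Finset.range N).powerset, F (tosses g n m N d) (n + N)
        (((√2 : ℝ) : ℂ)⁻¹ ^ N • flip (coinSet n m) ψ) := by
  induction N generalizing F with
  | zero => simp [SM.iter, SM.exp_ret, tosses, coinSet, flip_empty]
  | succ N ih =>
    rw [SM.exp_iter_succ, ih, Finset.range_add_one,
      Finset.sum_powerset_insert Finset.notMem_range_self, ← Finset.sum_add_distrib]
    refine Finset.sum_congr rfl fun m hm => ?_
    have hmN : ∀ j ∈ m, j < N := fun j hj => by simpa using Finset.mem_powerset.1 hm hj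
    have hN : N ∉ m := fun h => lt_irrefl _ (hmN N h)
    have hsupp : (((√2 : ℝ) : ℂ)⁻¹ ^ N • flip (coinSet n m) ψ).SuppIn (Set.Iio (n + N)) := by
      refine State.SuppIn.smul _ (SuppIn_flip (hψ.mono (Set.Iio_subset_Iio (by omega))) ?_)
      intro q hq
      obtain ⟨j, hj, rfl⟩ := Finset.mem_map.1 hq
      have := hmN j hj
      simp [addLeftEmbedding]; omega
    have hset : symmDiff {n + N} (coinSet n m) = coinSet n (insert N m) := by
      have hn : n + N ∉ coinSet n m := by
        intro h
        obtain ⟨j, hj, h⟩ := Finset.mem_map.1 h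
        have := hmN j hj
        simp [addLeftEmbedding] at h; omega
      rw [coinSet, coinSet, Finset.map_insert]
      ext x
      simp only [Finset.mem_symmDiff, Finset.mem_insert, Finset.mem_singleton]
      have : addLeftEmbedding n N = n + N := rfl
      rw [this]
      constructor
      · tauto
      · rintro (rfl | h)
        · exact .inl ⟨rfl, hn⟩
        · exact .inr ⟨h, fun e => hn (e ▸ h)⟩
    rw [hf, proj_hadamard hsupp, proj_hadamard hsupp]
    simp only [map_smul, Bool.false_eq_true, if_false, if_true, flip_empty, Module.End.one_apply]
    rw [← Module.End.mul_apply (flip {n + N}), flip_mul, hset, smul_smul, smul_smul, ← pow_succ',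
      tosses, tosses, tosses_congr (m := insert N m) (m' := m)]
    · simp [hN, add_assoc]
    · intro j hj
      simp [hj.ne]

end expPrograms

/-! ### Polynomial running time -/

theorem poly_mono (P : Polynomial ℕ) {a b : ℕ} (h : a ≤ b) : P.eval a ≤ P.eval b := by
  rw [Polynomial.eval_eq_sum, Polynomial.eval_eq_sum]
  exact Finset.sum_le_sum fun i _ => Nat.mul_le_mul_left _ (Nat.pow_le_pow_left h i)

/-- Polynomial running time in terms of the symbolic semantics. -/
def Prog.Poly (p : Prog) : Prop :=
  ∃ P : Polynomial ℕ, ∀ d ν, ∀ b ∈ sem p d ν, b.cost ≤ P.eval d.size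

theorem exists_lt_names (l : List ℕ) : ∃ n, ∀ q ∈ l, q < n :=
  ⟨l.sum + 1, fun _ hq => Nat.lt_succ_of_le (List.le_sum_of_mem hq)⟩

theorem Prog.isQPT_iff (p : Prog) : p.IsQPT ↔ p.Poly := by
  constructor
  · rintro ⟨P, hP⟩
    refine ⟨P, fun d ν b hb => ?_⟩
    -- The number of steps does not depend on the names of the fresh qubits.
    obtain ⟨n, hn⟩ := exists_lt_names d.names
    let f : ℕ → ℕ := fun i => if i < n then i else ν (i - n)
    have hd : d.map f = d := map_eq_self fun q hq => by simp [f, hn q hq]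
    have hν : f ∘ (n + ·) = ν := by
      funext i; simp [f]
    rw [← hd, ← hν, sem_map] at hb
    obtain ⟨b', hb', rfl⟩ := List.mem_map.1 hb
    have := hP d ⟨n, 0, 0⟩
    rw [impl_eval] at this
    have := this _ (List.mem_map.2 ⟨b', hb', rfl⟩)
    simpa [Br.map] using this
  · rintro ⟨P, hP⟩
    refine ⟨P, fun d μ o ho => ?_⟩
    rw [impl_eval] at ho
    obtain ⟨b, hb, rfl⟩ := List.mem_map.1 ho
    have := hP d _ b hb
    simpa using this

namespace Prog.Poly

theorem mem_bind {α β : Type} {x : SM α} {k : α → SM β} {ν : ℕ → ℕ} {b : Br β}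
    (hb : b ∈ x.bind k ν) : ∃ b₁ ∈ x ν, ∃ b₂ ∈ k b₁.val fun i => ν (b₁.used + i),
      b = b₁.andThen b₂ := by
  simp only [SM.bind, List.mem_flatMap, List.mem_map] at hb
  obtain ⟨b₁, h₁, b₂, h₂, rfl⟩ := hb
  exact ⟨b₁, h₁, b₂, h₂, rfl⟩

theorem mem_ret_bind {β : Type} {c : ℕ} {d : Data} {k : Data → SM β} {ν : ℕ → ℕ} {b : Br β}
    (hb : b ∈ (SM.ret c d).bind k ν) : ∃ b₂ ∈ k d ν, b.val = b₂.val ∧ b.cost = c + b₂.cost := by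
  obtain ⟨b₁, h₁, b₂, h₂, rfl⟩ := mem_bind hb
  simp only [SM.ret, List.mem_singleton] at h₁
  subst h₁
  simp only [Nat.zero_add] at h₂
  exact ⟨b₂, h₂, rfl, rfl⟩

theorem ret {p : Prog} (c : ℕ) (g : Data → Data) (h : ∀ d, ∃ k ≤ c, sem p d = SM.ret k (g d)) :
    p.Poly := by
  refine ⟨Polynomial.C c, fun d ν b hb => ?_⟩
  obtain ⟨k, hk, e⟩ := h d
  rw [e] at hb
  simp only [SM.ret, List.mem_singleton] at hb
  subst hb
  simpa using hk

theorem id : Prog.id.Poly := ret 1 (fun d => d) fun _ => ⟨1, le_rfl, rfl⟩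
theorem nil : Prog.nil.Poly := ret 1 (fun _ => .nil) fun _ => ⟨1, le_rfl, rfl⟩
theorem fst : Prog.fst.Poly := ret 1 Data.fst fun _ => ⟨1, le_rfl, rfl⟩
theorem snd : Prog.snd.Poly := ret 1 Data.snd fun _ => ⟨1, le_rfl, rfl⟩
theorem swap : Prog.swap.Poly := ret 1 (fun d => .pair d.snd d.fst) fun _ => ⟨1, le_rfl, rfl⟩
theorem assoc : Prog.assoc.Poly :=
  ret 1 (fun d => .pair d.fst.fst (.pair d.fst.snd d.snd)) fun _ => ⟨1, le_rfl, rfl⟩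

theorem dup : Prog.dup.Poly := by
  refine ⟨1 + Polynomial.X, fun d ν b hb => ?_⟩
  simp only [sem, SM.ret, List.mem_singleton] at hb
  subst hb
  simp

theorem size : Prog.size.Poly := by
  refine ⟨1 + Polynomial.X, fun d ν b hb => ?_⟩
  simp only [sem, SM.ret, List.mem_singleton] at hb
  subst hb
  simp

theorem coin : Prog.coin.Poly := by
  refine ⟨5, fun d ν b hb => ?_⟩
  simp [Prog.coin, sem, SM.bind, SM.ret, Br.andThen] at hb
  rcases hb with rfl | rfl <;> simp

theorem meas : Prog.meas.Poly := by
  refine ⟨1, fun d ν b hb => ?_⟩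
  cases d <;> simp [sem, SM.ret] at hb
  case qubit => rcases hb with rfl | rfl <;> simp
  all_goals subst hb; simp

theorem comp {f g : Prog} (hg : g.Poly) (hf : f.Poly) : (Prog.comp g f).Poly := by
  obtain ⟨P, hP⟩ := hf
  obtain ⟨Q, hQ⟩ := hg
  refine ⟨1 + P + Q.comp (Polynomial.X + 4 * P), fun d ν b hb => ?_⟩
  obtain ⟨b', hb', -, hc⟩ := mem_ret_bind hb
  obtain ⟨b₁, h₁, b₂, h₂, rfl⟩ := mem_bind hb'
  have e₁ := hP d _ b₁ h₁
  have e₂ := hQ _ _ b₂ h₂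
  have e₃ := sem_sized f d _ b₁ h₁
  have e₄ := poly_mono Q (show b₁.val.size ≤ d.size + 4 * P.eval d.size by omega)
  have e₅ : ((4 : Polynomial ℕ)).eval d.size = 4 := by
    simp
  simp only [hc, Br.andThen, Polynomial.eval_add, Polynomial.eval_one, Polynomial.eval_comp,
    Polynomial.eval_mul, Polynomial.eval_X, e₅]
  omega

theorem size_fst_le (d : Data) : d.fst.size ≤ d.size := by
  have := size_fst_snd d; have := d.snd.size_pos; omega

theorem size_snd_le (d : Data) : d.snd.size ≤ d.size := by
  have := size_fst_snd d; have := d.fst.size_pos; omega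

theorem par {f g : Prog} (hf : f.Poly) (hg : g.Poly) : (Prog.par f g).Poly := by
  obtain ⟨P, hP⟩ := hf
  obtain ⟨Q, hQ⟩ := hg
  refine ⟨1 + P + Q, fun d ν b hb => ?_⟩
  obtain ⟨b', hb', -, hc⟩ := mem_ret_bind hb
  obtain ⟨b₁, h₁, b₂, h₂, rfl⟩ := mem_bind hb'
  obtain ⟨b₃, h₃, b₄, h₄, rfl⟩ := mem_bind h₂
  simp only [SM.ret, List.mem_singleton] at h₄
  subst h₄
  have e₁ := (hP _ _ b₁ h₁).trans (poly_mono P (size_fst_le d))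
  have e₂ := (hQ _ _ b₃ h₃).trans (poly_mono Q (size_snd_le d))
  simp only [hc, Br.andThen, Polynomial.eval_add, Polynomial.eval_one]
  omega

theorem ite {f g : Prog} (hf : f.Poly) (hg : g.Poly) : (Prog.ite f g).Poly := by
  obtain ⟨P, hP⟩ := hf
  obtain ⟨Q, hQ⟩ := hg
  refine ⟨1 + P + Q, fun d ν b hb => ?_⟩
  obtain ⟨b', hb', -, hc⟩ := mem_ret_bind hb
  simp only [hc, Polynomial.eval_add, Polynomial.eval_one]
  cases hd : d.fst <;> simp only [hd] at hb'
  · have := hQ _ _ b' hb'; omega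
  all_goals have := hP _ _ b' hb'; omega

/-- In every round of a loop with this body, the datum grows by a quantity that was fixed at the
beginning. -/
def Grows (f : Prog) : Prop := ∃ (φ : Data → ℕ) (c : ℕ), (∀ d, φ d ≤ d.size) ∧
  ∀ d ν, ∀ b ∈ sem f d ν, φ b.val ≤ φ d ∧ b.val.size ≤ d.size + φ d + c

/-- A loop runs in polynomial time if its body does and the datum grows linearly in the number of
rounds. -/
theorem loop {f : Prog} (hf : f.Poly) (h : Grows f) : (Prog.loop f).Poly := by
  obtain ⟨P, hP⟩ := hf
  obtain ⟨φ, c, hφ, hg⟩ := h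
  have key : ∀ (k : ℕ) (d : Data) (s : ℕ) (ν : ℕ → ℕ), d.size + k * (φ d + c) ≤ s →
      ∀ b ∈ SM.iter (fun e => sem f e) k d ν, b.cost ≤ k * P.eval s := by
    intro k
    induction k with
    | zero =>
      intro d s ν _ b hb
      simp only [SM.iter, SM.ret, List.mem_singleton] at hb
      subst hb; simp
    | succ k ih =>
      intro d s ν hs b hb
      obtain ⟨b₁, h₁, b₂, h₂, rfl⟩ := mem_bind hb
      obtain ⟨g₁, g₂⟩ := hg d ν b₁ h₁
      have e₁ := (hP d ν b₁ h₁).trans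
        (poly_mono P (show d.size ≤ s from (Nat.le_add_right _ _).trans hs))
      have e₂ := ih b₁.val s _ (by
        have : k * (φ b₁.val + c) ≤ k * (φ d + c) := Nat.mul_le_mul_left _ (by omega)
        have h3 : (k + 1) * (φ d + c) = k * (φ d + c) + (φ d + c) := by ring
        omega) b₂ h₂
      simp only [Br.andThen, Nat.succ_mul]
      omega
  refine ⟨1 + Polynomial.X + Polynomial.X * P.comp (Polynomial.X + Polynomial.X *
    (Polynomial.X + Polynomial.C c)), fun d ν b hb => ?_⟩
  obtain ⟨b', hb', -, hc⟩ := mem_ret_bind hb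
  have hl : d.fst.toList.length ≤ d.size := (length_toList_le _).trans (size_fst_le d)
  have e := key _ d.snd (d.size + d.size * (d.size + c)) ν (by
    have h1 := size_snd_le d
    have h2 := hφ d.snd
    gcongr
    omega) b' hb'
  have e' := Nat.mul_le_mul_right (P.eval (d.size + d.size * (d.size + c))) hl
  simp only [hc, Polynomial.eval_add, Polynomial.eval_one, Polynomial.eval_comp,
    Polynomial.eval_mul, Polynomial.eval_X, Polynomial.eval_C]
  omega

theorem unassoc : Prog.unassoc.Poly := swap.comp (assoc.comp (swap.comp (assoc.comp swap)))

theorem const (d : Data) : (Prog.const d).Poly := by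
  induction d with
  | pair a b iha ihb => exact iha.par ihb
  | _ => exact nil

theorem grows_push : Grows push := by
  refine ⟨fun d => d.fst.size, 3, size_fst_le, fun d ν b hb => ?_⟩
  simp [push, sem, SM.bind, SM.ret, Br.andThen, Data.fst_pair, Data.snd_pair] at hb
  subst hb
  have := size_fst_snd d
  simp only [Data.fst_pair, Data.size, size_classical]
  omega

theorem grows_snd : Grows .snd := by
  refine ⟨fun _ => 0, 0, fun _ => Nat.zero_le _, fun d ν b hb => ?_⟩
  simp [sem, SM.ret] at hb
  subst hb
  simpa using size_snd_le d

theorem grows_messageStep : Grows messageStep := by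
  refine ⟨fun _ => 0, 20, fun _ => Nat.zero_le _, fun d ν b hb => ?_⟩
  have := size_fst_snd d
  simp [messageStep, Prog.unassoc, Prog.coin, sem, SM.bind, SM.ret, Br.andThen, Data.fst_pair,
    Data.snd_pair, Data.classical] at hb
  rcases hb with rfl | rfl <;> simp [Data.size, bit] <;> omega

theorem grows_dropStep : Grows dropStep := by
  refine ⟨fun _ => 0, 20, fun _ => Nat.zero_le _, fun d ν b hb => ?_⟩
  have := size_fst_snd d
  have := size_snd_le d.fst
  have := size_snd_le d.snd
  simp [dropStep, Prog.coin, sem, SM.bind, SM.ret, Br.andThen, Data.fst_pair,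
    Data.snd_pair, bit] at hb
  rcases hb with rfl | rfl <;> simp [Data.size]; omega

theorem square : Prog.square.Poly :=
  size.comp (snd.comp ((loop (assoc.comp (dup.par id)) grows_push).comp
    ((id.par ((id.par nil).comp dup)).comp dup)))

theorem big (c : ℕ) : (Prog.big c).Poly := by
  induction c with
  | zero => exact id
  | succ c ih => exact square.comp ih

theorem messageStep : Prog.messageStep.Poly :=
  ((((dup.par id).comp swap).par id).comp (unassoc.comp ((id.par swap).comp
    ((id.par (swap.par id)).comp ((id.par unassoc).comp (assoc.comp ((id.par coin).comp dup)))))))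

theorem dropStep : Prog.dropStep.Poly :=
  (((snd.par snd).comp snd).ite snd).comp ((fst.par id).comp (swap.comp ((id.par coin).comp dup)))

theorem trunc (c : ℕ) : (Prog.trunc c).Poly :=
  (snd.ite nil).comp ((((loop snd grows_snd).comp swap).par id).comp (unassoc.comp
    ((id.par swap).comp ((big c).par ((id.par size).comp dup)))))

theorem pick (c : ℕ) : (Prog.pick c).Poly :=
  (fst.par fst).comp ((loop dropStep grows_dropStep).comp ((snd.comp (big c)).par id))

theorem same : Prog.same.Poly :=
  (((nil.par nil).ite nil).comp swap).ite ((nil.ite (nil.par nil)).comp swap)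

theorem finish (c c' : ℕ) {dec : Prog} (h : dec.Poly) : (Prog.finish c c' dec).Poly := by
  have h1 : (shorten c).Poly := (id.par ((trunc c).par id)).comp ((id.par unassoc).comp
    (assoc.comp (dup.par id)))
  have h2 : (select c').Poly := (id.par ((id.par (pick c')).comp (assoc.comp
    ((swap.par id).comp unassoc)))).comp (assoc.comp (dup.par id))
  have h3 : (verify dec).Poly := same.comp (((fst.comp (meas.comp (fst.comp h))).par id).comp
    (unassoc.comp (id.par unassoc)))
  exact h3.comp (h2.comp h1)

end Prog.Poly

/-! ### The binomial distribution near its centre -/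

/-- The ratios of consecutive binomial coefficients, `1 - (2 j + 1) / (M + j + 1)`, multiply up to a
loss of at most `j ^ 2 / (M + 1)`. -/
theorem choose_center (M j : ℕ) (hj : j ≤ M) :
    (1 - (j : ℝ) ^ 2 / (M + 1)) * (2 * M).choose M ≤ (2 * M).choose (M + j) := by
  induction j with
  | zero => simp
  | succ j ih =>
    have ih := ih (by omega)
    have hrec : ((2 * M).choose (M + j + 1) : ℝ) * (M + j + 1) =
        (2 * M).choose (M + j) * (M - j) := by
      have h := Nat.choose_succ_right_eq (2 * M) (M + j)
      have h' : 2 * M - (M + j) = M - j := by omega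
      rw [h'] at h
      have h2 : (((M - j : ℕ)) : ℝ) = (M : ℝ) - j := Nat.cast_sub (by omega)
      rw [← h2]
      exact_mod_cast h
    set a : ℝ := (((2 * M).choose M : ℕ) : ℝ)
    set x : ℝ := (((2 * M).choose (M + j) : ℕ) : ℝ)
    set y : ℝ := (((2 * M).choose (M + j + 1) : ℕ) : ℝ)
    have ha : 0 ≤ a := Nat.cast_nonneg _
    have hM : (0 : ℝ) < M + 1 := by positivity
    have hj' : (j : ℝ) + 1 ≤ M := by exact_mod_cast hj
    have hj0 : (0 : ℝ) ≤ j := Nat.cast_nonneg _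
    have hy : y = x * (1 - (2 * j + 1) / (M + j + 1)) := by
      field_simp
      rw [hrec]; ring
    have h1 : (2 * (j : ℝ) + 1) / (M + j + 1) ≤ (2 * j + 1) / (M + 1) := by
      gcongr; linarith
    have h2 : 0 ≤ 1 - (2 * (j : ℝ) + 1) / (M + j + 1) := by
      rw [sub_nonneg, div_le_one (by positivity)]; linarith
    have h3 : (1 - (j : ℝ) ^ 2 / (M + 1)) * a * (1 - (2 * j + 1) / (M + j + 1)) ≤ y := by
      rw [hy]; exact mul_le_mul_of_nonneg_right ih h2
    refine le_trans ?_ (le_trans ?_ h3) (b := (1 - (j : ℝ) ^ 2 / (M + 1) -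
      (2 * (j : ℝ) + 1) / (M + j + 1)) * a)
    · refine mul_le_mul_of_nonneg_right ?_ ha
      have : ((j : ℝ) + 1) ^ 2 / (M + 1) = (j : ℝ) ^ 2 / (M + 1) + (2 * j + 1) / (M + 1) := by
        rw [← add_div]; ring
      push_cast
      rw [this]; linarith
    · have h4 : 0 ≤ (j : ℝ) ^ 2 / (M + 1) * ((2 * j + 1) / (M + j + 1)) * a := by positivity
      nlinarith [h4]

/-- Every position within `√(M / 2)` of the centre has probability at least `1 / (4 M)`. -/
theorem choose_center_ge {M j : ℕ} (hM : 0 < M) (hj : 2 * j ^ 2 ≤ M) :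
    1 / (4 * M : ℝ) ≤ (2 * M).choose (M + j) / 2 ^ (2 * M) := by
  have hjM : j ≤ M := by nlinarith [Nat.zero_le j]
  have h1 := choose_center M j hjM
  have h2 : (1 : ℝ) / 2 ≤ 1 - (j : ℝ) ^ 2 / (M + 1) := by
    have : (j : ℝ) ^ 2 / (M + 1) ≤ 1 / 2 := by
      rw [div_le_div_iff₀ (by positivity) (by norm_num)]
      have : (2 * (j : ℝ) ^ 2) ≤ M := by exact_mod_cast hj
      linarith
    linarith
  have h3 : (4 : ℝ) ^ M ≤ 2 * M * (2 * M).choose M := by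
    have := Nat.four_pow_le_two_mul_self_mul_centralBinom M hM
    rw [Nat.centralBinom_eq_two_mul_choose] at this
    exact_mod_cast this
  have hM' : (0 : ℝ) < M := by exact_mod_cast hM
  have ha : (0 : ℝ) ≤ (2 * M).choose M := Nat.cast_nonneg _
  rw [pow_mul, show (2 : ℝ) ^ 2 = 4 by norm_num, div_le_div_iff₀ (by positivity) (by positivity)]
  nlinarith [mul_le_mul_of_nonneg_right h2 ha]

/-! ### The attack -/

/-- The identity on one qubit. -/
def idCircuit : Circuit := ⟨1, 0, [], [0]⟩

theorem idCircuit_wellFormed : idCircuit.WellFormed := by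
  refine ⟨by simp [idCircuit], by simp [idCircuit], by simp [idCircuit]⟩

/-- The adversary against a scheme with decryption algorithm `dec`: its messages are random bits,
it asks for the key of the identity after it got the ciphertexts, and it outputs whether it could
recover one of the bits, chosen at random. The number of messages is `sqFun^[c'] n`, and keys of
size `sqFun^[c] n` or more are thrown away. -/
def attack (c c' : ℕ) (dec : Prog) : Adversary where
  query₁ := .nil
  challenge := .comp (.loop messageStep) (.par (big c') (.par .nil .nil))
  query₂ := .par (.const idCircuit.encode) .id
  finish := Prog.finish c c' dec

theorem attack_isQPT (c c' : ℕ) {dec : Prog} (h : dec.IsQPT) : (attack c c' dec).IsQPT := by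
  rw [isQPT_iff] at h
  refine ⟨?_, ?_, ?_, ?_⟩ <;> rw [isQPT_iff]
  · exact Poly.nil
  · exact Poly.comp (Poly.loop Poly.messageStep Poly.grows_messageStep)
      (Poly.par (Poly.big c') (Poly.par Poly.nil Poly.nil))
  · exact Poly.par (Prog.Poly.const _) Poly.id
  · exact Poly.finish c c' h

/-! ### The experiments -/

section experiments

variable (S : QFE) (A : Adversary) (n : ℕ)

/-- The branches of the generation of the master key. -/
def setupSM : SM Data := (sem S.setup (.ofNat n)).bind fun mk => SM.ret 0 mk.classical

/-- The branches of the generation of a functional key. -/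
def keyGenSM (mk : Data) (C : Circuit) : SM Data :=
  sem S.keyGen (.pair (.ofNat n) (.pair mk C.encode))

/-- The branches of an encryption. -/
def encSM (mk : Data) (m : List ℕ) : SM Data :=
  sem S.enc (.pair (.ofNat n) (.pair mk (.ofReg m)))

/-- The branches of the first phase of the adversary. -/
def firstSM (mk : Data) : SM (Option Circuit × List (List ℕ) × Data) :=
  (sem A.query₁ (.ofNat n)).bind fun a =>
    SM.bind (match Circuit.decode a.fst with
      | some C => keyGenSM S n mk C
      | none => SM.ret 0 .nil) fun fk =>
    (sem A.challenge (.pair (.ofNat n) (.pair fk a.snd))).bind fun b =>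
      SM.ret 0 (Circuit.decode a.fst, b.fst.toList.map Data.toReg, b.snd)

/-- The branches of the second phase of the adversary, whose key query is answered by `key`. -/
def secondSM (q₁ : Option Circuit) (cts st : Data) (key : Circuit → SM Data) : SM Data :=
  (sem A.query₂ (.pair (.ofNat n) (.pair cts st))).bind fun a =>
    SM.bind (match q₁, Circuit.decode a.fst with
      | none, some C => key C
      | _, _ => SM.ret 0 .nil) fun fk =>
    sem A.finish (.pair (.ofNat n) (.pair fk a.snd))

/-- The branches of the real experiment. -/
def realSM : SM Data :=
  (setupSM S n).bind fun mk => (firstSM S A n mk).bind fun r =>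
    (SM.mapM (encSM S n mk) r.2.1).bind fun cts =>
      secondSM A n r.1 (.ofList cts) r.2.2 (keyGenSM S n mk)

theorem impl_setup : Impl (S.runSetup n) (setupSM S n) :=
  (impl_eval _ _).bind fun _ => Impl.pure _

theorem impl_first (mk : Data) : Impl (firstPhase S A n mk) (firstSM S A n mk) := by
  refine (impl_eval _ _).bind fun a => ?_
  cases hq : Circuit.decode a.fst with
  | none =>
    exact (Impl.pure _).bind fun fk => (impl_eval _ _).bind fun b => Impl.pure _
  | some C =>
    exact (impl_eval _ _).bind fun fk => (impl_eval _ _).bind fun b => Impl.pure _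

theorem impl_second (q₁ : Option Circuit) (cts st : Data) {key : Circuit → QM Data}
    {keySM : Circuit → SM Data} (h : ∀ C, Impl (key C) (keySM C)) :
    Impl (secondPhase A n q₁ cts st key) (secondSM A n q₁ cts st keySM) := by
  refine (impl_eval _ _).bind fun a => ?_
  cases q₁ with
  | none =>
    cases Circuit.decode a.fst with
    | none => exact (Impl.pure _).bind fun fk => impl_eval _ _
    | some C => exact (h C).bind fun fk => impl_eval _ _
  | some C => exact (Impl.pure _).bind fun fk => impl_eval _ _

theorem impl_real : Impl (realExp S A n) (realSM S A n) :=
  (impl_setup S n).bind fun _ => (impl_first S A n _).bind fun ⟨_, _, _⟩ =>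
    (Impl.mapM (fun _ => impl_eval _ _) _).bind fun _ =>
      impl_second A n _ _ _ fun _ => impl_eval _ _

open Classical in
/-- The squared norm of the branches that end with the bit `1`. -/
def accF : Data → ℕ → State → ℝ := fun a _ φ => if a = bit true then ‖φ‖ ^ 2 else 0

theorem accept_eq {x : QM Data} {X : SM Data} (h : Impl x X) :
    QFun.accept .snd n x = X.exp accF 0 (ket ∅) := by
  rw [QFun.accept, Impl.prob_eq (h.bind fun a => impl_eval _ _) Mem.init, SM.exp_bind]
  refine congrArg (fun F => X.exp F 0 (ket ∅)) ?_
  funext a m φ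
  rw [exp_snd, snd_pair, accF]

end experiments

/-! ### Expectations over valid memories -/

/-- The memory with `n` qubits in use contains the datum and the state. -/
def Valid (n : ℕ) (d : Data) (ψ : State) : Prop := (∀ q ∈ d.names, q < n) ∧ ψ.SuppIn (Set.Iio n)

theorem branch_valid {p : Prog} {d : Data} {n : ℕ} {ψ : State} (h : Valid n d ψ) {b : Br Data}
    (hb : b ∈ sem p d (n + ·)) : Valid (n + b.used) b.val (b.word.lin ψ) := by
  obtain ⟨h1, h2⟩ := Eff.branch_names (B := Set.Iio n) h.1 hb
  have hsub : Set.Iio n ∪ (n + ·) '' Set.Iio b.used ⊆ Set.Iio (n + b.used) := by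
    rintro q (hq | ⟨i, hi, rfl⟩)
    · simp at hq ⊢; omega
    · simpa using hi
  exact ⟨fun q hq => hsub (h1 q hq), State.SuppIn.word (fun q hq => hsub (h2 q hq))
    (h.2.mono (Set.Iio_subset_Iio (by omega)))⟩

theorem exp_congr_valid {p : Prog} {d : Data} {n : ℕ} {ψ : State} (h : Valid n d ψ)
    {F G : Data → ℕ → State → ℝ} (hFG : ∀ a m φ, n ≤ m → Valid m a φ → F a m φ = G a m φ) :
    (sem p d).exp F n ψ = (sem p d).exp G n ψ :=
  SM.exp_congr fun b hb => hFG _ _ _ (by omega) (branch_valid h hb)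

/-- The expectation of an effect on the result is the value of the composed effect. -/
theorem exp_val (x : SM Data) (K : Data → Eff) (n : ℕ) (ψ : State) :
    x.exp (fun a m φ => (K a).val (m + ·) φ) n ψ = (Eff.bind x K).val (n + ·) ψ := by
  rw [Eff.val_bind_shift, SM.exp]
  simp only [add_assoc]

theorem exp_sum {α ι : Type} (x : SM α) (t : Finset ι) (c : ι → ℝ)
    (G : ι → α → ℕ → State → ℝ) (n : ℕ) (ψ : State) :
    x.exp (fun a m φ => ∑ i ∈ t, c i * G i a m φ) n ψ = ∑ i ∈ t, c i * x.exp (G i) n ψ := by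
  simp only [SM.exp]
  induction x (n + ·) with
  | nil => simp
  | cons b l ih =>
    simp only [List.map_cons, List.sum_cons, ih, mul_add, Finset.sum_add_distrib]

/-- A process on other qubits whose result is ignored has no influence on an effect. -/
theorem exp_discard {p : Prog} {d : Data} {P : Eff} {A : Set ℕ} {n : ℕ} {ψ : State}
    (hP : Eff.On A P) (hA : A ⊆ Set.Iio n) (hd : ∀ q ∈ d.names, q < n ∧ q ∉ A)
    (hψ : ψ.SuppIn (Set.Iio n)) :
    (sem p d).exp (fun _ m φ => P.val (m + ·) φ) n ψ = P.val (n + ·) ψ := by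
  obtain ⟨ν₁, ν₂, -, -, h₁, h₂, -, -⟩ := Eff.exists_fresh n
  rw [exp_val, Eff.val_bind hP hA (fun q hq => (hd q hq).1) hψ (fresh_add n) h₁ h₂]
  exact Eff.val_discard hP hA (fun q hq => hd q hq) hψ (fresh_add n) h₁ h₂

/-- The element at position `k` of a list, or `nil` if the list is shorter. -/
def pos (k : ℕ) (d : Data) : Data := (Data.snd^[k] d).fst

theorem pos_cons_zero (a : Data) (l : List Data) : pos 0 (ofList (a :: l)) = a := rfl

theorem pos_cons_succ (k : ℕ) (a : Data) (l : List Data) :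
    pos (k + 1) (ofList (a :: l)) = pos k (ofList l) := rfl

theorem pos_ofList {l : List Data} {k : ℕ} (h : k < l.length) : pos k (ofList l) = l[k] := by
  induction l generalizing k with
  | nil => simp at h
  | cons a l ih =>
    cases k with
    | zero => rfl
    | succ k => rw [pos_cons_succ, ih (by simpa using h)]; rfl

section mapM

variable {γ : Type} (p : Prog) (g : γ → Data)

theorem exp_mapM_discard {P : Eff} {A : Set ℕ} (hP : Eff.On A P) (l : List γ) {n : ℕ}
    {ψ : State} (hA : A ⊆ Set.Iio n) (hl : ∀ a ∈ l, ∀ q ∈ (g a).names, q < n ∧ q ∉ A)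
    (hψ : ψ.SuppIn (Set.Iio n)) :
    (SM.mapM (fun a => sem p (g a)) l).exp (fun _ m φ => P.val (m + ·) φ) n ψ =
      P.val (n + ·) ψ := by
  induction l generalizing n ψ with
  | nil => exact SM.exp_ret ..
  | cons a l ih =>
    have ha := hl a (by simp)
    simp only [SM.mapM, SM.exp_bind, SM.exp_bind', SM.exp_ret']
    rw [← exp_discard hP hA ha hψ]
    refine exp_congr_valid ⟨fun q hq => (ha q hq).1, hψ⟩ fun b m φ hm hv => ?_
    exact ih (hA.trans (Set.Iio_subset_Iio hm))
      (fun a' ha' q hq => ⟨((hl a' (by simp [ha']) q hq).1).trans_le hm,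
        (hl a' (by simp [ha']) q hq).2⟩) hv.2

/-- Only the process that is looked at matters in a list of processes on disjoint qubits. -/
theorem exp_mapM {K : Data → Eff} (hK : Eff.Fam ∅ K) (l : List γ) {n : ℕ} {ψ : State}
    (hl : ∀ a ∈ l, ∀ q ∈ (g a).names, q < n)
    (hdis : l.Pairwise fun a b => (g a).names.Disjoint (g b).names)
    (hψ : ψ.SuppIn (Set.Iio n)) {k : ℕ} (hk : k < l.length) :
    (SM.mapM (fun a => sem p (g a)) l).exp (fun cts m φ => (K (pos k (ofList cts))).val (m + ·) φ)
      n ψ = (Eff.bind (sem p (g l[k])) K).val (n + ·) ψ := by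
  induction l generalizing n ψ k with
  | nil => simp at hk
  | cons a l ih =>
    have ha := hl a (by simp)
    obtain ⟨hdis₁, hdis₂⟩ := List.pairwise_cons.1 hdis
    simp only [SM.mapM, SM.exp_bind, SM.exp_bind', SM.exp_ret']
    cases k with
    | zero =>
      simp only [pos_cons_zero, List.getElem_cons_zero]
      rw [← exp_val]
      refine SM.exp_congr fun b hb => ?_
      have hv := branch_valid ⟨ha, hψ⟩ hb
      refine exp_mapM_discard p g (A := {q | q ∈ b.val.names})
        (hK.on (Set.empty_subset _) fun q hq => hq) l (fun q hq => hv.1 q hq) ?_ hv.2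
      intro a' ha' q hq
      have hqn := hl a' (by simp [ha']) q hq
      refine ⟨hqn.trans_le (Nat.le_add_right _ _), fun hqb => ?_⟩
      rcases List.mem_append.1 ((sem_linear p (g a) _ b hb).1.subset hqb) with h | h
      · exact hdis₁ a' ha' h hq
      · obtain ⟨i, -, rfl⟩ := List.mem_map.1 h
        omega
    | succ k =>
      simp only [pos_cons_succ, List.getElem_cons_succ]
      have hk' : k < l.length := by simpa using hk
      have hmem : l[k] ∈ l := List.getElem_mem hk'
      have hon : Eff.On {q | q ∈ (g l[k]).names} (Eff.bind (sem p (g l[k])) K) := by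
        have h1 : Eff.Fam {q | q ∈ (g l[k]).names} fun t => K t.fst :=
          (hK.mono (Set.empty_subset _)).comp (Eff.Unif.id _).fst
        exact Eff.Fam.bind h1 p (Eff.Unif.const fun q hq => hq)
      rw [← exp_discard (p := p) (d := g a) hon (fun q hq => hl _ (by simp [hmem]) q hq)
        (fun q hq => ⟨ha q hq, fun h => hdis₁ _ hmem hq h⟩) hψ]
      refine exp_congr_valid ⟨ha, hψ⟩ fun b m φ hm hv => ?_
      exact ih (fun a' ha' q hq => (hl a' (by simp [ha']) q hq).trans_le hm) hdis₂ hv.2 hk'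

end mapM

/-! ### The final test -/

theorem agree_map (f : ℕ → ℕ) (a b : Data) : agree (a.map f) (b.map f) = agree a b := by
  cases a <;> cases b <;> rfl

theorem cut_map (B : ℕ) (f : ℕ → ℕ) (d : Data) : cut B (d.map f) = (cut B d).map f := by
  rw [cut, cut, size_map]; split_ifs <;> rfl

theorem unif_cut (B : ℕ) {A : Set ℕ} {g : Data → Data} (hg : Eff.Unif A g) :
    Eff.Unif A fun d => cut B (g d) := by
  refine ⟨fun a q hq => ?_, fun f hf a => by rw [hg.map f hf, cut_map]⟩
  rw [cut] at hq
  split_ifs at hq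
  · exact hg.names a q hq
  · simp [names] at hq

/-- The test whether the functional key, the ciphertext and the bit in a triple fit together. -/
def fits (dec : Prog) (n : ℕ) (t : Data) : Eff :=
  Eff.accept (sem (test dec) (.pair (.ofNat n) (.pair t.fst t.snd.fst)))
    fun a => agree a t.snd.snd

theorem fam_fits (dec : Prog) (n : ℕ) : Eff.Fam ∅ (fits dec n) :=
  Eff.Fam.accept (E := fun t a => agree a t.snd.snd) (test dec)
    ((Eff.Unif.const (by simp [names_ofNat])).pair
      ((Eff.Unif.id _).fst.pair (Eff.Unif.id _).snd.fst))
    fun f t a => by rw [snd_map, snd_map, agree_map]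

theorem val_smul (P : Eff) (ν : ℕ → ℕ) (a : ℂ) (ψ : State) :
    P.val ν (a • ψ) = ‖a‖ ^ 2 * P.val ν ψ := by
  rw [Eff.val, Eff.val, ← List.sum_map_mul_left]
  congr 1
  refine List.map_congr_left fun w _ => ?_
  rw [map_smul, norm_smul, mul_pow]

/-- Qubits that an effect does not touch may be flipped. -/
theorem val_flip {A : Set ℕ} {P : Eff} (hP : Eff.On A P) {ν : ℕ → ℕ} {t : Finset ℕ}
    (h : ∀ q ∈ t, q ∉ A ∧ ∀ i, ν i ≠ q) (ψ : State) : P.val ν (flip t ψ) = P.val ν ψ := by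
  rw [Eff.val, Eff.val]
  congr 1
  refine List.map_congr_left fun w hw => ?_
  have hd : Disjoint (A ∪ Set.range ν) (t : Set ℕ) := by
    rw [Set.disjoint_left]
    rintro q (hq | ⟨i, rfl⟩) hqt
    · exact (h q hqt).1 hq
    · exact (h _ hqt).2 i rfl
  have := commute_of_disjoint hd (Word.lin_mem (hP.names hw)) (flip_mem fun q hq => hq)
  have e : w.lin (flip t ψ) = flip t (w.lin ψ) := LinearMap.congr_fun this.eq ψ
  rw [e, norm_flip]

theorem norm_coin (N : ℕ) : ‖((√2 : ℝ) : ℂ)⁻¹ ^ N‖ ^ 2 = (2 ^ N : ℝ)⁻¹ := by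
  rw [norm_pow, norm_inv, Complex.norm_real, Real.norm_of_nonneg (Real.sqrt_nonneg _), ← pow_mul,
    mul_comm, pow_mul, inv_pow, Real.sq_sqrt (by norm_num), inv_pow]

theorem exp_test (dec : Prog) (n : ℕ) (fk ct m : Data) (k : ℕ) (ψ : State) :
    (sem (test dec) (pair (ofNat n) (pair fk ct))).exp
      (fun a => (sem .id m).exp fun b => (sem same (pair a b)).exp accF) k ψ =
        (fits dec n (pair fk (pair ct m))).val (k + ·) ψ := by
  have e : (fun a => (sem .id m).exp fun b => (sem same (pair a b)).exp accF) =
      fun a => accF (bit (agree a m)) := by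
    funext a k φ
    rw [exp_id, exp_same]
  rw [e, fits, Eff.val, Eff.accept, List.map_map, SM.exp]
  simp only [fst_pair, snd_pair]
  induction sem (test dec) (pair (ofNat n) (pair fk ct)) (k + ·) with
  | nil => simp
  | cons b l ih =>
    rw [List.map_cons, List.sum_cons, ih, List.filter_cons]
    cases h : agree b.val m <;> simp [accF, bit]

theorem names_cut {B : ℕ} {d : Data} : ∀ q ∈ (cut B d).names, q ∈ d.names := by
  intro q hq
  rw [cut] at hq
  split_ifs at hq
  · exact hq
  · simp [names] at hq

theorem names_pos {k : ℕ} {d : Data} : ∀ q ∈ (pos k d).names, q ∈ d.names := by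
  intro q hq
  have hq' : q ∈ (Data.snd^[k] d).names :=
    (names_fst_snd _).subset (List.mem_append_left _ hq)
  clear hq
  induction k generalizing d with
  | zero => exact hq'
  | succ j ih => exact (names_fst_snd d).subset (List.mem_append_right _ (ih hq'))

/-- Coins that have been tossed do not influence an effect. -/
theorem val_coins {A : Set ℕ} {P : Eff} (hP : Eff.On A P) {k : ℕ} (hA : A ⊆ Set.Iio k)
    {ψ : State} (hψ : ψ.SuppIn (Set.Iio k)) {R : ℕ} {s : Finset ℕ} (hs : s ⊆ Finset.range R) :
    P.val (k + R + ·) (((√2 : ℝ) : ℂ)⁻¹ ^ R • flip (coinSet k s) ψ) =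
      (2 ^ R : ℝ)⁻¹ * P.val (k + ·) ψ := by
  have hkR : Set.Iio k ⊆ Set.Iio (k + R) := Set.Iio_subset_Iio (Nat.le_add_right k R)
  rw [val_smul, norm_coin, val_flip hP,
    hP.val_eq hA hψ (fresh_add k) ((fresh_add (k + R)).mono hkR)]
  intro q hq
  obtain ⟨j, hj, rfl⟩ := Finset.mem_map.1 hq
  have hj' : j < R := by simpa using hs hj
  refine ⟨fun h => ?_, fun i => ?_⟩
  · have := hA h
    simp [addLeftEmbedding] at this
  · simp [addLeftEmbedding]; omega

/-- In the loop that picks a position, the number of dropped elements is the number of heads. -/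
theorem tosses_drop (n : ℕ) (m : Finset ℕ) (k : ℕ) (a b : Data) :
    tosses (fun h _ d => if h then pair d.fst.snd d.snd.snd else d) n m k (pair a b) =
      pair (Data.snd^[(m.filter (· < k)).card] a) (Data.snd^[(m.filter (· < k)).card] b) := by
  induction k with
  | zero => simp [tosses]
  | succ k ih =>
    have hf : m.filter (· < k + 1) =
        if k ∈ m then insert k (m.filter (· < k)) else m.filter (· < k) := by
      ext j
      split_ifs with h <;> simp only [Finset.mem_filter, Finset.mem_insert]
      · constructor
        · rintro ⟨h1, h2⟩
          rcases Nat.lt_succ_iff_lt_or_eq.1 h2 with h3 | rfl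
          · exact .inr ⟨h1, h3⟩
          · exact .inl rfl
        · rintro (rfl | ⟨h1, h2⟩)
          · exact ⟨h, by omega⟩
          · exact ⟨h1, by omega⟩
      · constructor
        · rintro ⟨h1, h2⟩
          refine ⟨h1, lt_of_le_of_ne (by omega) fun e => h (e ▸ h1)⟩
        · rintro ⟨h1, h2⟩; exact ⟨h1, by omega⟩
    rw [tosses, ih, hf]
    by_cases h : k ∈ m
    · rw [if_pos h, Finset.card_insert_of_notMem (by simp)]
      simp [h, fst_pair, snd_pair, Function.iterate_succ_apply']
    · simp [h]

/-- The last part of the attack tests a position with binomial distribution, since fair coins are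
the only source of randomness. -/
theorem exp_finish (c c' : ℕ) (dec : Prog) (n : ℕ) (fk cts st : Data) {k : ℕ} {ψ : State}
    (hv : Valid k (pair fk (pair cts st)) ψ) :
    (sem (Prog.finish c c' dec) (pair (ofNat n) (pair fk (pair cts st)))).exp accF k ψ =
      ∑ x ∈ Finset.range (sqFun^[c'] n - 1 + 1), ((sqFun^[c'] n - 1).choose x : ℝ) /
        2 ^ (sqFun^[c'] n - 1) *
        (fits dec n (pair (cut (sqFun^[c] n) fk) (pair (pos x cts) (pos x st)))).val
          (k + ·) ψ := by
  set R := sqFun^[c'] n - 1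
  have hcl : (ofNat n).classical = ofNat n := classical_eq_self (names_ofNat n)
  have hdrop : ∀ d (F : Data → ℕ → State → ℝ) n ψ, (sem dropStep d).exp F n ψ =
      F ((fun (h : Bool) (_ : ℕ) (d : Data) => if h then pair d.fst.snd d.snd.snd else d)
          false n d) (n + 1) (proj n false (hadamard n ψ)) +
        F ((fun (h : Bool) (_ : ℕ) (d : Data) => if h then pair d.fst.snd d.snd.snd else d)
          true n d) (n + 1) (proj n true (hadamard n ψ)) := fun d F n ψ => exp_dropStep F n ψ d
  have hR : Data.snd (ofNat (sqFun^[c'] n)) = ofNat R := by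
    show _ = ofNat (sqFun^[c'] n - 1)
    cases sqFun^[c'] n <;> rfl
  simp only [Prog.finish, shorten, select, verify, exp_comp, exp_par, exp_dup, exp_id, exp_assoc,
    exp_unassoc, exp_trunc, exp_swap, pick, exp_big, exp_snd, exp_loop, fst_pair,
    snd_pair, hcl, hR, toList_ofNat]
  rw [exp_iter_coin (g := fun h _ d => if h then pair d.fst.snd d.snd.snd else d) hdrop hv.2]
  have hpos : ∀ k d, (Data.snd^[k] d).fst = pos k d := fun _ _ => rfl
  simp only [tosses_drop, exp_comp, exp_par, exp_fst, exp_id, exp_unassoc, fst_pair, snd_pair,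
    exp_test, hpos]
  have hterm : ∀ s ∈ (Finset.range R).powerset,
      (fits dec n (pair (cut (sqFun^[c] n) fk) (pair (pos (s.filter (· < R)).card cts)
        (pos (s.filter (· < R)).card st)))).val (k + R + ·)
        (((√2 : ℝ) : ℂ)⁻¹ ^ R • flip (coinSet k s) ψ) =
      (2 ^ R : ℝ)⁻¹ * (fits dec n (pair (cut (sqFun^[c] n) fk) (pair (pos s.card cts)
        (pos s.card st)))).val (k + ·) ψ := by
    intro s hs
    have hs' := Finset.mem_powerset.1 hs
    have hsR : s.filter (· < R) = s := Finset.filter_true_of_mem fun j hj => by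
      simpa using hs' hj
    rw [hsR]
    refine val_coins ((fam_fits dec n).on (B := Set.Iio k) (Set.empty_subset _) ?_) subset_rfl
      hv.2 hs'
    intro q hq
    refine hv.1 q ?_
    simp only [names, List.mem_append] at hq ⊢
    rcases hq with hq | hq | hq
    · exact .inl (names_cut q hq)
    · exact .inr (.inl (names_pos q hq))
    · exact .inr (.inr (names_pos q hq))
  rw [Finset.sum_congr rfl hterm]
  rw [Finset.sum_powerset_apply_card fun x => (2 ^ R : ℝ)⁻¹ * (fits dec n
    (pair (cut (sqFun^[c] n) fk) (pair (pos x cts) (pos x st)))).val (k + ·) ψ, Finset.card_range]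
  refine Finset.sum_congr rfl fun x _ => ?_
  rw [nsmul_eq_mul, div_eq_mul_inv, mul_assoc]

/-! ### The two phases of the attack -/

/-- The messages of the attack are the qubits `k + N - 1, …, k`. -/
def messages (k N : ℕ) : List (List ℕ) := (List.range N).reverse.map fun j => [k + j]

/-- The bits in the messages, where `m` is the set of those `j` for which the qubit `k + j` is `1`.
-/
def bits (N : ℕ) (m : Finset ℕ) : Data :=
  ofList ((List.range N).reverse.map fun j => bit (decide (j ∈ m)))

theorem tosses_message (k : ℕ) (m : Finset ℕ) (N : ℕ) :
    tosses (fun h q d => pair (pair (pair (qubit q) Data.nil) d.fst) (pair (bit h) d.snd)) k m N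
      (pair Data.nil Data.nil) =
      pair (ofList ((List.range N).reverse.map fun j => pair (qubit (k + j)) Data.nil))
        (bits N m) := by
  induction N with
  | zero => rfl
  | succ N ih =>
    rw [tosses, ih]
    simp [List.range_succ, bits, ofList, fst_pair, snd_pair]

theorem messages_eq (k N : ℕ) :
    (ofList ((List.range N).reverse.map fun j => pair (qubit (k + j)) Data.nil)).toList.map toReg =
      messages k N := by
  rw [toList_ofList, messages, List.map_map]
  exact List.map_congr_left fun j _ => rfl

theorem names_bits (N : ℕ) (m : Finset ℕ) : (bits N m).names = [] := by
  rw [bits, names_ofList, List.flatMap_eq_nil_iff]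
  intro d hd
  obtain ⟨j, -, rfl⟩ := List.mem_map.1 hd
  cases decide (j ∈ m) <;> rfl

theorem length_messages (k N : ℕ) : (messages k N).length = N := by simp [messages]

theorem getElem_messages {k N x : ℕ} (h : x < (messages k N).length) :
    (messages k N)[x] = [k + (N - 1 - x)] := by
  simp [messages]

theorem pos_bits {N x : ℕ} (h : x < N) (m : Finset ℕ) :
    pos x (bits N m) = bit (decide (N - 1 - x ∈ m)) := by
  rw [bits, pos_ofList (by simpa using h)]
  simp

theorem decode_nil : Circuit.decode Data.nil = none := by
  rw [Circuit.decode, dif_neg]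
  rintro ⟨C, -, h⟩
  exact absurd h (by simp [Circuit.encode])

theorem names_encode_idCircuit : idCircuit.encode.names = [] := by
  simp [Circuit.encode, idCircuit, names, names_ofNat, ofList]

section phases

variable (S : QFE) (c c' : ℕ) (n : ℕ)

/-- The first phase of the attack prepares messages in a uniformly random basis state. -/
theorem exp_first (mk : Data) (F : Option Circuit × List (List ℕ) × Data → ℕ → State → ℝ) {k : ℕ}
    {ψ : State} (hψ : ψ.SuppIn (Set.Iio k)) :
    (firstSM S (attack c c' S.dec) n mk).exp F k ψ =
      ∑ m ∈ (Finset.range (sqFun^[c'] n)).powerset,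
        F (none, messages k (sqFun^[c'] n), bits (sqFun^[c'] n) m) (k + sqFun^[c'] n)
          (((√2 : ℝ) : ℂ)⁻¹ ^ (sqFun^[c'] n) • flip (coinSet k m) ψ) := by
  have hstep : ∀ d (F : Data → ℕ → State → ℝ) n ψ, (sem messageStep d).exp F n ψ =
      F ((fun (h : Bool) (q : ℕ) (d : Data) =>
          pair (pair (pair (qubit q) Data.nil) d.fst) (pair (bit h) d.snd)) false n d) (n + 1)
            (proj n false (hadamard n ψ)) +
        F ((fun (h : Bool) (q : ℕ) (d : Data) =>
          pair (pair (pair (qubit q) Data.nil) d.fst) (pair (bit h) d.snd)) true n d) (n + 1)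
            (proj n true (hadamard n ψ)) := fun d F n ψ => exp_messageStep F n ψ d
  have hnil : Data.nil.fst = Data.nil := rfl
  simp only [firstSM, attack, SM.exp_bind, exp_nil, hnil, decode_nil, SM.exp_bind', SM.exp_ret,
    SM.exp_ret', exp_comp, exp_par, exp_big, exp_loop, fst_pair, snd_pair, toList_ofNat]
  rw [exp_iter_coin (g := fun h q d =>
    pair (pair (pair (qubit q) Data.nil) d.fst) (pair (bit h) d.snd)) hstep hψ]
  simp only [tosses_message, fst_pair, snd_pair, messages_eq]

/-- The second phase of the attack, for any way `p` of answering the query for the identity. -/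
theorem exp_second {cts st : Data} {key : Circuit → SM Data} {p : Prog} {d : Data} {k : ℕ}
    {ψ : State} (hkey : ∀ F k ψ, (key idCircuit).exp F k ψ = (sem p d).exp F k ψ)
    (hd : Valid k d ψ) (hv : Valid k (pair cts st) ψ) :
    (secondSM (attack c c' S.dec) n none cts st key).exp accF k ψ =
      ∑ x ∈ Finset.range (sqFun^[c'] n - 1 + 1), ((sqFun^[c'] n - 1).choose x : ℝ) /
        2 ^ (sqFun^[c'] n - 1) *
        (Eff.bind (sem p d) fun fk => fits S.dec n
          (pair (cut (sqFun^[c] n) fk) (pair (pos x cts) (pos x st)))).val (k + ·) ψ := by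
  simp only [secondSM, attack, SM.exp_bind, exp_par, exp_const _ _ _ _ _ names_encode_idCircuit,
    exp_id, fst_pair, snd_pair, Circuit.decode_encode idCircuit_wellFormed, hkey]
  have hsub : ∀ m, k ≤ m → ∀ q ∈ (pair cts st).names, q < m := fun m hm q hq =>
    (hv.1 q hq).trans_le hm
  rw [exp_congr_valid hd (G := fun fk m φ => ∑ x ∈ Finset.range (sqFun^[c'] n - 1 + 1),
    ((sqFun^[c'] n - 1).choose x : ℝ) / 2 ^ (sqFun^[c'] n - 1) * (fits S.dec n
      (pair (cut (sqFun^[c] n) fk) (pair (pos x cts) (pos x st)))).val (m + ·) φ)]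
  · rw [exp_sum]
    simp only [exp_val]
  · intro fk m φ hm h
    refine exp_finish c c' S.dec n fk cts st ⟨fun q hq => ?_, h.2⟩
    rcases List.mem_append.1 hq with hq | hq
    · exact h.1 q hq
    · exact hsub m hm q hq

end phases

/-- Expectations after a list of processes depend only on what happens for valid memories. -/
theorem mapM_valid {γ : Type} (p : Prog) (g : γ → Data) {l : List γ} {n : ℕ} {ψ : State}
    (hl : ∀ a ∈ l, ∀ q ∈ (g a).names, q < n) (hψ : ψ.SuppIn (Set.Iio n))
    {F G : List Data → ℕ → State → ℝ}
    (h : ∀ cts m φ, n ≤ m → Valid m (ofList cts) φ → F cts m φ = G cts m φ) :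
    (SM.mapM (fun a => sem p (g a)) l).exp F n ψ =
      (SM.mapM (fun a => sem p (g a)) l).exp G n ψ := by
  induction l generalizing n ψ F G with
  | nil =>
    simp only [SM.mapM, SM.exp_ret]
    exact h [] n ψ le_rfl ⟨by simp [ofList, names], hψ⟩
  | cons a l ih =>
    simp only [SM.mapM, SM.exp_bind, SM.exp_bind', SM.exp_ret']
    refine exp_congr_valid ⟨hl a (by simp), hψ⟩ fun b m φ hm hv => ?_
    refine ih (fun a' ha' q hq => (hl a' (by simp [ha']) q hq).trans_le hm) hv.2 ?_
    intro cts m' φ' hm' hv'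
    refine h _ _ _ (hm.trans hm') ⟨fun q hq => ?_, hv'.2⟩
    rcases List.mem_append.1 hq with hq | hq
    · exact (hv.1 q hq).trans_le hm'
    · exact hv'.1 q hq

/-! ### The real experiment -/

section real

variable (S : QFE) (c c' : ℕ) (n : ℕ)

/-- Key generation for the identity, after the ciphertext has been obtained, and the final test. -/
def keyThenFits (B : ℕ) (mk : Data) (b : Bool) (ct : Data) : Eff :=
  Eff.bind (sem S.keyGen (pair (ofNat n) (pair mk idCircuit.encode))) fun fk =>
    fits S.dec n (pair (cut B fk) (pair ct (bit b)))

/-- Encryption, key generation and the final test. -/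
def hitEff (B : ℕ) (mk : Data) (b : Bool) (d : Data) : Eff :=
  Eff.bind (sem S.enc (pair (ofNat n) (pair mk (pair d Data.nil)))) (keyThenFits S n B mk b)

/-- The probability that the attack recovers the bit `b` from a ciphertext of it. -/
def hit (B : ℕ) (mk : Data) (b : Bool) : ℝ :=
  (hitEff S n B mk b (qubit 0)).val (1 + ·) (ket (if b then {0} else ∅))

theorem fam_keyThenFits {mk : Data} (hmk : mk.names = []) (B : ℕ) (b : Bool) :
    Eff.Fam ∅ (keyThenFits S n B mk b) := by
  have hb : (bit b).names = [] := by cases b <;> rfl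
  have h := (fam_fits S.dec n).comp
    ((unif_cut B (Eff.Unif.id ∅).fst).pair ((Eff.Unif.id ∅).snd.pair
      (Eff.Unif.const (d := bit b) (by simp [hb]))))
  exact Eff.Fam.bind h S.keyGen (Eff.Unif.const (by
    simp [names, names_ofNat, hmk, names_encode_idCircuit]))

theorem fam_hitEff {mk : Data} (hmk : mk.names = []) (B : ℕ) (b : Bool) :
    Eff.Fam ∅ (hitEff S n B mk b) := by
  have h := (fam_keyThenFits S n hmk B b).comp (Eff.Unif.id ∅).fst
  exact Eff.Fam.bind h S.enc ((Eff.Unif.const (by simp [names_ofNat])).pair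
    ((Eff.Unif.const (by simp [hmk])).pair ((Eff.Unif.id ∅).pair
      (Eff.Unif.const (by simp [names])))))

/-- On a product state, the attack only sees the message that it decrypts. -/
theorem val_hitEff {mk : Data} (hmk : mk.names = []) (B : ℕ) {q k' : ℕ} (hq : q < k')
    (m : Finset ℕ) {ψ : State} (hψ : ψ.SuppIn (Set.Iio k')) (hqψ : ∀ s ∈ ψ.support, q ∉ s)
    (hm : ∀ j ∈ m, j < k') :
    (hitEff S n B mk (decide (q ∈ m)) (qubit q)).val (k' + ·) (flip m ψ) =
      ‖ψ‖ ^ 2 * hit S n B mk (decide (q ∈ m)) := by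
  classical
  set b := decide (q ∈ m)
  have hfam := fam_hitEff S n hmk B b
  have hon : Eff.On {q} (hitEff S n B mk b (qubit q)) :=
    hfam.on (Set.empty_subset _) (by simp [names])
  -- The state factors into the qubit `q`, which is `b`, and the others; swapping `q` with `0` then
  -- gives the state in the definition of `hit`.
  set t : Finset ℕ := if b then {q} else ∅
  have hsplit : flip m ψ = flip t (flip (symmDiff m t) ψ) := by
    rw [← Module.End.mul_apply, flip_mul, symmDiff_comm m t, symmDiff_symmDiff_cancel_left]
  have ht : ∀ j ∈ t, j ∈ ({q} : Set ℕ) := by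
    intro j hj
    by_cases h : b <;> simp [t, h] at hj ⊢; exact hj
  have hsupp : (flip (symmDiff m t) ψ).SuppIn (Set.Iio k' \ {q}) := by
    refine SuppIn_flip ?_ ?_
    · refine fun s hs j hj => ⟨hψ s hs j hj, ?_⟩
      rintro rfl
      exact hqψ s hs hj
    · intro j hj
      refine ⟨?_, ?_⟩
      · rcases Finset.mem_symmDiff.1 hj with h | h
        · exact hm j h.1
        · have := ht j h.1
          simp only [Set.mem_singleton_iff] at this
          simpa [this] using hq
      · rintro rfl
        by_cases h : j ∈ m <;> simp [Finset.mem_symmDiff, t, b, h] at hj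
  rw [hsplit, Eff.val_frame hon (Set.disjoint_sdiff_right)
    ((fresh_add k').mono Set.sdiff_subset) (flip_mem ht) hsupp, norm_flip]
  congr 1
  have h1 := Eff.val_rename hfam (σ := Equiv.swap q 0) (by simp) (qubit q) (k' + ·)
    (flip t (ket ∅))
  rw [← h1, hit]
  have h2 : rename (Equiv.swap q 0) (flip t (ket ∅)) = ket (if b then {0} else ∅) := by
    rw [flip_ket, empty_symmDiff, rename_ket]
    by_cases h : b <;> simp [t, h]
  have h3 : (qubit q).map (Equiv.swap q 0) = qubit 0 := by simp [Data.map]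
  rw [h2, h3]
  have hon0 : Eff.On {0} (hitEff S n B mk b (qubit 0)) :=
    hfam.on (Set.empty_subset _) (by simp [names])
  refine hon0.val_eq (B := {0}) subset_rfl (State.SuppIn.ket ?_) ⟨?_, ?_⟩ ⟨?_, ?_⟩
  · by_cases h : b <;> simp [h]
  · exact (Equiv.injective _).comp (fresh_add k').1
  · intro i h
    have h4 : Equiv.swap q 0 (k' + i) = 0 := h
    have : k' + i = q := by
      exact (Equiv.injective (Equiv.swap q 0)) (h4.trans (Equiv.swap_apply_left q 0).symm)
    omega
  · exact (fresh_add 1).1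
  · intro i h
    simp at h

/-- The probability that the attack succeeds in the real experiment with master key `mk`. -/
def average (B N : ℕ) (mk : Data) : ℝ :=
  ∑ m ∈ (Finset.range N).powerset, (2 ^ N : ℝ)⁻¹ * ∑ x ∈ Finset.range (N - 1 + 1),
    ((N - 1).choose x : ℝ) / 2 ^ (N - 1) * hit S n B mk (decide (N - 1 - x ∈ m))

theorem sum_choose_div (R : ℕ) :
    ∑ x ∈ Finset.range (R + 1), (R.choose x : ℝ) / 2 ^ R = 1 := by
  rw [← Finset.sum_div, ← Nat.cast_sum, Nat.sum_range_choose]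
  push_cast
  exact div_self (by positivity)

theorem sum_powerset_const (N : ℕ) (a : ℝ) :
    ∑ _m ∈ (Finset.range N).powerset, (2 ^ N : ℝ)⁻¹ * a = a := by
  rw [Finset.sum_const, Finset.card_powerset, Finset.card_range, nsmul_eq_mul]
  push_cast
  rw [mul_inv_cancel_left₀ (by positivity)]

theorem le_average {B N : ℕ} {mk : Data} {L : ℝ} (h : ∀ b, L ≤ hit S n B mk b) :
    L ≤ average S n B N mk := by
  rw [← sum_powerset_const N L]
  refine Finset.sum_le_sum fun m _ => mul_le_mul_of_nonneg_left ?_ (by positivity)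
  calc L = ∑ x ∈ Finset.range (N - 1 + 1), ((N - 1).choose x : ℝ) / 2 ^ (N - 1) * L := by
        rw [← Finset.sum_mul, sum_choose_div, one_mul]
    _ ≤ _ := Finset.sum_le_sum fun x _ => mul_le_mul_of_nonneg_left (h _) (by positivity)

/-- After the encryption of all messages, the test of one position succeeds as often as if there
were only the message at this position. -/
theorem exp_encrypt (B : ℕ) {mk : Data} (hmk : mk.names = []) (N : ℕ) {m : Finset ℕ}
    (hm : m ⊆ Finset.range N) {x : ℕ} (hx : x < N) {k : ℕ} {ψ : State} (hψ : ψ.SuppIn (Set.Iio k)) :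
    (SM.mapM (encSM S n mk) (messages k N)).exp
      (fun cts l φ => (keyThenFits S n B mk (decide (N - 1 - x ∈ m)) (pos x (ofList cts))).val
        (l + ·) φ) (k + N) (((√2 : ℝ) : ℂ)⁻¹ ^ N • flip (coinSet k m) ψ) =
      (2 ^ N : ℝ)⁻¹ * (‖ψ‖ ^ 2 * hit S n B mk (decide (N - 1 - x ∈ m))) := by
  have hkN : Set.Iio k ⊆ Set.Iio (k + N) := Set.Iio_subset_Iio (Nat.le_add_right k N)
  have hcoin : ∀ j ∈ coinSet k m, j < k + N := by
    intro j hj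
    obtain ⟨i, hi, rfl⟩ := Finset.mem_map.1 hj
    have := Finset.mem_range.1 (hm hi)
    simpa [addLeftEmbedding] using this
  have hsupp : (((√2 : ℝ) : ℂ)⁻¹ ^ N • flip (coinSet k m) ψ).SuppIn (Set.Iio (k + N)) :=
    State.SuppIn.smul _ (SuppIn_flip (hψ.mono hkN) hcoin)
  have hx' : x < (messages k N).length := by rwa [length_messages]
  have hmem : decide (k + (N - 1 - x) ∈ coinSet k m) = decide (N - 1 - x ∈ m) := by
    simp [coinSet, addLeftEmbedding]
  have hg : ∀ j, (pair (ofNat n) (pair mk (ofReg [j]))).names = [j] := by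
    intro j; simp [names, names_ofNat, hmk, ofReg, ofList]
  have key := exp_mapM S.enc (fun w => pair (ofNat n) (pair mk (ofReg w)))
    (fam_keyThenFits S n hmk B (decide (N - 1 - x ∈ m))) (messages k N) (n := k + N) (k := x)
    (ψ := ((√2 : ℝ) : ℂ)⁻¹ ^ N • flip (coinSet k m) ψ) ?_ ?_ hsupp hx'
  · rw [getElem_messages] at key
    refine key.trans ?_
    rw [← hmem]
    refine (val_smul (hitEff S n B mk _ (qubit (k + (N - 1 - x)))) _ _ _).trans ?_
    rw [norm_coin, val_hitEff S n hmk B (by omega) _ (hψ.mono hkN) ?_ hcoin]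
    intro s hs h
    have := hψ s hs _ h
    simp at this
  · intro w hw q hq
    obtain ⟨j, hj, rfl⟩ := List.mem_map.1 hw
    rw [hg, List.mem_singleton] at hq
    simp at hj
    omega
  · rw [messages, List.pairwise_map, List.pairwise_reverse]
    refine (List.nodup_range).imp ?_
    intro a b hab
    simp only [hg, List.disjoint_singleton, List.mem_singleton]
    omega

/-- The success probability of the attack in the real experiment, given by what happens to single
bits. -/
theorem exp_real (hN : 0 < sqFun^[c'] n) :
    (realSM S (attack c c' S.dec) n).exp accF 0 (ket ∅) =
      (setupSM S n).exp (fun mk _ ψ => ‖ψ‖ ^ 2 * average S n (sqFun^[c] n) (sqFun^[c'] n) mk)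
        0 (ket ∅) := by
  rw [realSM, SM.exp_bind, setupSM, SM.exp_bind, SM.exp_bind]
  refine exp_congr_valid ⟨by simp [names_ofNat], State.SuppIn.ket (by simp)⟩
    fun mk₀ k ψ _ hv => ?_
  rw [SM.exp_ret, SM.exp_ret, SM.exp_bind, exp_first S c c' n _ _ hv.2, average, Finset.mul_sum]
  set N := sqFun^[c'] n
  set mk := mk₀.classical
  have hmk : mk.names = [] := names_classical _
  refine Finset.sum_congr rfl fun m hm => ?_
  have hm' := Finset.mem_powerset.1 hm
  have hkN : Set.Iio k ⊆ Set.Iio (k + N) := Set.Iio_subset_Iio (Nat.le_add_right k N)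
  have hsupp : (((√2 : ℝ) : ℂ)⁻¹ ^ N • flip (coinSet k m) ψ).SuppIn (Set.Iio (k + N)) := by
    refine State.SuppIn.smul _ (SuppIn_flip (hv.2.mono hkN) fun j hj => ?_)
    obtain ⟨i, hi, rfl⟩ := Finset.mem_map.1 hj
    have := Finset.mem_range.1 (hm' hi)
    simpa [addLeftEmbedding] using this
  rw [SM.exp_bind]
  have hvalid := mapM_valid S.enc (fun w => pair (ofNat n) (pair mk (ofReg w)))
    (l := messages k N) (n := k + N) (ψ := ((√2 : ℝ) : ℂ)⁻¹ ^ N • flip (coinSet k m) ψ)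
    (F := fun cts => (secondSM (attack c c' S.dec) n none (ofList cts) (bits N m)
      (keyGenSM S n mk)).exp accF)
    (G := fun cts l φ => ∑ x ∈ Finset.range (N - 1 + 1), ((N - 1).choose x : ℝ) /
      2 ^ (N - 1) * (keyThenFits S n (sqFun^[c] n) mk (decide (N - 1 - x ∈ m))
        (pos x (ofList cts))).val (l + ·) φ) ?_ hsupp ?_
  · refine hvalid.trans ?_
    rw [exp_sum, Finset.mul_sum, Finset.mul_sum]
    refine Finset.sum_congr rfl fun x hx => ?_
    have hxN : x < N := by
      have := Finset.mem_range.1 hx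
      omega
    have := exp_encrypt S n (sqFun^[c] n) hmk N hm' hxN hv.2
    rw [show (SM.mapM fun w => sem S.enc (pair (ofNat n) (pair mk (ofReg w)))) =
      SM.mapM (encSM S n mk) from rfl, this]
    ring
  · intro w hw q hq
    obtain ⟨j, hj, rfl⟩ := List.mem_map.1 hw
    simp [names, names_ofNat, hmk, ofReg, ofList] at hq hj
    omega
  · intro cts l φ _ hv'
    rw [exp_second S c c' n (p := S.keyGen) (d := pair (ofNat n) (pair mk idCircuit.encode))
      (fun _ _ _ => rfl)]
    · refine Finset.sum_congr rfl fun x hx => ?_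
      have hxN : x < N := by
        have := Finset.mem_range.1 hx
        omega
      rw [pos_bits hxN]
      rfl
    · refine ⟨by simp [names, names_ofNat, hmk, names_encode_idCircuit], hv'.2⟩
    · refine ⟨fun q hq => ?_, hv'.2⟩
      rw [names, names_bits, List.append_nil] at hq
      exact hv'.1 q hq

end real

/-! ### Correctness of the scheme in terms of branches -/

open scoped ComplexOrder in
/-- Diagonal entries are bounded by the trace norm; the proof goes through the Frobenius norm. -/
theorem norm_apply_le_traceNorm {k : ℕ} (A : QMat k) (i : Fin k → Bool) :
    ‖A i i‖ ≤ traceNorm A := by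
  classical
  have hH := Matrix.isHermitian_conjTranspose_mul_self A
  have hpos : ∀ j, 0 ≤ hH.eigenvalues j :=
    (Matrix.posSemidef_conjTranspose_mul_self A).eigenvalues_nonneg
  have hnn : 0 ≤ traceNorm A := Finset.sum_nonneg fun j _ => Real.sqrt_nonneg _
  refine abs_le_of_sq_le_sq' ?_ hnn |>.2
  have h1 : (Matrix.trace (A.conjTranspose * A)) = ((∑ i, ∑ j, ‖A j i‖ ^ 2 : ℝ) : ℂ) := by
    simp only [Matrix.trace, Matrix.diag, Matrix.mul_apply, Matrix.conjTranspose_apply]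
    push_cast
    refine Finset.sum_congr rfl fun a _ => Finset.sum_congr rfl fun b _ => ?_
    rw [← Complex.conj_mul']
    rfl
  have h2 : (∑ i, ∑ j, ‖A j i‖ ^ 2 : ℝ) = ∑ j, hH.eigenvalues j := by
    have := hH.trace_eq_sum_eigenvalues
    rw [h1] at this
    exact Complex.ofReal_injective (this.trans (by push_cast; rfl))
  calc ‖A i i‖ ^ 2 ≤ ∑ j, ‖A j i‖ ^ 2 :=
        Finset.single_le_sum (f := fun j => ‖A j i‖ ^ 2) (fun j _ => by positivity)
          (Finset.mem_univ i)
    _ ≤ ∑ i, ∑ j, ‖A j i‖ ^ 2 :=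
        Finset.single_le_sum (f := fun i => ∑ j, ‖A j i‖ ^ 2)
          (fun i _ => Finset.sum_nonneg fun j _ => by positivity) (Finset.mem_univ i)
    _ = ∑ j, (√(hH.eigenvalues j)) ^ 2 := by
        rw [h2]
        exact Finset.sum_congr rfl fun j _ => (Real.sq_sqrt (hpos j)).symm
    _ ≤ traceNorm A ^ 2 :=
        Finset.sum_sq_le_sq_sum_of_nonneg fun j _ => Real.sqrt_nonneg _

theorem norm_proj_sq (q : ℕ) (b : Bool) (φ : State) :
    ‖proj q b φ‖ ^ 2 = ∑ s ∈ φ.support with (decide (q ∈ s) = b), ‖φ s‖ ^ 2 := by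
  classical
  rw [← State.normSq_eq, State.normSq, Finsupp.sum]
  have hs : (proj q b φ).support = φ.support.filter fun s => decide (q ∈ s) = b := by
    ext s
    by_cases h : decide (q ∈ s) = b <;> simp [proj_apply, h]
  rw [hs]
  refine Finset.sum_congr rfl fun s hs => ?_
  rw [proj_apply, if_pos (Finset.mem_filter.1 hs).2]

/-- The diagonal of a reduced density matrix holds the probabilities of measurement outcomes. -/
theorem reduced_apply_self (q : ℕ) (φ : State) (b : Bool) :
    reduced (fun _ : Fin 1 => q) φ (fun _ => b) (fun _ => b) = ((‖proj q b φ‖ ^ 2 : ℝ) : ℂ) := by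
  classical
  rw [norm_proj_sq, reduced]
  have hu : (Finset.univ : Finset (Fin 1)).image (fun _ => q) = {q} := by simp
  set t : Finset ℕ := (Finset.univ.filter fun _ : Fin 1 => b = true).image fun _ => q with ht
  have ht' : t = if b then {q} else ∅ := by cases b <;> simp [ht]
  rw [hu]
  have hmem : ∀ e : Finset ℕ, q ∉ e → decide (q ∈ e ∪ t) = b := by
    intro e he
    cases b <;> simp [ht', he]
  have hinv : ∀ s : Finset ℕ, decide (q ∈ s) = b → s \ {q} ∪ t = s := by
    intro s hs
    cases b
    · have : q ∉ s := by simpa using hs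
      simp [ht', this]
    · have : q ∈ s := by simpa using hs
      ext j
      by_cases h : j = q <;> simp [ht', h, this]
  have hsum : ∑ s ∈ φ.support with (decide (q ∈ s) = b), ‖φ s‖ ^ 2 =
      ∑ e ∈ (φ.support.filter fun s => decide (q ∈ s) = b).image (· \ {q}), ‖φ (e ∪ t)‖ ^ 2 := by
    rw [Finset.sum_image]
    · refine Finset.sum_congr rfl fun s hs => ?_
      rw [hinv s (Finset.mem_filter.1 hs).2]
    · intro s hs s' hs' h
      rw [← hinv s (Finset.mem_filter.1 hs).2, ← hinv s' (Finset.mem_filter.1 hs').2]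
      exact congrArg (· ∪ t) h
  rw [hsum]
  push_cast
  refine (Finset.sum_subset (Finset.image_subset_image (Finset.filter_subset _ _)) ?_).symm.trans
    (Finset.sum_congr rfl fun e _ => ?_)
  · intro e he hne
    obtain ⟨s, -, rfl⟩ := Finset.mem_image.1 he
    have hq : q ∉ s \ {q} := by simp
    have h0 : φ (s \ {q} ∪ t) = 0 := by
      by_contra h
      refine hne (Finset.mem_image.2 ⟨s \ {q} ∪ t, Finset.mem_filter.2
        ⟨Finsupp.mem_support_iff.2 h, hmem _ hq⟩, ?_⟩)
      ext j
      by_cases hj : j = q <;> cases b <;> simp [ht', hj]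
    simp [h0]
  · rw [← Complex.mul_conj']
    rfl

theorem density_apply {x : QM (List ℕ)} {X : SM (List ℕ)} (h : Impl x X) (μ : Mem) (b : Bool) :
    density 1 x μ (fun _ => b) (fun _ => b) =
      ((X.exp (fun w _ φ => if w.length = 1 then ‖proj (w.getD 0 0) b φ‖ ^ 2 else 0)
        μ.next μ.amp : ℝ) : ℂ) := by
  rw [density, h μ, SM.exp, List.map_map]
  induction X (μ.next + ·) with
  | nil => simp
  | cons a l ih =>
    rw [List.map_cons, List.sum_cons, Matrix.add_apply, ih, List.map_cons, List.sum_cons,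
      Complex.ofReal_add]
    congr 1
    by_cases hl : a.val.length = 1
    · simp only [Function.comp_apply, hl, if_true]
      have : (fun i : Fin 1 => a.val.getD i 0) = fun _ => a.val.getD 0 0 := by
        funext i; rw [Fin.val_eq_zero]
      rw [this, reduced_apply_self]
    · simp [hl]

theorem Impl.map {α β : Type} {x : QM α} {X : SM α} (h : Impl x X) (f : α → β) :
    Impl (f <$> x) (X.bind fun a => SM.ret 0 (f a)) := by
  rw [map_eq_pure_bind]
  exact h.bind fun a => Impl.pure _

namespace SM

variable {α : Type} (x : SM α)

theorem exp_mono {x : SM α} {F G : α → ℕ → State → ℝ} {n : ℕ} {ψ : State}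
    (h : ∀ b ∈ x (n + ·), F b.val (n + b.used) (b.word.lin ψ) ≤
      G b.val (n + b.used) (b.word.lin ψ)) : x.exp F n ψ ≤ x.exp G n ψ :=
  List.sum_le_sum h

theorem exp_add (F G : α → ℕ → State → ℝ) (n : ℕ) (ψ : State) :
    x.exp (fun a m φ => F a m φ + G a m φ) n ψ = x.exp F n ψ + x.exp G n ψ :=
  List.sum_map_add

theorem exp_mul_left (r : ℝ) (F : α → ℕ → State → ℝ) (n : ℕ) (ψ : State) :
    x.exp (fun a m φ => r * F a m φ) n ψ = r * x.exp F n ψ :=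
  List.sum_map_mul_left ..

theorem Complete.exp_norm {x : SM α} (h : x.Complete) (n : ℕ) (ψ : State) :
    x.exp (fun _ _ φ => ‖φ‖ ^ 2) n ψ = ‖ψ‖ ^ 2 := h _ ψ

end SM

theorem SM.exp_nonneg {α : Type} {x : SM α} {F : α → ℕ → State → ℝ} (h : ∀ a n ψ, 0 ≤ F a n ψ)
    (n : ℕ) (ψ : State) : 0 ≤ x.exp F n ψ :=
  List.sum_nonneg (by simp only [List.mem_map]; rintro _ ⟨b, -, rfl⟩; exact h _ _ _)

theorem exp_meas (F : Data → ℕ → State → ℝ) (n : ℕ) (ψ : State) (q : ℕ) :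
    (sem .meas (qubit q)).exp F n ψ = F (pair (bit false) (qubit q)) n (proj q false ψ) +
      F (pair (bit true) (qubit q)) n (proj q true ψ) := by
  simp [SM.exp, sem, Word.lin, Op.lin]

/-- The test succeeds at least as often as the decryption, measured as a one-qubit message, gives
the right bit. -/
theorem fits_ge (dec : Prog) (n : ℕ) (fk ct : Data) (b : Bool) (k : ℕ) (ψ : State) :
    (sem dec (pair (ofNat n) (pair fk ct))).exp (fun out _ φ =>
      if out.toReg.length = 1 then ‖proj (out.toReg.getD 0 0) b φ‖ ^ 2 else 0) k ψ ≤
    (fits dec n (pair fk (pair ct (bit b)))).val (k + ·) ψ := by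
  rw [← exp_test, test, exp_comp, exp_comp, exp_comp]
  refine SM.exp_mono fun br _ => ?_
  rw [exp_fst]
  have hF : ∀ (a : Data) m φ, 0 ≤ (sem .id (bit b)).exp (fun b => (sem same (pair a b)).exp accF)
      m φ := fun a m φ => SM.exp_nonneg (fun _ _ _ => SM.exp_nonneg (fun d _ _ => by
        rw [accF]; split_ifs <;> positivity) _ _) _ _
  split_ifs with h
  · rcases hout : br.val with _ | _ | ⟨_ | q | _, r⟩
    case pair.qubit =>
      rw [fst_pair, exp_meas]
      simp only [exp_fst, fst_pair, exp_id, exp_same]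
      cases b <;> simp [accF, bit, agree, toReg]
    all_goals simp [hout, toReg] at h
  · exact SM.exp_nonneg (fun _ _ _ => SM.exp_nonneg (fun _ _ _ => hF _ _ _) _ _) _ _

section correct

variable (S : QFE) (n : ℕ)

/-- The branches of key generation, encryption and decryption. -/
def roundTripSM (mk : Data) (C : Circuit) (m : List ℕ) : SM (List ℕ) :=
  (keyGenSM S n mk C).bind fun fk => (encSM S n mk m).bind fun ct =>
    (sem S.dec (pair (ofNat n) (pair fk ct))).bind fun out => SM.ret 0 out.toReg

theorem impl_roundTrip (mk : Data) (C : Circuit) (m : List ℕ) :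
    Impl (S.roundTrip n mk C m) (roundTripSM S n mk C m) :=
  (impl_eval _ _).bind fun _ => (impl_eval _ _).bind fun _ => (impl_eval _ _).bind fun _ =>
    Impl.pure _

theorem impl_run_idCircuit (q : ℕ) : Impl (idCircuit.run [q]) (SM.ret 0 [q]) := by
  intro μ
  simp [Circuit.run, idCircuit, SM.ret, Word.lin]

/-- The pure state in which the qubit `0` is `b` and there is no other one. -/
def bitKet (b : Bool) : State := ket (if b then {0} else ∅)

theorem bitKet_suppIn (b : Bool) : (bitKet b).SuppIn (Set.Iio 1) :=
  State.SuppIn.ket (by cases b <;> simp)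

/-- If the scheme works well on the bit `b` then so does the attack. -/
theorem le_hit {B : ℕ} {mk : Data} (hmk : mk.names = []) (b : Bool) {ε : ℝ}
    (hB : ∀ ν, ∀ br ∈ keyGenSM S n mk idCircuit ν, br.val.size < B)
    (h : traceDist (density 1 ((· ++ []) <$> idCircuit.run [0]) ⟨1, bitKet b, 0⟩)
      (density 1 ((· ++ []) <$> S.roundTrip n mk idCircuit [0]) ⟨1, bitKet b, 0⟩) ≤ ε) :
    1 - 2 * ε ≤ hit S n B mk b := by
  have hb : (bit b).names = [] := by cases b <;> rfl
  have hid := density_apply ((impl_run_idCircuit 0).map (· ++ [])) ⟨1, bitKet b, 0⟩ b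
  have hrt := density_apply ((impl_roundTrip S n mk idCircuit [0]).map (· ++ []))
    ⟨1, bitKet b, 0⟩ b
  have hone : ‖proj 0 b (bitKet b)‖ = 1 := by
    rw [bitKet, proj_ket, if_pos (by cases b <;> simp), norm_ket]
  have h1 := (norm_apply_le_traceNorm _ fun _ => b).trans (show traceNorm _ ≤ 2 * ε by
    rw [traceDist] at h; linarith)
  rw [Matrix.sub_apply, hid, hrt, ← Complex.ofReal_sub, Complex.norm_real, Real.norm_eq_abs] at h1
  have h2 := (abs_le.1 h1).2
  simp only [SM.exp_bind, SM.exp_ret, SM.exp_ret', SM.exp_bind', List.append_nil,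
    List.length_singleton, if_true, List.getD_cons_zero, hone, roundTripSM] at h2
  set E := pair (ofNat n) (pair mk (pair (qubit 0) Data.nil))
  set D := pair (ofNat n) (pair mk idCircuit.encode)
  have hE : ∀ q ∈ E.names, q < 1 := by simp [E, names, names_ofNat, hmk]
  have hD : D.names = [] := by simp [D, names, names_ofNat, hmk, names_encode_idCircuit]
  let T : Data → Eff := fun t => fits S.dec n (pair (cut B t.snd) (pair t.fst (bit b)))
  have hT : Eff.Fam ∅ T := (fam_fits S.dec n).comp ((unif_cut B (Eff.Unif.id ∅).snd).pair
    ((Eff.Unif.id ∅).fst.pair (Eff.Unif.const (d := bit b) (by simp [hb]))))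
  -- Correctness speaks of keys generated before the encryption, the attack asks for its key
  -- afterwards.
  have hswap : hit S n B mk b = (keyGenSM S n mk idCircuit).exp (fun fk => (encSM S n mk [0]).exp
      fun ct m φ => (T (pair ct fk)).val (m + ·) φ) 1 (bitKet b) := by
    have h3 := Eff.val_swap (n := 1) (p := S.enc) (q := S.keyGen) (d := E) (e := D) hT
      (Set.empty_subset _) hE (by simp [hD]) (by simp [hD]) (bitKet_suppIn b)
    refine h3.trans ?_
    rw [← exp_val]
    refine SM.exp_congr fun br _ => ?_
    exact (exp_val (sem S.enc E) (fun ct => T (pair ct br.val)) _ _).symm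
  rw [hswap]
  refine le_trans (show _ ≤ (keyGenSM S n mk idCircuit).exp (fun fk => (encSM S n mk [0]).exp
    fun ct => (sem S.dec (pair (ofNat n) (pair fk ct))).exp fun out _ φ =>
      if out.toReg.length = 1 then ‖proj (out.toReg.getD 0 0) b φ‖ ^ 2 else 0) 1 (bitKet b) by
    linarith) ?_
  refine SM.exp_mono fun br hbr => SM.exp_mono fun br' _ =>
    (fits_ge S.dec n br.val br'.val b _ _).trans_eq ?_
  have hcut : cut B br.val = br.val := if_pos (hB _ br hbr)
  simp only [T, fst_pair, snd_pair, hcut]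

/-- The real experiment accepts with overwhelming probability. -/
theorem real_ge {S : QFE} (hS : S.IsCorrect) (c c' : ℕ) (hN : ∀ n, 0 < sqFun^[c'] n)
    (hB : ∀ n ν ν', ∀ b ∈ setupSM S n ν, ∀ br ∈ keyGenSM S n b.val idCircuit ν',
      br.val.size < sqFun^[c] n) :
    ∃ ε : ℕ → ℝ, Negligible ε ∧ ∀ n,
      1 - ε n ≤ (realSM S (attack c c' S.dec) n).exp accF 0 (ket ∅) := by
  -- The master keys for which the bit `b` survives encryption and decryption up to `ε`.
  let Good : ℕ → Bool → ℝ → Data → Prop := fun n b ε mk =>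
    traceDist (density 1 ((· ++ []) <$> idCircuit.run [0]) ⟨1, bitKet b, 0⟩)
      (density 1 ((· ++ []) <$> S.roundTrip n mk idCircuit [0]) ⟨1, bitKet b, 0⟩) ≤ ε
  have hcor : ∀ b : Bool, ∃ ε : ℕ → ℝ, Negligible ε ∧ ∀ n,
      1 - ε n ≤ prob (S.runSetup n) Mem.init (Good n b (ε n)) := by
    intro b
    refine hS (fun _ => idCircuit) (fun _ => 0) (fun _ => bitKet b)
      (fun _ => idCircuit_wellFormed) ⟨Polynomial.C idCircuit.encode.size, fun n => by simp⟩ ?_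
    intro n
    refine ⟨by rw [State.normSq_eq, bitKet, norm_ket, one_pow], fun s hs q hq => ?_⟩
    have := bitKet_suppIn b s hs q hq
    simpa [idCircuit] using this
  choose ε hε hprob using hcor
  refine ⟨fun n => 3 * (|ε false n| + |ε true n|), ?_, fun n => ?_⟩
  · have habs : ∀ b, Negligible fun n => |ε b n| := fun b =>
      (hε b).trans_abs_le fun n => by simp
    exact ((habs false).add (habs true)).const_mul 3
  rw [exp_real S c c' n (hN n)]
  let G : Bool → Data → ℕ → State → ℝ := fun b mk _ φ =>
    if Good n b (ε b n) mk then ‖φ‖ ^ 2 else 0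
  have hp : ∀ b, 1 - |ε b n| ≤ (setupSM S n).exp (G b) 0 (ket ∅) := fun b => by
    have h := hprob b n
    rw [(impl_setup S n).prob_eq] at h
    exact le_trans (by linarith [le_abs_self (ε b n)]) h
  have hcomplete : (setupSM S n).Complete := (sem_complete _ _).bind fun _ => SM.Complete.ret _ _
  have htot := hcomplete.exp_norm 0 (ket ∅)
  rw [norm_ket, one_pow] at htot
  have hf := hp false
  have ht := hp true
  set e := |ε false n| + |ε true n| with he
  have he0 : |ε false n| ≤ e := by simp [he]
  have he1 : |ε true n| ≤ e := by simp [he]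
  -- The bound `𝟙[G false] + 𝟙[G true] - (1 + 2 * e)` on the success probability for a given master
  -- key is trivial unless both bits are good.
  calc 1 - 3 * e
      ≤ (setupSM S n).exp (G false) 0 (ket ∅) + (setupSM S n).exp (G true) 0 (ket ∅) +
          (-(1 + 2 * e)) * 1 := by linarith
    _ = (setupSM S n).exp (fun mk m φ => G false mk m φ + G true mk m φ +
          (-(1 + 2 * e)) * ‖φ‖ ^ 2) 0 (ket ∅) := by
        rw [SM.exp_add, SM.exp_add, SM.exp_mul_left, htot]
    _ ≤ _ := SM.exp_mono fun br hbr => ?_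
  have hmk : br.val.names = [] := by
    obtain ⟨b₁, -, b₂, h₂, rfl⟩ := Poly.mem_bind hbr
    simp only [SM.ret, List.mem_singleton] at h₂
    subst h₂
    exact names_classical _
  have hhit : ∀ b, Good n b (ε b n) br.val → 1 - 2 * e ≤ hit S n (sqFun^[c] n) br.val b :=
    fun b hb => le_trans (by cases b <;> linarith [le_abs_self (ε false n), le_abs_self (ε true n)])
      (le_hit S n hmk b (fun ν' => hB n _ ν' br hbr) hb)
  have h0 : 0 ≤ average S n (sqFun^[c] n) (sqFun^[c'] n) br.val :=
    le_average S n fun b => Eff.val_nonneg _ _ _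
  have hφ : 0 ≤ ‖br.word.lin (ket ∅)‖ ^ 2 := by positivity
  have he : 0 ≤ e := by positivity
  by_cases g0 : Good n false (ε false n) br.val
  · by_cases g1 : Good n true (ε true n) br.val
    · simp only [G, if_pos g0, if_pos g1]
      have := le_average S n (B := sqFun^[c] n) (N := sqFun^[c'] n) (mk := br.val) (L := 1 - 2 * e)
        fun b => by cases b; exacts [hhit false g0, hhit true g1]
      nlinarith
    · simp only [G, if_pos g0, if_neg g1]
      nlinarith [mul_nonneg hφ h0, mul_nonneg he hφ]
  · by_cases g1 : Good n true (ε true n) br.val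
    · simp only [G, if_neg g0, if_pos g1]
      nlinarith [mul_nonneg hφ h0, mul_nonneg he hφ]
    · simp only [G, if_neg g0, if_neg g1]
      nlinarith [mul_nonneg hφ h0, mul_nonneg he hφ]

end correct

/-! ### Growth -/

theorem sqFun_pos (k : ℕ) : 0 < sqFun k := Nat.succ_pos _

theorem pow_le_iterate_sqFun (c n : ℕ) : (n + 2) ^ 2 ^ c ≤ sqFun^[c + 1] n + 1 := by
  induction c with
  | zero => simp [sqFun]; nlinarith
  | succ c ih =>
    rw [Function.iterate_succ_apply', pow_succ, pow_mul]
    refine (Nat.pow_le_pow_left ih 2).trans ?_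
    simp only [sqFun]; nlinarith

/-- Every polynomial is dominated by an iterate of `sqFun`. -/
theorem exists_lt_iterate_sqFun (Q : Polynomial ℕ) : ∃ c, ∀ n, Q.eval n < sqFun^[c] n := by
  have h1 : ∀ n, Q.eval n ≤ Q.eval 1 * (n + 2) ^ Q.natDegree := by
    intro n
    rw [Polynomial.eval_eq_sum_range, Polynomial.eval_eq_sum_range, Finset.sum_mul]
    refine Finset.sum_le_sum fun i hi => ?_
    rw [one_pow, mul_one]
    refine Nat.mul_le_mul_left _ ((Nat.pow_le_pow_left (by omega) i).trans
      (Nat.pow_le_pow_right (by omega) ?_))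
    have := Finset.mem_range.1 hi
    omega
  set s := Q.eval 1 + Q.natDegree + 1
  refine ⟨s + 1, fun n => ?_⟩
  have h2 : (n + 2) ^ s ≤ (n + 2) ^ 2 ^ s :=
    Nat.pow_le_pow_right (by omega) (Nat.lt_two_pow_self).le
  have h3 := pow_le_iterate_sqFun s n
  have h4 : Q.eval 1 < (n + 2) ^ Q.eval 1 := Nat.lt_pow_self (by omega)
  have h5 : (n + 2) ^ s = (n + 2) ^ Q.eval 1 * (n + 2) ^ Q.natDegree * (n + 2) := by
    rw [pow_succ, pow_add]
  have h6 : 0 < (n + 2) ^ Q.natDegree := by positivity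
  have h7 := h1 n
  have h8 : Q.eval 1 * (n + 2) ^ Q.natDegree < (n + 2) ^ Q.eval 1 * (n + 2) ^ Q.natDegree :=
    Nat.mul_lt_mul_of_pos_right h4 h6
  nlinarith

theorem exists_poly_iterate_sqFun (c : ℕ) : ∃ Q : Polynomial ℕ, ∀ n, sqFun^[c] n = Q.eval n := by
  induction c with
  | zero => exact ⟨Polynomial.X, fun n => by simp⟩
  | succ c ih =>
    obtain ⟨Q, hQ⟩ := ih
    refine ⟨2 * Q ^ 2 + 2 * Q + 1, fun n => ?_⟩
    rw [Function.iterate_succ_apply', hQ]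
    simp [sqFun]

/-- The size of keys for the identity is bounded by a function that the attack can compute. -/
theorem exists_key_bound {S : QFE} (h₁ : S.setup.Poly) (h₂ : S.keyGen.Poly) :
    ∃ c, ∀ n, 0 < sqFun^[c] n ∧ ∀ ν ν', ∀ b ∈ setupSM S n ν,
      ∀ br ∈ keyGenSM S n b.val idCircuit ν', br.val.size < sqFun^[c] n := by
  obtain ⟨P₁, hP₁⟩ := h₁
  obtain ⟨P₂, hP₂⟩ := h₂
  let Q₁ : Polynomial ℕ := 2 * Polynomial.X + 1
  let Q₂ : Polynomial ℕ := Q₁ + 4 * P₁.comp Q₁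
  let Q₃ : Polynomial ℕ := Q₁ + Q₂ + Polynomial.C (idCircuit.encode.size + 2)
  obtain ⟨c, hc⟩ := exists_lt_iterate_sqFun (Q₃ + 4 * P₂.comp Q₃)
  refine ⟨c, fun n => ⟨(Nat.zero_le _).trans_lt (hc n), fun ν ν' b hb br hbr =>
    lt_of_le_of_lt ?_ (hc n)⟩⟩
  have e₁ : (ofNat n).size = Q₁.eval n := by simp [Q₁, size_ofNat]
  have e₂ : b.val.size ≤ Q₂.eval n := by
    obtain ⟨b₁, h₁, b₂, h₂, rfl⟩ := Poly.mem_bind hb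
    simp only [SM.ret, List.mem_singleton] at h₂
    subst h₂
    have h3 := hP₁ _ _ b₁ h₁
    have h4 := sem_sized _ _ _ b₁ h₁
    rw [e₁] at h3 h4
    simp only [Br.andThen, size_classical, Q₂, Polynomial.eval_add, Polynomial.eval_mul,
      Polynomial.eval_comp, Polynomial.eval_ofNat]
    omega
  have e₃ : (pair (ofNat n) (pair b.val idCircuit.encode)).size ≤ Q₃.eval n := by
    simp only [Data.size, Q₃, Polynomial.eval_add, Polynomial.eval_C, e₁]
    omega
  have h3 := (hP₂ _ _ br hbr).trans (poly_mono P₂ e₃)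
  have h4 := sem_sized _ _ _ br hbr
  simp only [Polynomial.eval_add, Polynomial.eval_mul, Polynomial.eval_comp, Polynomial.eval_ofNat]
  omega

/-! ### Positive operators of effects -/

/-- The sum of the operators `wᴴ w`, given by its inner products, is local to the qubits in the
words. -/
theorem exists_posOp (W : List Word) :
    ∃ E : Module.End ℂ State, (∀ x y, ⟪x, E y⟫_ℂ = (W.map fun w => ⟪w.lin x, w.lin y⟫_ℂ).sum) ∧
      ∀ A : Set ℕ, (∀ w ∈ W, ∀ q ∈ w.names, q ∈ A) → E ∈ localAlg A := by
  have hlocal : ∃ E ∈ localAlg {q | ∃ w ∈ W, q ∈ w.names},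
      ∀ x y, ⟪x, E y⟫_ℂ = (W.map fun w => ⟪w.lin x, w.lin y⟫_ℂ).sum := by
    induction W with
    | nil => exact ⟨0, zero_mem _, fun x y => by simp⟩
    | cons w W ih =>
      obtain ⟨E, hE, h⟩ := ih
      obtain ⟨K, hK, h'⟩ := exists_adjoint (Word.lin_mem (w := w) (A := {q | q ∈ w.names})
        fun q hq => hq)
      refine ⟨K * w.lin + E, add_mem (mul_mem (localAlg_mono ?_ hK) (Word.lin_mem ?_))
        (localAlg_mono ?_ hE), fun x y => ?_⟩
      · exact fun q hq => ⟨w, by simp, hq⟩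
      · exact fun q hq => ⟨w, by simp, hq⟩
      · exact fun q ⟨w', hw', hq⟩ => ⟨w', by simp [hw'], hq⟩
      · rw [LinearMap.add_apply, inner_add_right, h, Module.End.mul_apply, List.map_cons,
          List.sum_cons, ← h']
  obtain ⟨E, hE, h⟩ := hlocal
  refine ⟨E, h, fun A hA => localAlg_mono ?_ hE⟩
  rintro q ⟨w, hw, hq⟩
  exact hA w hw q hq

/-- The positive operator `∑ wᴴ w` of an effect given by a list of words. -/
def posOp (W : List Word) : Module.End ℂ State := (exists_posOp W).choose

theorem inner_posOp (W : List Word) (x y : State) :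
    ⟪x, posOp W y⟫_ℂ = (W.map fun w => ⟪w.lin x, w.lin y⟫_ℂ).sum :=
  (exists_posOp W).choose_spec.1 x y

theorem posOp_mem {W : List Word} {A : Set ℕ} (h : ∀ w ∈ W, ∀ q ∈ w.names, q ∈ A) :
    posOp W ∈ localAlg A := (exists_posOp W).choose_spec.2 A h

theorem inner_rename (σ : Equiv.Perm ℕ) (x y : State) :
    ⟪rename σ x, rename σ y⟫_ℂ = ⟪x, y⟫_ℂ :=
  inner_moveKets (Finset.map_injective _) x y

theorem rename_posOp (σ : Equiv.Perm ℕ) (W : List Word) :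
    rename σ * posOp W = posOp (W.map (Word.map σ)) * rename σ := by
  have hsurj : Function.Surjective (rename σ) := fun y => ⟨rename σ.symm y, by
    rw [← Module.End.mul_apply]
    refine LinearMap.congr_fun (f := rename σ * rename σ.symm) (g := 1)
      (State.hom_ext fun s => ?_) y
    rw [Module.End.mul_apply, rename_ket, rename_ket, Finset.map_map]
    simp [Finset.map_eq_image, Function.comp_def]⟩
  refine LinearMap.ext fun y => ext_inner_left ℂ fun x => ?_
  obtain ⟨x, rfl⟩ := hsurj x
  rw [Module.End.mul_apply, Module.End.mul_apply, inner_rename, inner_posOp, inner_posOp,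
    List.map_map]
  congr 1
  refine List.map_congr_left fun w _ => ?_
  have h : ∀ z, (w.map σ).lin (rename σ z) = rename σ (w.lin z) := fun z =>
    (LinearMap.congr_fun (rename_word σ w) z).symm
  rw [Function.comp_apply, h, h, inner_rename]

/-- The probability of acceptance. -/
def weight (W : List Word) (x : State) : ℝ := (W.map fun w => ‖w.lin x‖ ^ 2).sum

theorem weight_nonneg (W : List Word) (x : State) : 0 ≤ weight W x :=
  List.sum_nonneg (by simp only [List.mem_map]; rintro _ ⟨w, -, rfl⟩; positivity)

theorem re_inner_posOp (W : List Word) (x : State) :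
    (⟪x, posOp W x⟫_ℂ).re = weight W x := by
  rw [inner_posOp, weight]
  induction W with
  | nil => simp
  | cons w W ih =>
    rw [List.map_cons, List.sum_cons, Complex.add_re, ih, List.map_cons, List.sum_cons,
      inner_self_eq_norm_sq_to_K]
    norm_cast

theorem weight_sub (W : List Word) (x y : State) :
    weight W (x - y) = weight W x - 2 * (⟪y, posOp W x⟫_ℂ).re + weight W y := by
  rw [inner_posOp, weight, weight, weight]
  induction W with
  | nil => simp
  | cons w W ih =>
    simp only [List.map_cons, List.sum_cons, Complex.add_re, ih]
    have h := @norm_sub_sq ℂ _ _ _ _ (w.lin x) (w.lin y)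
    have h' : RCLike.re ⟪w.lin x, w.lin y⟫_ℂ = (⟪w.lin y, w.lin x⟫_ℂ).re :=
      inner_re_symm _ _
    rw [map_sub, h, h']
    ring

/-- The operator `E` satisfies `E * E ≤ E`; the proof evaluates the positive form `weight W` at
`x - E x`. -/
theorem norm_posOp_sq_le {W : List Word} (hW : ∀ x, weight W x ≤ ‖x‖ ^ 2) (x : State) :
    ‖posOp W x‖ ^ 2 ≤ weight W x := by
  have h1 := weight_nonneg W (x - posOp W x)
  have h2 := hW (posOp W x)
  have h3 : (⟪posOp W x, posOp W x⟫_ℂ).re = ‖posOp W x‖ ^ 2 := inner_self_eq_norm_sq (𝕜 := ℂ) _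
  rw [weight_sub, h3] at h1
  linarith

theorem norm_sub_posOp_sq_le {W : List Word} (hW : ∀ x, weight W x ≤ ‖x‖ ^ 2) (x : State) :
    ‖x - posOp W x‖ ^ 2 ≤ ‖x‖ ^ 2 - weight W x := by
  rw [@norm_sub_sq ℂ]
  have := norm_posOp_sq_le hW x
  have h2 := re_inner_posOp W x
  change _ - 2 * (⟪x, posOp W x⟫_ℂ).re + _ ≤ _
  linarith

theorem norm_posOp_le {W : List Word} (hW : ∀ x, weight W x ≤ ‖x‖ ^ 2) (x : State) :
    ‖posOp W x‖ ≤ ‖x‖ :=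
  abs_le_of_sq_le_sq' ((norm_posOp_sq_le hW x).trans (hW x)) (norm_nonneg _) |>.2

/-! ### Products of contractions -/

/-- Telescoping: the errors of contractions that nearly fix a vector add up. -/
theorem norm_sub_prod_le {ι : Type} (E : ι → Module.End ℂ State) (l : List ι)
    (h : ∀ i ∈ l, ∀ x, ‖E i x‖ ≤ ‖x‖) (x : State) :
    ‖x - (l.map E).prod x‖ ≤ (l.map fun i => ‖x - E i x‖).sum := by
  induction l with
  | nil => simp
  | cons i l ih =>
    rw [List.map_cons, List.prod_cons, List.map_cons, List.sum_cons, Module.End.mul_apply]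
    have : x - E i ((l.map E).prod x) = (x - E i x) + E i (x - (l.map E).prod x) := by
      rw [map_sub]; abel
    rw [this]
    refine (norm_add_le _ _).trans (add_le_add le_rfl ?_)
    exact (h i (by simp) _).trans (ih fun j hj => h j (by simp [hj]))

/-- If every one of the operators nearly fixes a vector, then the product does not make it much
shorter: a sequence of gentle measurements is gentle. -/
theorem norm_sq_le_prod {ι : Type} [DecidableEq ι] (E : ι → Module.End ℂ State) {l : List ι}
    (hl : l.Nodup) (h : ∀ i ∈ l, ∀ x, ‖E i x‖ ≤ ‖x‖) (x : State) :
    ‖x‖ ^ 2 ≤ 2 * ‖(l.map E).prod x‖ ^ 2 +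
      2 * l.length * (l.map fun i => ‖x - E i x‖ ^ 2).sum := by
  have h1 := norm_sub_prod_le E l h x
  have h2 : (l.map fun i => ‖x - E i x‖).sum ^ 2 ≤
      l.length * (l.map fun i => ‖x - E i x‖ ^ 2).sum := by
    rw [← List.sum_toFinset _ hl, ← List.sum_toFinset _ hl, ← List.toFinset_card_of_nodup hl]
    exact sq_sum_le_card_mul_sum_sq
  have h3 : ‖x - (l.map E).prod x‖ ^ 2 ≤ (l.map fun i => ‖x - E i x‖).sum ^ 2 :=
    pow_le_pow_left₀ (norm_nonneg _) h1 2
  have h4 : ‖x‖ ≤ ‖(l.map E).prod x‖ + ‖x - (l.map E).prod x‖ := by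
    have := norm_add_le ((l.map E).prod x) (x - (l.map E).prod x)
    rwa [add_sub_cancel] at this
  nlinarith [sq_nonneg (‖(l.map E).prod x‖ - ‖x - (l.map E).prod x‖), norm_nonneg x,
    norm_nonneg ((l.map E).prod x), norm_nonneg (x - (l.map E).prod x)]

/-- A vector that is independent of `m` passes all tests for the bits of `m` with probability at
most `2 ^ (-l.length)`, averaged over `m`: the two tests at a position exclude each other, so that
each one halves the sum. -/
theorem sum_prod_le {ι : Type} (E : ι → Bool → Module.End ℂ State) (p : ι → ℕ) (R : Finset ℕ)
    (l : List ι) (hp : ∀ i ∈ l, p i ∈ R) (hl : (l.map p).Nodup)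
    (h : ∀ i ∈ l, ∀ x, ‖E i false x‖ ^ 2 + ‖E i true x‖ ^ 2 ≤ ‖x‖ ^ 2) (u : State) :
    2 ^ l.length * ∑ m ∈ R.powerset, ‖(l.map fun i => E i (decide (p i ∈ m))).prod u‖ ^ 2 ≤
      2 ^ R.card * ‖u‖ ^ 2 := by
  induction l with
  | nil => simp [Finset.card_powerset]
  | cons i l ih =>
    have ih' := ih (fun j hj => hp j (by simp [hj])) (List.nodup_cons.1 hl).2
      fun j hj => h j (by simp [hj])
    refine le_trans ?_ ih'
    rw [List.length_cons, pow_succ, mul_assoc]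
    refine mul_le_mul_of_nonneg_left ?_ (by positivity)
    have hi : p i ∈ R := hp i (by simp)
    have hne : ∀ j ∈ l, p j ≠ p i := fun j hj e =>
      (List.nodup_cons.1 hl).1 (List.mem_map.2 ⟨j, hj, e⟩)
    rw [← Finset.insert_erase hi, Finset.sum_powerset_insert (Finset.notMem_erase _ _),
      Finset.sum_powerset_insert (Finset.notMem_erase _ _), ← Finset.sum_add_distrib,
      ← Finset.sum_add_distrib, Finset.mul_sum]
    refine Finset.sum_le_sum fun m hm => ?_
    have him : p i ∉ m := fun hh => by simpa using Finset.mem_powerset.1 hm hh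
    have hrest : (l.map fun j => E j (decide (p j ∈ insert (p i) m))) =
        l.map fun j => E j (decide (p j ∈ m)) :=
      List.map_congr_left fun j hj => by simp [hne j hj]
    rw [List.map_cons, List.map_cons, List.prod_cons, List.prod_cons, hrest]
    simp only [Module.End.mul_apply, him, Finset.mem_insert_self, decide_true, decide_false]
    have := h i (by simp) ((l.map fun j => E j (decide (p j ∈ m))).prod u)
    linarith

/-! ### Short keys -/

/-- One instruction of a stack machine that builds data: push `nil`, push the next qubit, pair the
two topmost data, do nothing. -/
def buildStep (ν : ℕ → ℕ) (s : List Data × ℕ) : Fin 4 → List Data × ℕ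
  | 0 => (Data.nil :: s.1, s.2)
  | 1 => (qubit (ν s.2) :: s.1, s.2 + 1)
  | 2 =>
    match s.1 with
    | b :: a :: l => (pair a b :: l, s.2)
    | _ => s
  | 3 => s

/-- Every datum is built by as many instructions as its size, provided that its qubits are the next
ones in the stream. -/
theorem exists_build (ν : ℕ → ℕ) (d : Data) (j r : ℕ) (l : List Data)
    (h : d.names = (List.range r).map fun i => ν (j + i)) :
    ∃ w : List (Fin 4), w.length = d.size ∧ w.foldl (buildStep ν) (l, j) = (d :: l, j + r) := by
  induction d generalizing j r l with
  | nil =>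
    have : r = 0 := by simpa [names] using (congrArg List.length h).symm
    subst this
    exact ⟨[0], rfl, rfl⟩
  | qubit q =>
    have : r = 1 := by simpa [names] using (congrArg List.length h).symm
    subst this
    have : q = ν j := by simpa [names] using h
    subst this
    exact ⟨[1], rfl, rfl⟩
  | pair a b iha ihb =>
    have hr : a.names.length + b.names.length = r := by
      simpa [names] using congrArg List.length h
    have hsplit : (List.range r).map (fun i => ν (j + i)) =
        (List.range a.names.length).map (fun i => ν (j + i)) ++
          (List.range b.names.length).map fun i => ν (j + a.names.length + i) := by
      rw [← hr, List.range_add, List.map_append, List.map_map]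
      simp [Function.comp_def, add_assoc]
    rw [hsplit, names] at h
    obtain ⟨ha, hb⟩ := List.append_inj h (by simp)
    obtain ⟨w₁, hw₁, h₁⟩ := iha j _ l ha
    obtain ⟨w₂, hw₂, h₂⟩ := ihb _ _ (a :: l) hb
    refine ⟨w₁ ++ w₂ ++ [2], by simp [hw₁, hw₂, Data.size]; omega, ?_⟩
    rw [List.foldl_append, List.foldl_append, h₁, h₂]
    simp [buildStep, ← hr, add_assoc]

open Classical in
/-- A finite set containing all data of size at most `B` whose qubits are `ν 0, ν 1, …`. -/
def catalog (ν : ℕ → ℕ) (B : ℕ) : Finset Data :=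
  Finset.univ.image fun g : Fin B → Fin 4 =>
    ((List.ofFn g).foldl (buildStep ν) ([], 0)).1.headD Data.nil

open Classical in
theorem card_catalog_le (ν : ℕ → ℕ) (B : ℕ) : (catalog ν B).card ≤ 4 ^ B :=
  Finset.card_image_le.trans (by simp)

theorem mem_catalog {ν : ℕ → ℕ} {B : ℕ} {d : Data} (hd : d.size ≤ B) {r : ℕ}
    (h : d.names = (List.range r).map ν) : d ∈ catalog ν B := by
  classical
  obtain ⟨w, hw, e⟩ := exists_build ν d 0 r [] (by simpa using h)
  obtain ⟨k, rfl⟩ := Nat.exists_eq_add_of_le hd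
  have hlen : (w ++ List.replicate k 3).length = d.size + k := by simp [hw]
  refine Finset.mem_image.2 ⟨fun i => (w ++ List.replicate k 3).get (i.cast hlen.symm),
    Finset.mem_univ _, ?_⟩
  have hofn : List.ofFn (fun i : Fin (d.size + k) =>
      (w ++ List.replicate k 3).get (i.cast hlen.symm)) = w ++ List.replicate k 3 := by
    apply List.ext_get
    · simp [hw]
    · intro i h₁ h₂
      simp
  have hpad : ∀ (k : ℕ) s, (List.replicate k (3 : Fin 4)).foldl (buildStep ν) s = s := by
    intro k
    induction k with
    | zero => intro s; rfl
    | succ k ih => intro s; rw [List.replicate_succ, List.foldl_cons]; exact ih s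
  rw [hofn, List.foldl_append, e, hpad]
  rfl

/-- A family of operators, depending on a datum, which are local to `A` and the qubits of the datum
and equivariant under renamings that fix `A`. -/
structure OpFam (A : Set ℕ) (F : Data → Module.End ℂ State) : Prop where
  mem : ∀ d, F d ∈ localAlg (A ∪ {q | q ∈ d.names})
  equivariant : ∀ σ : Equiv.Perm ℕ, (∀ q ∈ A, σ q = q) → ∀ d,
    rename σ * F d = F (d.map σ) * rename σ

theorem OpFam.prod {ι : Type} {A : Set ℕ} {F : ι → Data → Module.End ℂ State} (l : List ι)
    (h : ∀ i ∈ l, OpFam A (F i)) : OpFam A fun d => (l.map fun i => F i d).prod := by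
  induction l with
  | nil => exact ⟨fun d => by simp, fun σ _ d => by simp⟩
  | cons i l ih =>
    have hi := h i (by simp)
    have hl := ih fun j hj => h j (by simp [hj])
    refine ⟨fun d => ?_, fun σ hσ d => ?_⟩
    · rw [List.map_cons, List.prod_cons]
      exact mul_mem (hi.mem d) (hl.mem d)
    · simp only [List.map_cons, List.prod_cons]
      rw [← mul_assoc, hi.equivariant σ hσ, mul_assoc, hl.equivariant σ hσ, mul_assoc]

theorem local_comm {A B : Set ℕ} (h : Disjoint A B) {K L : Module.End ℂ State}
    (hK : K ∈ localAlg A) (hL : L ∈ localAlg B) (x : State) : K (L x) = L (K x) :=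
  LinearMap.congr_fun (commute_of_disjoint h hK hL).eq x

/-- A fresh qubit in a random state `0` or `1` may stand in for a qubit of the datum, at the
price of a factor `2`. -/
theorem OpFam.replace {A : Set ℕ} {F : Data → Module.End ℂ State} (hF : OpFam A F) {d : Data}
    {a a' : ℕ} (ha : a ∉ A) (ha' : a' ∉ A) (hd' : a' ∉ d.names) {x : State}
    (hx : x.SuppIn {q | q ≠ a'}) :
    ‖F d x‖ ^ 2 ≤ 2 * (‖F (d.map (Equiv.swap a a')) x‖ ^ 2 +
      ‖F (d.map (Equiv.swap a a')) (flip {a'} x)‖ ^ 2) := by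
  classical
  by_cases haa : a = a'
  · subst haa
    rw [Equiv.swap_self]
    have : d.map (Equiv.refl ℕ) = d := map_eq_self fun q _ => rfl
    rw [this]
    nlinarith [sq_nonneg ‖F d x‖, sq_nonneg ‖F d (flip {a} x)‖]
  set σ := Equiv.swap a a'
  have hσ : ∀ q ∈ A, σ q = q := fun q hq =>
    Equiv.swap_apply_of_ne_of_ne (fun e => ha (e ▸ hq)) fun e => ha' (e ▸ hq)
  have hx0 : proj a' false x = x := by
    ext s
    rw [proj_apply]
    by_cases hs : s ∈ x.support
    · have : a' ∉ s := fun h => hx s hs a' h rfl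
      simp [this]
    · simp [Finsupp.notMem_support_iff.1 hs]
  have hfix : ∀ b : Bool, rename σ (flip (if b then {a'} else ∅) (proj a b x)) =
      flip (if b then {a'} else ∅) (proj a b x) := by
    intro b
    have h : rename σ * flip (if b then {a'} else ∅) * proj a b * proj a' false =
        flip (if b then {a'} else ∅) * proj a b * proj a' false := by
      refine State.hom_ext fun s => ?_
      simp only [Module.End.mul_apply, proj_ket]
      by_cases h1 : a' ∈ s
      · simp [h1]
      · by_cases h2 : decide (a ∈ s) = b
        · simp only [h1, decide_false, if_true, proj_ket, h2, flip_ket, rename_ket]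
          congr 1
          ext q
          simp only [Finset.mem_map_equiv, σ, Equiv.symm_swap]
          by_cases hqa : q = a
          · subst hqa
            rw [Equiv.swap_apply_left]
            cases b <;> simp_all [Finset.mem_symmDiff]
          · by_cases hqa' : q = a'
            · subst hqa'
              rw [Equiv.swap_apply_right]
              cases b <;> simp_all [Finset.mem_symmDiff]
            · rw [Equiv.swap_apply_of_ne_of_ne hqa hqa']
        · simp [h1, proj_ket, h2]
    have := LinearMap.congr_fun h x
    simpa only [Module.End.mul_apply, hx0] using this
  have hdis₁ : Disjoint (A ∪ {q | q ∈ d.names}) {a'} := by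
    rw [Set.disjoint_singleton_right]
    rintro (h | h)
    exacts [ha' h, hd' h]
  have hdis₂ : Disjoint (A ∪ {q | q ∈ (d.map σ).names}) {a} := by
    rw [Set.disjoint_singleton_right]
    rintro (h | h)
    · exact ha h
    · simp only [names_map, Set.mem_ofPred_eq, List.mem_map] at h
      obtain ⟨q, hq, e⟩ := h
      have : q = a' := by
        rw [← Equiv.swap_apply_right a a'] at e
        exact σ.injective e
      exact hd' (this ▸ hq)
  have hterm : ∀ b : Bool, ‖F d (proj a b x)‖ ≤
      ‖F (d.map σ) (flip (if b then {a'} else ∅) x)‖ := by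
    intro b
    have ht : ∀ q ∈ (if b then {a'} else ∅ : Finset ℕ), q ∈ ({a'} : Set ℕ) := by
      cases b <;> simp
    have h1 : ‖F d (proj a b x)‖ = ‖F d (flip (if b then {a'} else ∅) (proj a b x))‖ := by
      rw [local_comm hdis₁ (hF.mem d) (flip_mem ht), norm_flip]
    have h2 : rename σ (F d (flip (if b then {a'} else ∅) (proj a b x))) =
        F (d.map σ) (flip (if b then {a'} else ∅) (proj a b x)) := by
      have := LinearMap.congr_fun (hF.equivariant σ hσ d)
        (flip (if b then {a'} else ∅) (proj a b x))
      rw [Module.End.mul_apply, Module.End.mul_apply, hfix] at this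
      exact this
    have hne : Disjoint ({a'} : Set ℕ) {a} := by
      rw [Set.disjoint_singleton]
      exact fun e => haa e.symm
    have hproj : proj a b ∈ localAlg {a} := proj_mem (Set.mem_singleton a) b
    have h3 : F (d.map σ) (flip (if b then {a'} else ∅) (proj a b x)) =
        proj a b (F (d.map σ) (flip (if b then {a'} else ∅) x)) := by
      rw [local_comm hne (flip_mem ht) hproj, local_comm hdis₂ (hF.mem _) hproj]
    rw [h1, ← norm_rename σ, h2, h3]
    exact norm_proj_le _ _ _
  have hsum : F d x = F d (proj a false x) + F d (proj a true x) := by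
    rw [← map_add, ← LinearMap.add_apply, proj_add, Module.End.one_apply]
  have h0 := hterm false
  have h1 := hterm true
  simp only [Bool.false_eq_true, if_false, if_true, flip_empty, Module.End.one_apply] at h0 h1
  have h2 := norm_add_le (F d (proj a false x)) (F d (proj a true x))
  rw [← hsum] at h2
  have h3 := norm_nonneg (F d x)
  have h4 := norm_nonneg (F d (proj a false x))
  have h5 := norm_nonneg (F d (proj a true x))
  nlinarith [sq_nonneg (‖F (d.map σ) x‖ - ‖F (d.map σ) (flip {a'} x)‖)]

/-- Splits a sum over the states of `i + 1` qubits according to the last one. -/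
theorem sum_powerset_flip {i : ℕ} {ν : ℕ → ℕ} (hν : Function.Injective ν)
    (G : State → ℝ) (x : State) :
    ∑ q ∈ ((Finset.range (i + 1)).image ν).powerset, G (flip q x) =
      ∑ q ∈ ((Finset.range i).image ν).powerset, (G (flip q x) + G (flip {ν i} (flip q x))) := by
  have hi : ν i ∉ (Finset.range i).image ν := by
    intro h
    obtain ⟨j, hj, e⟩ := Finset.mem_image.1 h
    have := Finset.mem_range.1 hj
    have := hν e
    omega
  rw [Finset.range_add_one, Finset.image_insert, Finset.sum_powerset_insert hi,
    ← Finset.sum_add_distrib]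
  refine Finset.sum_congr rfl fun q hq => ?_
  have hq : ν i ∉ q := fun h => hi (Finset.mem_powerset.1 hq h)
  have hins : insert (ν i) q = symmDiff {ν i} q := by
    ext j
    simp only [Finset.mem_insert, Finset.mem_symmDiff, Finset.mem_singleton]
    by_cases hj : j = ν i
    · subst hj; simp [hq]
    · simp [hj]
  rw [hins, ← Module.End.mul_apply (flip {ν i}), flip_mul]

/-- A short datum may be replaced by a guess of its shape and of random states of its qubits. The
qubits are replaced one by one. -/
theorem OpFam.norm_sq_le {A C : Set ℕ} {F : Data → Module.End ℂ State} (hF : OpFam A F)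
    {d : Data} (hd : d.names.Nodup) (hdA : ∀ q ∈ d.names, q ∉ A) {B : ℕ} (hB : d.size ≤ B)
    {ν : ℕ → ℕ} (hν : Fresh ν (A ∪ C)) (hdC : ∀ q ∈ d.names, q ∈ C) {x : State}
    (hx : x.SuppIn C) :
    ‖F d x‖ ^ 2 ≤ 2 ^ B * ∑ e ∈ catalog ν B,
      ∑ q ∈ ((Finset.range B).image ν).powerset, ‖F e (flip q x)‖ ^ 2 := by
  have hνA : ∀ i, ν i ∉ A := fun i h => hν.2 i (.inl h)
  have hνC : ∀ i, ν i ∉ C := fun i h => hν.2 i (.inr h)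
  -- The datum `e` arises from `d` by replacing the first `i` qubits by `ν 0, …, ν (i - 1)`.
  have key : ∀ i ≤ d.names.length, ∃ e : Data, e.size = d.size ∧
      e.names = (List.range i).map ν ++ d.names.drop i ∧
      ‖F d x‖ ^ 2 ≤ 2 ^ i * ∑ q ∈ ((Finset.range i).image ν).powerset, ‖F e (flip q x)‖ ^ 2 := by
    intro i
    induction i with
    | zero => exact fun _ => ⟨d, rfl, by simp, by simp [flip_empty]⟩
    | succ i ih =>
      intro hi
      obtain ⟨e, he, hnames, hle⟩ := ih (by omega)
      set a := d.names[i]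
      have ha : a ∈ d.names := List.getElem_mem _
      have hdrop : d.names.drop i = a :: d.names.drop (i + 1) := List.drop_eq_getElem_cons hi
      have haν : ∀ j, ν j ≠ a := fun j h => hνC j (h ▸ hdC a ha)
      have hadrop : a ∉ d.names.drop (i + 1) := by
        have := hd.sublist (List.drop_sublist i d.names)
        rw [hdrop] at this
        exact (List.nodup_cons.1 this).1
      have hνe : ν i ∉ e.names := by
        rw [hnames, List.mem_append]
        rintro (h | h)
        · obtain ⟨j, hj, h⟩ := List.mem_map.1 h
          have := List.mem_range.1 hj
          have := hν.1 h
          omega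
        · exact hνC i (hdC _ (List.drop_subset _ _ h))
      refine ⟨e.map (Equiv.swap a (ν i)), by rw [size_map, he], ?_, ?_⟩
      · rw [names_map, hnames, List.map_append, hdrop, List.map_cons, Equiv.swap_apply_left,
          List.range_succ, List.map_append, List.append_assoc, List.map_map]
        congr 1
        · refine List.map_congr_left fun j hj => ?_
          have := List.mem_range.1 hj
          exact Equiv.swap_apply_of_ne_of_ne (haν j) fun h => by
            have := hν.1 h
            omega
        · simp only [List.map_cons, List.map_nil, List.singleton_append]
          congr 1
          refine (List.map_congr_left fun q hq => ?_).trans (List.map_id _)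
          refine Equiv.swap_apply_of_ne_of_ne (fun h => hadrop (h ▸ hq)) fun h => ?_
          exact hνC i (h ▸ hdC _ (List.drop_subset _ _ hq))
      · refine hle.trans ?_
        rw [pow_succ, mul_assoc]
        refine mul_le_mul_of_nonneg_left ?_ (by positivity)
        rw [sum_powerset_flip hν.1 (fun y => ‖F (e.map (Equiv.swap a (ν i))) y‖ ^ 2),
          Finset.mul_sum]
        refine Finset.sum_le_sum fun q hq => ?_
        refine hF.replace (hdA a ha) (hνA i) hνe ?_
        refine SuppIn_flip (hx.mono fun j (hj : j ∈ C) (h : j = ν i) => hνC i (h ▸ hj))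
          fun j hj (h : j = ν i) => ?_
        obtain ⟨l, hl, e'⟩ := Finset.mem_image.1 (Finset.mem_powerset.1 hq hj)
        have := Finset.mem_range.1 hl
        have := hν.1 (e'.trans h)
        omega
  obtain ⟨e, he, hnames, hle⟩ := key _ le_rfl
  rw [List.drop_length, List.append_nil] at hnames
  have hr : d.names.length ≤ B := (length_names_le d).trans hB
  refine hle.trans (mul_le_mul (pow_le_pow_right₀ (by norm_num) hr) ?_ (by positivity)
    (by positivity))
  calc ∑ q ∈ ((Finset.range d.names.length).image ν).powerset, ‖F e (flip q x)‖ ^ 2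
      ≤ ∑ q ∈ ((Finset.range B).image ν).powerset, ‖F e (flip q x)‖ ^ 2 :=
        Finset.sum_le_sum_of_subset_of_nonneg (Finset.powerset_mono.2
          (Finset.image_subset_image (Finset.range_subset_range.2 hr))) fun _ _ _ => by positivity
    _ ≤ _ := Finset.single_le_sum (f := fun e => ∑ q ∈ ((Finset.range B).image ν).powerset,
        ‖F e (flip q x)‖ ^ 2) (fun _ _ => by positivity) (mem_catalog (he.trans_le hB) hnames)

/-! ### The key simulated afterwards -/

theorem names_of_mem_catalog {ν : ℕ → ℕ} {B : ℕ} {d : Data} (hd : d ∈ catalog ν B) :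
    ∀ q ∈ d.names, q ∈ Set.range ν := by
  classical
  have key : ∀ (w : List (Fin 4)) (s : List Data × ℕ),
      (∀ a ∈ s.1, ∀ q ∈ a.names, q ∈ Set.range ν) →
      ∀ a ∈ (w.foldl (buildStep ν) s).1, ∀ q ∈ a.names, q ∈ Set.range ν := by
    intro w
    induction w with
    | nil => exact fun s h => h
    | cons i w ih =>
      intro s h
      refine ih _ ?_
      obtain ⟨l, j⟩ := s
      fin_cases i
      · intro a ha
        rcases List.mem_cons.1 ha with rfl | ha
        · simp [names]
        · exact h a ha
      · intro a ha
        rcases List.mem_cons.1 ha with rfl | ha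
        · intro q hq
          exact ⟨j, (List.mem_singleton.1 hq).symm⟩
        · exact h a ha
      · rcases l with _ | ⟨b, _ | ⟨c, l⟩⟩
        · exact h
        · exact h
        · intro a ha
          rcases List.mem_cons.1 ha with rfl | ha
          · intro q hq
            rcases List.mem_append.1 hq with hq | hq
            · exact h c (by simp) q hq
            · exact h b (by simp) q hq
          · exact h a (by simp [ha])
      · exact h
  obtain ⟨g, -, rfl⟩ := Finset.mem_image.1 hd
  have := key (List.ofFn g) ([], 0) (by simp)
  cases hl : ((List.ofFn g).foldl (buildStep ν) ([], 0)).1 with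
  | nil => simp [names]
  | cons a l => exact this a (by simp [hl])

theorem list_sum_finset_sum {α ι : Type} (l : List α) (t : Finset ι) (f : α → ι → ℝ) :
    (l.map fun a => ∑ i ∈ t, f a i).sum = ∑ i ∈ t, (l.map fun a => f a i).sum := by
  induction l with
  | nil => simp
  | cons a l ih => simp [ih, Finset.sum_add_distrib]

theorem size_cut_le {B : ℕ} (hB : 0 < B) (d : Data) : (cut B d).size ≤ B := by
  rw [cut]
  split_ifs with h
  · exact h.le
  · exact hB

/-- A short key that has been computed from qubits that the tests do not touch helps no more than
a guess. The flips in `f` stand for the messages: the key may depend on them, its replacement does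
not. -/
theorem sum_key_le {A C : Set ℕ} {F : Data → Module.End ℂ State} (hF : OpFam A F) (p : Prog)
    {d : Data} (hd : d.names.Nodup) (hdC : ∀ q ∈ d.names, q ∈ C) (hdA : ∀ q ∈ d.names, q ∉ A)
    {ν ν' : ℕ → ℕ} (hν : Fresh ν (A ∪ C)) (hν' : Fresh ν' (A ∪ C ∪ Set.range ν)) {y : State}
    (hy : y.SuppIn C) {f : Finset ℕ} (hf : ∀ q ∈ f, q ∈ C ∧ q ∉ A) {B : ℕ} (hB : 0 < B) :
    ((sem p d ν).map fun b => ‖F (cut B b.val) (b.word.lin (flip f y))‖ ^ 2).sum ≤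
      2 ^ B * ∑ e ∈ catalog ν' B, ∑ q ∈ ((Finset.range B).image ν').powerset,
        ‖F e (flip q y)‖ ^ 2 := by
  classical
  have hfy : (flip f y).SuppIn C := SuppIn_flip hy fun q hq => (hf q hq).1
  have hlocal : ∀ e ∈ catalog ν' B, ∀ q ∈ ((Finset.range B).image ν').powerset,
      F e * flip q ∈ localAlg (A ∪ Set.range ν') := by
    intro e he q hq
    refine mul_mem (localAlg_mono ?_ (hF.mem e))
      (localAlg_mono ?_ (flip_mem (A := Set.range ν') ?_))
    · exact Set.union_subset_union_right _ (names_of_mem_catalog he)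
    · exact Set.subset_union_right
    · intro j hj
      obtain ⟨i, -, rfl⟩ := Finset.mem_image.1 (Finset.mem_powerset.1 hq hj)
      exact ⟨i, rfl⟩
  -- Once the key is replaced by a guess, the operators of the tests commute with those of the key
  -- generation.
  have hterm : ∀ b ∈ sem p d ν, ‖F (cut B b.val) (b.word.lin (flip f y))‖ ^ 2 ≤
      2 ^ B * ∑ e ∈ catalog ν' B, ∑ q ∈ ((Finset.range B).image ν').powerset,
        ‖b.word.lin (F e (flip q (flip f y)))‖ ^ 2 := by
    intro b hb
    obtain ⟨hv, hw⟩ := sem_linear p d ν b hb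
    have hnodup : (d.names ++ (List.range b.used).map ν).Nodup := by
      refine List.nodup_append.2 ⟨hd, List.nodup_range.map hν.1, ?_⟩
      rintro q hq q' hq' rfl
      obtain ⟨i, -, rfl⟩ := List.mem_map.1 hq'
      exact hν.2 i (.inr (hdC _ hq))
    have hnames : ∀ q ∈ d.names ++ (List.range b.used).map ν, q ∈ C ∪ Set.range ν ∧ q ∉ A := by
      intro q hq
      rcases List.mem_append.1 hq with hq | hq
      · exact ⟨.inl (hdC q hq), hdA q hq⟩
      · obtain ⟨i, -, rfl⟩ := List.mem_map.1 hq
        exact ⟨.inr ⟨i, rfl⟩, fun h => hν.2 i (.inl h)⟩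
    have hcut : (cut B b.val).names.Nodup := by
      obtain ⟨l, hl, hs⟩ := hv
      have hval := hl.nodup (hnodup.sublist hs)
      rw [cut]
      split_ifs
      · exact hval
      · exact List.nodup_nil
    have hcut' : ∀ q ∈ (cut B b.val).names, q ∈ C ∪ Set.range ν ∧ q ∉ A := fun q hq =>
      hnames q (hv.subset (names_cut q hq))
    refine (hF.norm_sq_le (C := C ∪ Set.range ν) hcut (fun q hq => (hcut' q hq).2)
      (size_cut_le hB _) (by rwa [← Set.union_assoc]) (fun q hq => (hcut' q hq).1)
      (State.SuppIn.word (fun q hq => (hnames q (hw q hq)).1)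
        (hfy.mono Set.subset_union_left))).trans_eq ?_
    congr 1
    refine Finset.sum_congr rfl fun e he => Finset.sum_congr rfl fun q hq => ?_
    have hdis : Disjoint (A ∪ Set.range ν') {q | q ∈ d.names ++ (List.range b.used).map ν} := by
      rw [Set.disjoint_left]
      rintro q (h | ⟨i, rfl⟩) hq
      · exact (hnames q hq).2 h
      · refine hν'.2 i ?_
        rcases (hnames _ hq).1 with h | h
        · exact .inl (.inr h)
        · exact .inr h
    have := local_comm hdis (hlocal e he q hq) (Word.lin_mem hw) (flip f y)
    rw [Module.End.mul_apply, Module.End.mul_apply] at this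
    rw [this]
  refine (List.sum_le_sum hterm).trans_eq ?_
  rw [List.sum_map_mul_left, list_sum_finset_sum]
  congr 1
  refine Finset.sum_congr rfl fun e he => ?_
  rw [list_sum_finset_sum]
  refine Finset.sum_congr rfl fun q hq => ?_
  rw [sem_complete p d ν]
  have hdis : Disjoint (A ∪ Set.range ν') (f : Set ℕ) := by
    rw [Set.disjoint_left]
    rintro q (h | ⟨i, rfl⟩) hq
    · exact (hf q hq).2 h
    · exact hν'.2 i (.inl (.inr (hf _ hq).1))
  have := local_comm hdis (hlocal e he q hq) (flip_mem fun q hq => hq) y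
  rw [Module.End.mul_apply, Module.End.mul_apply] at this
  rw [this, norm_flip]

/-! ### The operators of the final test -/

/-- The operators of a test form a family that depends on the functional key only. -/
theorem opFam_fits (dec : Prog) (n : ℕ) {ct : Data} (b : Bool) {ν : ℕ → ℕ} {A : Set ℕ}
    (hct : ∀ q ∈ ct.names, q ∈ A) (hν : Set.range ν ⊆ A) :
    OpFam A fun fk => posOp (fits dec n (pair fk (pair ct (bit b))) ν) := by
  have hb : (bit b).names = [] := by cases b <;> rfl
  refine ⟨fun d => posOp_mem fun w hw q hq => ?_, fun σ hσ d => ?_⟩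
  · rcases (fam_fits dec n).names _ _ w hw q hq with h | h | h
    · exact absurd h (Set.notMem_empty q)
    · simp only [names, hb, List.append_nil, List.mem_append] at h
      exact h.elim .inr fun h => .inl (hct q h)
    · exact .inl (hν h)
  · rw [rename_posOp, ← (fam_fits dec n).map σ (by simp)]
    have h1 : ct.map σ = ct := map_eq_self fun q hq => hσ q (hct q hq)
    have h2 : (bit b).map σ = bit b := map_eq_self (by simp [hb])
    have h3 : σ ∘ ν = ν := funext fun i => hσ _ (hν ⟨i, rfl⟩)
    simp only [Data.map, h1, h2, h3]

/-- The tests for the two values of a bit exclude each other. -/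
theorem weight_fits_add_le (dec : Prog) (n : ℕ) (fk ct : Data) (ν : ℕ → ℕ) (x : State) :
    weight (fits dec n (pair fk (pair ct (bit false))) ν) x +
      weight (fits dec n (pair fk (pair ct (bit true))) ν) x ≤ ‖x‖ ^ 2 := by
  rw [← sem_complete (test dec) (pair (ofNat n) (pair fk ct)) ν x]
  simp only [weight, fits, Eff.accept, fst_pair, snd_pair, List.map_map]
  induction sem (test dec) (pair (ofNat n) (pair fk ct)) ν with
  | nil => simp
  | cons b l ih =>
    have hnn : 0 ≤ ‖b.word.lin x‖ ^ 2 := by positivity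
    cases hb : b.val <;> simp [hb, agree, bit] at ih ⊢ <;> linarith

theorem weight_fits_le (dec : Prog) (n : ℕ) (fk ct : Data) (b : Bool) (ν : ℕ → ℕ) (x : State) :
    weight (fits dec n (pair fk (pair ct (bit b))) ν) x ≤ ‖x‖ ^ 2 := by
  have h := weight_fits_add_le dec n fk ct ν x
  have h0 := weight_nonneg (fits dec n (pair fk (pair ct (bit false))) ν) x
  have h1 := weight_nonneg (fits dec n (pair fk (pair ct (bit true))) ν) x
  cases b <;> linarith

/-! ### The ideal experiment: incompressibility -/

/-- The positions near the middle of a list of length `2 * M + 1`. -/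
def middle (M N₀ : ℕ) : List ℕ := (List.range N₀).map (M + ·)

theorem nodup_middle (M N₀ : ℕ) : (middle M N₀).Nodup :=
  List.nodup_range.map fun a b h => by simpa using h

theorem mem_middle {M N₀ x : ℕ} (h : x ∈ middle M N₀) : ∃ j < N₀, x = M + j := by
  obtain ⟨j, hj, rfl⟩ := List.mem_map.1 h
  exact ⟨j, List.mem_range.1 hj, rfl⟩

/-- If a test at a position with binomial distribution rarely fails, then all tests near the middle
may be performed one after the other. -/
theorem norm_sq_le_tests {W : ℕ → List Word} (hW : ∀ x y, weight (W x) y ≤ ‖y‖ ^ 2) {M N₀ : ℕ}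
    (hM : 0 < M) (hN : 2 * N₀ ^ 2 ≤ M) (χ : State) :
    ‖χ‖ ^ 2 ≤ 2 * ‖((middle M N₀).map fun x => posOp (W x)).prod χ‖ ^ 2 +
      8 * N₀ * M * (‖χ‖ ^ 2 - ∑ x ∈ Finset.range (2 * M + 1),
        ((2 * M).choose x : ℝ) / 2 ^ (2 * M) * weight (W x) χ) := by
  refine (norm_sq_le_prod (fun x => posOp (W x)) (nodup_middle M N₀)
    (fun x _ => norm_posOp_le (hW x)) χ).trans (add_le_add le_rfl ?_)
  have hfail : ∀ x, 0 ≤ ‖χ‖ ^ 2 - weight (W x) χ := fun x => sub_nonneg.2 (hW x χ)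
  have hMR : (0 : ℝ) < M := by exact_mod_cast hM
  have h1 : ((middle M N₀).map fun x => ‖χ - posOp (W x) χ‖ ^ 2).sum ≤
      4 * M * ∑ x ∈ Finset.range (2 * M + 1),
        ((2 * M).choose x : ℝ) / 2 ^ (2 * M) * (‖χ‖ ^ 2 - weight (W x) χ) := by
    rw [← List.sum_toFinset _ (nodup_middle M N₀), Finset.mul_sum]
    refine (Finset.sum_le_sum fun x hx => ?_).trans (Finset.sum_le_sum_of_subset_of_nonneg
      (t := Finset.range (2 * M + 1)) (fun x hx => ?_) fun x _ _ => ?_)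
    · obtain ⟨j, hj, rfl⟩ := mem_middle (List.mem_toFinset.1 hx)
      have hc := choose_center_ge hM (j := j)
        ((Nat.mul_le_mul_left 2 (Nat.pow_le_pow_left hj.le 2)).trans hN)
      refine (norm_sub_posOp_sq_le (hW _) χ).trans ?_
      rw [← mul_assoc]
      refine le_mul_of_one_le_left (hfail _) ?_
      rw [div_le_iff₀ (by positivity)] at hc
      linarith
    · obtain ⟨j, hj, rfl⟩ := mem_middle (List.mem_toFinset.1 hx)
      have : N₀ ≤ M := by nlinarith
      simp; omega
    · have := hfail x
      positivity
  have h2 : ∑ x ∈ Finset.range (2 * M + 1),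
      ((2 * M).choose x : ℝ) / 2 ^ (2 * M) * (‖χ‖ ^ 2 - weight (W x) χ) =
      ‖χ‖ ^ 2 - ∑ x ∈ Finset.range (2 * M + 1),
        ((2 * M).choose x : ℝ) / 2 ^ (2 * M) * weight (W x) χ := by
    simp only [mul_sub, Finset.sum_sub_distrib]
    rw [← Finset.sum_mul, sum_choose_div, one_mul]
  rw [h2] at h1
  have hlen : ((middle M N₀).length : ℝ) = N₀ := by simp [middle]
  rw [hlen]
  calc 2 * (N₀ : ℝ) * _ ≤ 2 * N₀ * _ := mul_le_mul_of_nonneg_left h1 (by positivity)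
    _ = _ := by ring

theorem pos_map (f : ℕ → ℕ) (k : ℕ) (d : Data) : pos k (d.map f) = (pos k d).map f := by
  induction k generalizing d with
  | zero => exact fst_map ..
  | succ k ih =>
    show pos k (d.map f).snd = (pos k d.snd).map f
    rw [snd_map, ih]

section ideal

variable (dec : Prog) (n B : ℕ) (sim₁ sim₂ : Prog) (v : Data)

/-- The simulated key, given the result of the first simulator, and the final test at position `x`
for the bit `b`. -/
def guess (x : ℕ) (b : Bool) (t : Data) : Eff :=
  Eff.bind (sem sim₂ (pair v t.snd)) fun fk =>
    fits dec n (pair (cut B fk) (pair (pos x t.fst) (bit b)))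

theorem fam_guess (x : ℕ) (b : Bool) {A : Set ℕ} (hv : ∀ q ∈ v.names, q ∈ A) :
    Eff.Fam A (guess dec n B sim₂ v x b) := by
  have hb : (bit b).names = [] := by cases b <;> rfl
  have hpos : Eff.Unif A fun s => pos x s.snd.fst := by
    have h := (Eff.Unif.id A).snd.fst
    exact ⟨fun a q hq => h.names a q (names_pos q hq), fun f hf a => by rw [h.map f hf, pos_map]⟩
  have hT := ((fam_fits dec n).mono (Set.empty_subset A)).comp
    ((unif_cut B (Eff.Unif.id A).fst).pair (hpos.pair
      (Eff.Unif.const (d := bit b) (by simp [hb]))))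
  exact Eff.Fam.bind hT sim₂ ((Eff.Unif.const hv).pair (Eff.Unif.id A).snd)

/-- The pairs of branches of the two simulators. -/
def branches (d : Data) (ν₁ ν₂ : ℕ → ℕ) : List (Br Data × Br Data) :=
  (sem sim₁ d ν₁).flatMap fun b₁ => (sem sim₂ (pair v b₁.val.snd) ν₂).map fun b₂ => (b₁, b₂)

theorem sum_branches (d : Data) (ν₁ ν₂ : ℕ → ℕ) (G : Br Data × Br Data → ℝ) :
    ((branches sim₁ sim₂ v d ν₁ ν₂).map G).sum = ((sem sim₁ d ν₁).map fun b₁ =>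
      ((sem sim₂ (pair v b₁.val.snd) ν₂).map fun b₂ => G (b₁, b₂)).sum).sum := by
  rw [branches, sum_flatMap]
  simp only [List.map_map]
  rfl

theorem sum_branches_norm (d : Data) (ν₁ ν₂ : ℕ → ℕ) (φ : State) :
    ((branches sim₁ sim₂ v d ν₁ ν₂).map fun b => ‖b.2.word.lin (b.1.word.lin φ)‖ ^ 2).sum =
      ‖φ‖ ^ 2 := by
  rw [sum_branches, ← sem_complete sim₁ d ν₁ φ]
  refine congrArg List.sum (List.map_congr_left fun b _ => ?_)
  exact sem_complete sim₂ (pair v b.val.snd) ν₂ (b.word.lin φ)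

variable {v}

/-- The success probability of a test in terms of the branches of the simulators, with separate
streams of fresh qubits for the first simulator, the second one and the test. -/
theorem val_guess (x : ℕ) (b : Bool) {d : Data} {k : ℕ} (hd : ∀ q ∈ d.names, q < k)
    (hv : ∀ q ∈ v.names, q < k) {φ : State} (hφ : φ.SuppIn (Set.Iio k)) {ν₁ ν₂ ν₃ : ℕ → ℕ}
    (h₁ : Fresh ν₁ (Set.Iio k)) (h₂ : Fresh ν₂ (Set.Iio k ∪ Set.range ν₁))
    (h₃ : Fresh ν₃ (Set.Iio k ∪ Set.range ν₁ ∪ Set.range ν₂)) :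
    (Eff.bind (sem sim₁ d) (guess dec n B sim₂ v x b)).val (k + ·) φ =
      ((branches sim₁ sim₂ v d ν₁ ν₂).map fun br => weight
        (fits dec n (pair (cut B br.2.val) (pair (pos x br.1.val.fst) (bit b))) ν₃)
        (br.2.word.lin (br.1.word.lin φ))).sum := by
  rw [Eff.val_bind (fam_guess dec n B sim₂ v x b (A := Set.Iio k) hv) subset_rfl hd hφ
    (fresh_add k) h₁ h₂, sum_branches]
  congr 1
  refine List.map_congr_left fun b₁ hb₁ => ?_
  obtain ⟨hval, hw⟩ := Eff.branch_names (B := Set.Iio k) hd hb₁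
  have hsub : Set.Iio k ∪ ν₁ '' Set.Iio b₁.used ⊆ Set.Iio k ∪ Set.range ν₁ :=
    Set.union_subset_union_right _ (Set.image_subset_range _ _)
  have hb : (bit b).names = [] := by cases b <;> rfl
  have hK : Eff.Fam (Set.Iio k ∪ Set.range ν₁) fun fk =>
      fits dec n (pair (cut B fk) (pair (pos x b₁.val.fst) (bit b))) :=
    ((fam_fits dec n).mono (Set.empty_subset _)).comp ((unif_cut B (Eff.Unif.id _)).pair
      ((Eff.Unif.const fun q hq => hsub (hval q ((names_fst_snd _).subset
        (List.mem_append_left _ (names_pos q hq))))).pair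
        (Eff.Unif.const (d := bit b) (by simp [hb]))))
  refine Eff.val_bind hK subset_rfl (fun q hq => ?_)
    (State.SuppIn.word (fun q hq => hsub (hw q hq)) (hφ.mono Set.subset_union_left)) h₂ h₂ h₃
  rcases List.mem_append.1 hq with hq | hq
  · exact .inl (hv q hq)
  · exact hsub (hval q ((names_fst_snd _).subset (List.mem_append_right _ hq)))

/-- Averaged over the messages, the probability that all tests in the middle succeed is at most
`2 ^ (4 * B - N₀)`: the ciphertexts are independent of the messages, and the key may be guessed, its
shape among `4 ^ B` and its qubits among `2 ^ B` with a loss of `2 ^ B`. -/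
theorem sum_tests_le {d : Data} (hd : d.names = []) (hv : v.names.Nodup) {k M N₀ : ℕ}
    (hvk : ∀ q ∈ v.names, q < k + (2 * M + 1)) (hN : N₀ ≤ M) (hB : 0 < B) {ψ : State}
    (hψ : ψ.SuppIn (Set.Iio k)) {ν₁ ν₂ ν₃ ν₄ : ℕ → ℕ} (h₁ : Fresh ν₁ (Set.Iio (k + (2 * M + 1))))
    (h₂ : Fresh ν₂ (Set.Iio (k + (2 * M + 1)) ∪ Set.range ν₁))
    (h₃ : Fresh ν₃ (Set.Iio (k + (2 * M + 1)) ∪ Set.range ν₁ ∪ Set.range ν₂))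
    (h₄ : Fresh ν₄ (Set.Iio (k + (2 * M + 1)) ∪ Set.range ν₁ ∪ Set.range ν₂ ∪ Set.range ν₃)) :
    2 ^ N₀ * ∑ m ∈ (Finset.range (2 * M + 1)).powerset,
      ((branches sim₁ sim₂ v d ν₁ ν₂).map fun br => ‖((middle M N₀).map fun x => posOp
        (fits dec n (pair (cut B br.2.val)
          (pair (pos x br.1.val.fst) (bit (decide (2 * M - x ∈ m))))) ν₃)).prod
        (br.2.word.lin (br.1.word.lin (flip (coinSet k m) ψ)))‖ ^ 2).sum ≤
      2 ^ (4 * B) * 2 ^ (2 * M + 1) * ‖ψ‖ ^ 2 := by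
  classical
  set K := k + (2 * M + 1)
  -- The tests of the ciphertexts in `t.fst` for the bits of `m`, as operators that depend on the
  -- key.
  let F : Data → Finset ℕ → Data → Module.End ℂ State := fun t m fk =>
    ((middle M N₀).map fun x => posOp (fits dec n (pair fk
      (pair (pos x t.fst) (bit (decide (2 * M - x ∈ m))))) ν₃)).prod
  let T : Finset (Finset ℕ) := ((Finset.range B).image ν₄).powerset
  have hkey : ∀ m ∈ (Finset.range (2 * M + 1)).powerset, ∀ b ∈ sem sim₁ d ν₁,
      ((sem sim₂ (pair v b.val.snd) ν₂).map fun b' => ‖F b.val m (cut B b'.val)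
        (b'.word.lin (b.word.lin (flip (coinSet k m) ψ)))‖ ^ 2).sum ≤
      2 ^ B * ∑ e ∈ catalog ν₄ B, ∑ q ∈ T, ‖F b.val m e (flip q (b.word.lin ψ))‖ ^ 2 := by
    intro m hm b hb
    obtain ⟨hval, hw⟩ := sem_linear sim₁ d ν₁ b hb
    rw [hd, List.nil_append] at hval hw
    have hrange : ∀ q ∈ (List.range b.used).map ν₁, q ∈ Set.range ν₁ := by
      intro q hq
      obtain ⟨i, -, rfl⟩ := List.mem_map.1 hq
      exact ⟨i, rfl⟩
    have hnodup : (b.val.fst.names ++ b.val.snd.names).Nodup := by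
      obtain ⟨l, hl, hs⟩ := hval
      exact (hl.nodup ((List.nodup_range.map h₁.1).sublist hs)).sublist (names_fst_snd _)
    obtain ⟨-, hnodup₂, hdisj⟩ := List.nodup_append.1 hnodup
    have hfst : ∀ q ∈ b.val.fst.names, q ∈ Set.range ν₁ := fun q hq => hrange q
      (hval.subset ((names_fst_snd _).subset (List.mem_append_left _ hq)))
    have hsnd : ∀ q ∈ b.val.snd.names, q ∈ Set.range ν₁ := fun q hq => hrange q
      (hval.subset ((names_fst_snd _).subset (List.mem_append_right _ hq)))
    set A : Set ℕ := {q | q ∈ b.val.fst.names} ∪ Set.range ν₃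
    have hF : OpFam A (F b.val m) := OpFam.prod _ fun x _ => opFam_fits dec n _
      (fun q hq => .inl (names_pos q hq)) Set.subset_union_right
    have hKA : ∀ q < K, q ∉ A := by
      rintro q hq (h | ⟨i, rfl⟩)
      · obtain ⟨i, rfl⟩ := hfst q h
        exact h₁.2 i hq
      · exact h₃.2 i (.inl (.inl hq))
    have hAC : A ∪ (Set.Iio K ∪ Set.range ν₁) ⊆ Set.Iio K ∪ Set.range ν₁ ∪ Set.range ν₃ := by
      rintro q ((h | h) | h)
      · exact .inl (.inr (hfst q h))
      · exact .inr h
      · exact .inl h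
    have hf : ∀ q ∈ coinSet k m, q < K := by
      intro q hq
      obtain ⟨i, hi, rfl⟩ := Finset.mem_map.1 hq
      have := Finset.mem_range.1 (Finset.mem_powerset.1 hm hi)
      simp [addLeftEmbedding, K]; omega
    -- The first simulator does not touch the messages.
    have hcomm : b.word.lin (flip (coinSet k m) ψ) = flip (coinSet k m) (b.word.lin ψ) := by
      refine local_comm (A := Set.range ν₁) (B := Set.Iio K) ?_
        (Word.lin_mem fun q hq => hrange q (hw q hq)) (flip_mem hf) ψ
      rw [Set.disjoint_left]
      rintro _ ⟨i, rfl⟩ h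
      exact h₁.2 i h
    simp only [hcomm]
    refine sum_key_le hF sim₂ (C := Set.Iio K ∪ Set.range ν₁) ?_ ?_ ?_ ?_ ?_ ?_ ?_ hB
    · refine List.nodup_append.2 ⟨hv, hnodup₂, ?_⟩
      rintro q hq q' hq' rfl
      obtain ⟨i, rfl⟩ := hsnd q hq'
      exact h₁.2 i (hvk _ hq)
    · intro q hq
      rcases List.mem_append.1 hq with hq | hq
      · exact .inl (hvk q hq)
      · exact .inr (hsnd q hq)
    · intro q hq
      rcases List.mem_append.1 hq with hq | hq
      · exact hKA q (hvk q hq)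
      · rintro (h | ⟨i, rfl⟩)
        · exact hdisj q h q hq rfl
        · exact h₃.2 i (.inl (.inr (hsnd _ hq)))
    · refine ⟨h₂.1, fun i h => ?_⟩
      rcases hAC h with h | ⟨j, hj⟩
      · exact h₂.2 i h
      · exact h₃.2 j (.inr ⟨i, hj.symm⟩)
    · refine h₄.mono ?_
      rintro q (h | h)
      · rcases hAC h with h | h
        · exact .inl (.inl h)
        · exact .inr h
      · exact .inl (.inr h)
    · exact State.SuppIn.word (fun q hq => .inr (hrange q (hw q hq)))
        (hψ.mono fun q hq => .inl (lt_of_lt_of_le hq (Nat.le_add_right _ _)))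
    · exact fun q hq => ⟨.inl (hf q hq), hKA q (hf q hq)⟩
  have hsum : ∀ b ∈ sem sim₁ d ν₁, 2 ^ N₀ * ∑ m ∈ (Finset.range (2 * M + 1)).powerset,
      ((sem sim₂ (pair v b.val.snd) ν₂).map fun b' => ‖F b.val m (cut B b'.val)
        (b'.word.lin (b.word.lin (flip (coinSet k m) ψ)))‖ ^ 2).sum ≤
      2 ^ (4 * B) * 2 ^ (2 * M + 1) * ‖b.word.lin ψ‖ ^ 2 := by
    intro b hb
    have hone : ∀ e ∈ catalog ν₄ B, ∀ q ∈ T,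
        2 ^ N₀ * ∑ m ∈ (Finset.range (2 * M + 1)).powerset,
          ‖F b.val m e (flip q (b.word.lin ψ))‖ ^ 2 ≤ 2 ^ (2 * M + 1) * ‖b.word.lin ψ‖ ^ 2 := by
      intro e _ q _
      have := sum_prod_le (fun x c => posOp (fits dec n (pair e
        (pair (pos x b.val.fst) (bit c))) ν₃)) (fun x => 2 * M - x) (Finset.range (2 * M + 1))
        (middle M N₀) (fun x _ => by simp) ?_ ?_ (flip q (b.word.lin ψ))
      · rwa [norm_flip, Finset.card_range, show (middle M N₀).length = N₀ by simp [middle]] at this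
      · rw [middle, List.map_map]
        refine List.Nodup.map_on (fun i hi j hj h => ?_) List.nodup_range
        have := List.mem_range.1 hi
        have := List.mem_range.1 hj
        simp only [Function.comp_apply] at h
        omega
      · exact fun x _ y => (add_le_add (norm_posOp_sq_le (weight_fits_le dec n e _ false ν₃) y)
          (norm_posOp_sq_le (weight_fits_le dec n e _ true ν₃) y)).trans
            (weight_fits_add_le dec n e _ ν₃ y)
    calc _ ≤ 2 ^ N₀ * ∑ m ∈ (Finset.range (2 * M + 1)).powerset,
          2 ^ B * ∑ e ∈ catalog ν₄ B, ∑ q ∈ T, ‖F b.val m e (flip q (b.word.lin ψ))‖ ^ 2 :=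
          mul_le_mul_of_nonneg_left (Finset.sum_le_sum fun m hm => hkey m hm b hb) (by positivity)
      _ = 2 ^ B * ∑ e ∈ catalog ν₄ B, ∑ q ∈ T,
          (2 ^ N₀ * ∑ m ∈ (Finset.range (2 * M + 1)).powerset,
            ‖F b.val m e (flip q (b.word.lin ψ))‖ ^ 2) := by
          rw [← Finset.mul_sum, Finset.sum_comm, mul_left_comm, Finset.mul_sum]
          congr 1
          refine Finset.sum_congr rfl fun e _ => ?_
          rw [Finset.sum_comm, Finset.mul_sum]
      _ ≤ 2 ^ B * ∑ e ∈ catalog ν₄ B, ∑ q ∈ T, (2 ^ (2 * M + 1) * ‖b.word.lin ψ‖ ^ 2) :=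
          mul_le_mul_of_nonneg_left (Finset.sum_le_sum fun e he => Finset.sum_le_sum fun q hq =>
            hone e he q hq) (by positivity)
      _ = 2 ^ B * ((catalog ν₄ B).card * (T.card * (2 ^ (2 * M + 1) * ‖b.word.lin ψ‖ ^ 2))) := by
          simp only [Finset.sum_const, nsmul_eq_mul]
      _ ≤ 2 ^ B * (4 ^ B * (2 ^ B * (2 ^ (2 * M + 1) * ‖b.word.lin ψ‖ ^ 2))) := by
          have hT : T.card = 2 ^ B := by
            rw [Finset.card_powerset, Finset.card_image_of_injective _ h₄.1, Finset.card_range]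
          rw [hT]
          push_cast
          refine mul_le_mul_of_nonneg_left (mul_le_mul_of_nonneg_right ?_ (by positivity))
            (by positivity)
          exact_mod_cast card_catalog_le ν₄ B
      _ = _ := by
          have h4 : (4 : ℝ) ^ B = 2 ^ (2 * B) := by rw [pow_mul]; norm_num
          rw [h4, show 4 * B = B + (2 * B + B) by ring, pow_add, pow_add]
          ring
  calc _ = ((sem sim₁ d ν₁).map fun b => 2 ^ N₀ * ∑ m ∈ (Finset.range (2 * M + 1)).powerset,
      ((sem sim₂ (pair v b.val.snd) ν₂).map fun b' => ‖F b.val m (cut B b'.val)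
        (b'.word.lin (b.word.lin (flip (coinSet k m) ψ)))‖ ^ 2).sum).sum := by
        rw [List.sum_map_mul_left, list_sum_finset_sum]
        simp only [sum_branches, F]
    _ ≤ ((sem sim₁ d ν₁).map fun b =>
        2 ^ (4 * B) * 2 ^ (2 * M + 1) * ‖b.word.lin ψ‖ ^ 2).sum := List.sum_le_sum hsum
    _ = _ := by rw [List.sum_map_mul_left, sem_complete sim₁ d ν₁ ψ]

/-- With simulated ciphertexts and a simulated key of bounded size, the attack fails noticeably: the
last bracket is its failure probability. -/
theorem ideal_core {d : Data} (hd : d.names = []) (hv : v.names.Nodup) {k M N₀ : ℕ}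
    (hvk : ∀ q ∈ v.names, q < k + (2 * M + 1)) (hM : 0 < M) (hN : 2 * N₀ ^ 2 ≤ M) (hB : 0 < B)
    {ψ : State} (hψ : ψ.SuppIn (Set.Iio k)) :
    ‖ψ‖ ^ 2 ≤ 2 * (2 ^ (4 * B) / 2 ^ N₀ * ‖ψ‖ ^ 2) + 8 * N₀ * M * (‖ψ‖ ^ 2 -
      ∑ m ∈ (Finset.range (2 * M + 1)).powerset, (2 ^ (2 * M + 1) : ℝ)⁻¹ *
        ∑ x ∈ Finset.range (2 * M + 1), ((2 * M).choose x : ℝ) / 2 ^ (2 * M) *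
          (Eff.bind (sem sim₁ d) (guess dec n B sim₂ v x (decide (2 * M - x ∈ m)))).val
            (k + (2 * M + 1) + ·) (flip (coinSet k m) ψ)) := by
  obtain ⟨ν₁, ν₂, ν₃, ν₄, h₁, h₂, h₃, h₄⟩ := Eff.exists_fresh (k + (2 * M + 1))
  have hN' : N₀ ≤ M := by nlinarith
  have htests := sum_tests_le dec n B sim₁ sim₂ hd hv hvk hN' hB hψ h₁ h₂ h₃ h₄
  let χ : Finset ℕ → Br Data × Br Data → State := fun m br =>
    br.2.word.lin (br.1.word.lin (flip (coinSet k m) ψ))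
  let W : Finset ℕ → Br Data × Br Data → ℕ → List Word := fun m br x =>
    fits dec n (pair (cut B br.2.val) (pair (pos x br.1.val.fst) (bit (decide (2 * M - x ∈ m))))) ν₃
  let L := branches sim₁ sim₂ v d ν₁ ν₂
  set a : ℕ → ℝ := fun x => ((2 * M).choose x : ℝ) / 2 ^ (2 * M)
  let P : Finset ℕ → ℝ := fun m => (L.map fun br => ‖((middle M N₀).map fun x =>
    posOp (W m br x)).prod (χ m br)‖ ^ 2).sum
  have hone : ∀ m ∈ (Finset.range (2 * M + 1)).powerset,
      ‖ψ‖ ^ 2 ≤ 2 * P m + 8 * N₀ * M * (‖ψ‖ ^ 2 - ∑ x ∈ Finset.range (2 * M + 1), a x *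
        (Eff.bind (sem sim₁ d) (guess dec n B sim₂ v x (decide (2 * M - x ∈ m)))).val
            (k + (2 * M + 1) + ·) (flip (coinSet k m) ψ)) := by
    intro m hm
    have hsupp : (flip (coinSet k m) ψ).SuppIn (Set.Iio (k + (2 * M + 1))) := by
      refine SuppIn_flip (hψ.mono (Set.Iio_subset_Iio (Nat.le_add_right _ _))) fun q hq => ?_
      obtain ⟨i, hi, rfl⟩ := Finset.mem_map.1 hq
      have := Finset.mem_range.1 (Finset.mem_powerset.1 hm hi)
      simp [addLeftEmbedding]; omega
    have hnorm : (L.map fun br => ‖χ m br‖ ^ 2).sum = ‖ψ‖ ^ 2 :=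
      (sum_branches_norm sim₁ sim₂ v d ν₁ ν₂ (flip (coinSet k m) ψ)).trans (by rw [norm_flip])
    have hval : ∀ x, (Eff.bind (sem sim₁ d) (guess dec n B sim₂ v x (decide (2 * M - x ∈ m)))).val
        (k + (2 * M + 1) + ·) (flip (coinSet k m) ψ) =
        (L.map fun br => weight (W m br x) (χ m br)).sum := fun x =>
      val_guess dec n B sim₁ sim₂ x _ (by simp [hd]) hvk hsupp h₁ h₂ h₃
    simp only [hval]
    have hle := List.sum_le_sum (l := L) fun br _ => norm_sq_le_tests (W := W m br)
      (fun x y => weight_fits_le dec n _ _ _ ν₃ y) hM hN (χ m br)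
    rw [hnorm] at hle
    refine hle.trans_eq ?_
    rw [List.sum_map_add, List.sum_map_mul_left, List.sum_map_mul_left]
    congr 2
    simp only [sub_eq_add_neg]
    rw [List.sum_map_add, hnorm]
    congr 1
    have hneg : ∀ G : Br Data × Br Data → ℝ, (L.map fun br => -G br).sum = -(L.map G).sum := by
      intro G
      simpa using List.sum_map_mul_left L G (-1)
    rw [hneg, list_sum_finset_sum]
    congr 1
    exact Finset.sum_congr rfl fun x _ => List.sum_map_mul_left ..
  have hP : ∑ m ∈ (Finset.range (2 * M + 1)).powerset, (2 ^ (2 * M + 1) : ℝ)⁻¹ * P m ≤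
      2 ^ (4 * B) / 2 ^ N₀ * ‖ψ‖ ^ 2 := by
    rw [← Finset.mul_sum, inv_mul_le_iff₀ (by positivity), ← mul_assoc, mul_div_assoc',
      div_mul_eq_mul_div, le_div_iff₀ (by positivity)]
    linarith
  have hsum := Finset.sum_le_sum fun m hm =>
    mul_le_mul_of_nonneg_left (hone m hm) (show 0 ≤ (2 ^ (2 * M + 1) : ℝ)⁻¹ by positivity)
  rw [sum_powerset_const] at hsum
  refine hsum.trans ?_
  have hsplit : ∀ G : Finset ℕ → ℝ, ∑ m ∈ (Finset.range (2 * M + 1)).powerset,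
      (2 ^ (2 * M + 1) : ℝ)⁻¹ * (2 * P m + 8 * N₀ * M * (‖ψ‖ ^ 2 - G m)) =
      2 * ∑ m ∈ (Finset.range (2 * M + 1)).powerset, (2 ^ (2 * M + 1) : ℝ)⁻¹ * P m +
        8 * N₀ * M * (‖ψ‖ ^ 2 - ∑ m ∈ (Finset.range (2 * M + 1)).powerset,
          (2 ^ (2 * M + 1) : ℝ)⁻¹ * G m) := by
    intro G
    conv_rhs => rw [← sum_powerset_const (2 * M + 1) (‖ψ‖ ^ 2)]
    rw [← Finset.sum_sub_distrib, Finset.mul_sum, Finset.mul_sum, ← Finset.sum_add_distrib]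
    exact Finset.sum_congr rfl fun m _ => by ring
  rw [hsplit]
  linarith

end ideal

/-! ### The ideal experiment -/

/-- The operation of a gate whose wires are the qubits `w 0, w 1, …`. -/
def Gate.op (w : ℕ → ℕ) : Gate → Op
  | .H a => .H (w a)
  | .T a => .T (w a)
  | .CNOT c t => .CNOT (w c) (w t)

theorem impl_gate (w : ℕ → ℕ) (g : Gate) :
    Impl (apply (g.unitary w)) (fun _ => [⟨(), [g.op w], 0, 0⟩]) := by
  intro μ
  cases g <;> simp [Gate.op, Gate.unitary, Word.lin, Op.lin] <;> rfl

theorem impl_newQubit : Impl newQubit (fun ν => [⟨ν 0, [], 1, 0⟩]) := by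
  intro μ
  simp [Word.lin]; rfl

/-- The branches of the evaluation of a circuit. -/
def runSM (C : Circuit) (m : List ℕ) : SM (List ℕ) :=
  if m.length = C.inputs then
    (SM.mapM (fun _ : Unit => fun ν => [⟨ν 0, [], 1, 0⟩])
      (List.replicate C.ancillas ())).bind fun anc =>
    (SM.mapM (fun g : Gate => fun _ => [⟨(), [g.op fun i => (m ++ anc).getD i 0], 0, 0⟩])
      C.gates).bind fun _ =>
    SM.ret 0 (C.outputs.map fun i => (m ++ anc).getD i 0)
  else SM.ret 0 []

theorem impl_run (C : Circuit) (m : List ℕ) : Impl (C.run m) (runSM C m) := by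
  rw [Circuit.run, runSM]
  split_ifs
  · exact (Impl.mapM (fun _ => impl_newQubit) _).bind fun anc =>
      (Impl.mapM (fun g => impl_gate _ g) _).bind fun _ => Impl.pure _
  · exact Impl.pure _

/-- The branches of the evaluation of a circuit on all messages. -/
def evalAllSM (C : Circuit) (msgs : List (List ℕ)) : SM Data :=
  (SM.mapM (runSM C) msgs).bind fun outs => SM.ret 0 (ofList (outs.map ofReg))

theorem impl_evalAll (C : Circuit) (msgs : List (List ℕ)) :
    Impl (evalAll C msgs) (evalAllSM C msgs) :=
  (Impl.mapM (impl_run C) _).bind fun _ => Impl.pure _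

/-- The values of the identity are the messages themselves. -/
theorem exp_evalAll {msgs : List (List ℕ)} (h : ∀ m ∈ msgs, m.length = 1)
    (F : Data → ℕ → State → ℝ) (n : ℕ) (ψ : State) :
    (evalAllSM idCircuit msgs).exp F n ψ = F (ofList (msgs.map ofReg)) n ψ := by
  have key : ∀ G : List (List ℕ) → ℕ → State → ℝ,
      (SM.mapM (runSM idCircuit) msgs).exp G n ψ = G msgs n ψ := by
    induction msgs with
    | nil => exact fun G => SM.exp_ret ..
    | cons m msgs ih =>
      intro G
      obtain ⟨q, rfl⟩ := List.length_eq_one_iff.1 (h m (by simp))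
      have hrun : ∀ (G : List ℕ → ℕ → State → ℝ) n ψ,
          (runSM idCircuit [q]).exp G n ψ = G [q] n ψ := by
        intro G n ψ
        simp [runSM, idCircuit, SM.mapM, SM.exp_bind, SM.exp_ret]
      rw [SM.mapM, SM.exp_bind, hrun, SM.exp_bind, ih fun m hm => h m (by simp [hm]), SM.exp_ret]
  rw [evalAllSM, SM.exp_bind, key, SM.exp_ret]

/-- The input of the simulators, apart from the state left by the first one: `c` describes the
circuit and `vals` holds its values. -/
def view (n : ℕ) (mk : Data) (msgs : List (List ℕ)) (c vals : Data) : Data :=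
  pair (ofNat n) (pair mk (pair c (pair vals (ofList (msgs.map fun m => ofNat m.length)))))

section ideal

variable (S : QFE) (A : Adversary) (Sim : Simulator) (n : ℕ)

/-- The branches of the ideal experiment after the first phase `r` of the adversary. -/
def simulatedSM (mk : Data) (r : Option Circuit × List (List ℕ) × Data) : SM Data :=
  let rest (v : Data) : SM Data :=
    (sem Sim.sim₁ v).bind fun t => secondSM A n r.1 t.fst r.2.2 fun C =>
      (evalAllSM C r.2.1).bind fun vals =>
        sem Sim.sim₂ (pair (view n mk r.2.1 C.encode vals) t.snd)
  match r.1 with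
  | some C => (evalAllSM C r.2.1).bind fun vals =>
      (SM.ret 0 (view n mk r.2.1 C.encode vals)).bind rest
  | none => (SM.ret 0 (view n mk r.2.1 .nil .nil)).bind rest

/-- The branches of the ideal experiment. -/
def idealSM : SM Data :=
  (setupSM S n).bind fun mk => (firstSM S A n mk).bind fun r => simulatedSM A Sim n mk r

theorem impl_ideal : Impl (idealExp S A Sim n) (idealSM S A Sim n) := by
  refine (impl_setup S n).bind fun mk => (impl_first S A n mk).bind fun ⟨q₁, msgs, st⟩ => ?_
  cases q₁ with
  | none =>
    exact (Impl.pure _).bind fun v => (impl_eval _ _).bind fun t => impl_second A n _ _ _ fun C =>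
      (impl_evalAll _ _).bind fun vals => impl_eval _ _
  | some C =>
    exact (impl_evalAll _ _).bind fun vals => (Impl.pure _).bind fun v =>
      (impl_eval _ _).bind fun t => impl_second A n _ _ _ fun C =>
      (impl_evalAll _ _).bind fun vals => impl_eval _ _

variable (c c' : ℕ)

theorem names_view_nil {mk : Data} (hmk : mk.names = []) (msgs : List (List ℕ)) :
    (view n mk msgs .nil .nil).names = [] := by
  simp [view, names, names_ofNat, hmk, names_ofList, List.flatMap_map]

theorem names_view {mk : Data} (hmk : mk.names = []) (k N : ℕ) :
    (view n mk (messages k N) idCircuit.encode (ofList ((messages k N).map ofReg))).names =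
      (List.range N).reverse.map (k + ·) := by
  have h : ∀ l : List ℕ, (l.map fun j => [k + j]).flatMap (fun m => (ofReg m).names) =
      l.map (k + ·) := by
    intro l
    induction l with
    | nil => rfl
    | cons j l ih => rw [List.map_cons, List.flatMap_cons, ih]; rfl
  simp only [view, names, names_ofNat, hmk, names_encode_idCircuit, names_ofList, List.flatMap_map,
    List.nil_append]
  rw [messages, ← h]
  simp

/-- The first simulator gets no qubit of the adversary, since the query is made later; the second
one gets the messages, as values of the identity. -/
theorem exp_simulated {mk : Data} (hmk : mk.names = []) {M k : ℕ} (hM : sqFun^[c'] n = 2 * M + 1)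
    {m : Finset ℕ} {φ : State} (hφ : φ.SuppIn (Set.Iio (k + (2 * M + 1)))) :
    (simulatedSM (attack c c' S.dec) Sim n mk
      (none, messages k (2 * M + 1), bits (2 * M + 1) m)).exp accF (k + (2 * M + 1)) φ =
      ∑ x ∈ Finset.range (2 * M + 1), ((2 * M).choose x : ℝ) / 2 ^ (2 * M) *
        (Eff.bind (sem Sim.sim₁ (view n mk (messages k (2 * M + 1)) .nil .nil))
          (guess S.dec n (sqFun^[c] n) Sim.sim₂ (view n mk (messages k (2 * M + 1))
            idCircuit.encode (ofList ((messages k (2 * M + 1)).map ofReg))) x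
              (decide (2 * M - x ∈ m)))).val (k + (2 * M + 1) + ·) φ := by
  have hlen : ∀ w ∈ messages k (2 * M + 1), w.length = 1 := by
    intro w hw
    obtain ⟨j, -, rfl⟩ := List.mem_map.1 hw
    rfl
  simp only [← exp_val]
  rw [← exp_sum, simulatedSM, SM.exp_bind, SM.exp_ret, SM.exp_bind]
  refine exp_congr_valid ⟨by simp [names_view_nil n hmk], hφ⟩ fun t l φ' hl hv => ?_
  rw [exp_second S c c' n (p := Sim.sim₂) (d := pair (view n mk (messages k (2 * M + 1))
    idCircuit.encode (ofList ((messages k (2 * M + 1)).map ofReg))) t.snd)]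
  · rw [hM, Nat.add_sub_cancel]
    refine Finset.sum_congr rfl fun x hx => ?_
    rw [pos_bits (Finset.mem_range.1 hx), Nat.add_sub_cancel]
    rfl
  · intro F k' ψ'
    rw [SM.exp_bind, exp_evalAll hlen]
  · refine ⟨fun q hq => ?_, hv.2⟩
    rw [names, names_view n hmk] at hq
    rcases List.mem_append.1 hq with hq | hq
    · obtain ⟨j, hj, rfl⟩ := List.mem_map.1 hq
      have := List.mem_range.1 (List.mem_reverse.1 hj)
      omega
    · exact hv.1 q ((names_fst_snd _).subset (List.mem_append_right _ hq))
  · refine ⟨fun q hq => ?_, hv.2⟩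
    rw [names, names_bits, List.append_nil] at hq
    exact hv.1 q ((names_fst_snd _).subset (List.mem_append_left _ hq))

/-- The attack does not succeed in the ideal experiment with probability close to one. -/
theorem ideal_le {M N₀ : ℕ} (hM : sqFun^[c'] n = 2 * M + 1) (hM₀ : 0 < M) (hN : 2 * N₀ ^ 2 ≤ M)
    (hB : 0 < sqFun^[c] n) :
    1 ≤ 2 * (2 ^ (4 * sqFun^[c] n) / 2 ^ N₀ : ℝ) + 8 * N₀ * M *
      (1 - (idealSM S (attack c c' S.dec) Sim n).exp accF 0 (ket ∅)) := by
  have htot := (sem_complete S.setup (ofNat n)).exp_norm 0 (ket ∅)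
  rw [norm_ket, one_pow] at htot
  set a : ℝ := 2 * (2 ^ (4 * sqFun^[c] n) / 2 ^ N₀ : ℝ)
  set e : ℝ := 8 * N₀ * M
  have hacc : (idealSM S (attack c c' S.dec) Sim n).exp accF 0 (ket ∅) =
      (sem S.setup (ofNat n)).exp (fun mk => ((firstSM S (attack c c' S.dec) n mk.classical).bind
        fun r => simulatedSM (attack c c' S.dec) Sim n mk.classical r).exp accF) 0 (ket ∅) := by
    rw [idealSM, SM.exp_bind, setupSM, SM.exp_bind]
    refine SM.exp_congr fun b _ => ?_
    rw [SM.exp_ret]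
  have hle : (sem S.setup (ofNat n)).exp (fun mk l ψ => (1 - a - e) * ‖ψ‖ ^ 2 +
      e * ((firstSM S (attack c c' S.dec) n mk.classical).bind
        fun r => simulatedSM (attack c c' S.dec) Sim n mk.classical r).exp accF l ψ) 0 (ket ∅) ≤
      (sem S.setup (ofNat n)).exp (fun _ _ _ => 0) 0 (ket ∅) := by
    refine SM.exp_mono fun b hb => ?_
    have hv := branch_valid (d := ofNat n) (n := 0) (ψ := ket ∅)
      ⟨by simp [names_ofNat], State.SuppIn.ket (by simp)⟩ hb
    set k := 0 + b.used
    set ψ := b.word.lin (ket ∅)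
    have hmk : b.val.classical.names = [] := names_classical _
    rw [SM.exp_bind, exp_first S c c' n _ _ hv.2, hM]
    have hnames := names_view n hmk k (2 * M + 1)
    have hcore := ideal_core S.dec n (sqFun^[c] n) Sim.sim₁ Sim.sim₂
      (d := view n b.val.classical (messages k (2 * M + 1)) .nil .nil)
      (v := view n b.val.classical (messages k (2 * M + 1)) idCircuit.encode
        (ofList ((messages k (2 * M + 1)).map ofReg)))
      (names_view_nil n hmk _) ?_ (k := k) ?_ hM₀ hN hB hv.2
    · have hterm : ∀ m ∈ (Finset.range (2 * M + 1)).powerset,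
          (simulatedSM (attack c c' S.dec) Sim n b.val.classical
            (none, messages k (2 * M + 1), bits (2 * M + 1) m)).exp accF (k + (2 * M + 1))
            (((√2 : ℝ) : ℂ)⁻¹ ^ (2 * M + 1) • flip (coinSet k m) ψ) =
          (2 ^ (2 * M + 1) : ℝ)⁻¹ * ∑ x ∈ Finset.range (2 * M + 1),
            ((2 * M).choose x : ℝ) / 2 ^ (2 * M) * (Eff.bind (sem Sim.sim₁ (view n
              b.val.classical (messages k (2 * M + 1)) .nil .nil)) (guess S.dec n (sqFun^[c] n)
              Sim.sim₂ (view n b.val.classical (messages k (2 * M + 1)) idCircuit.encode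
                (ofList ((messages k (2 * M + 1)).map ofReg))) x (decide (2 * M - x ∈ m)))).val
                  (k + (2 * M + 1) + ·) (flip (coinSet k m) ψ) := by
        intro m hm
        rw [exp_simulated S Sim n c c' hmk hM, Finset.mul_sum]
        · refine Finset.sum_congr rfl fun x _ => ?_
          rw [val_smul, norm_coin]
          ring
        · refine State.SuppIn.smul _ (SuppIn_flip (hv.2.mono (Set.Iio_subset_Iio (by omega)))
            fun q hq => ?_)
          obtain ⟨i, hi, rfl⟩ := Finset.mem_map.1 hq
          have := Finset.mem_range.1 (Finset.mem_powerset.1 hm hi)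
          simp [addLeftEmbedding]; omega
      rw [Finset.sum_congr rfl hterm]
      linarith
    · rw [hnames]
      exact (List.nodup_reverse.2 List.nodup_range).map fun i j h => by simpa using h
    · rw [hnames]
      intro q hq
      obtain ⟨j, hj, rfl⟩ := List.mem_map.1 hq
      have := List.mem_range.1 (List.mem_reverse.1 hj)
      omega
  rw [SM.exp_add, SM.exp_mul_left, SM.exp_mul_left, htot, ← hacc] at hle
  have h0 : (sem S.setup (ofNat n)).exp (fun _ _ _ => (0 : ℝ)) 0 (ket ∅) = 0 := by
    simp [SM.exp]
  rw [h0] at hle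
  linarith

end ideal

/-! ### The choice of the parameters -/

theorem le_sqFun_sqFun (B : ℕ) : 4 * B + 2 ≤ sqFun (sqFun B) := by
  simp only [sqFun]
  nlinarith

theorem two_mul_sq_le_sqFun (N : ℕ) : 2 * N ^ 2 ≤ sqFun N := by
  rw [sqFun]
  omega

theorem guess_loss_le {B N : ℕ} (h : 4 * B + 2 ≤ N) :
    2 * (2 ^ (4 * B) / 2 ^ N : ℝ) ≤ 1 / 2 := by
  have : (2 : ℝ) ^ (4 * B + 2) ≤ 2 ^ N := pow_le_pow_right₀ (by norm_num) h
  rw [pow_add] at this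
  have h2 : (2 : ℝ) ^ (4 * B) / 2 ^ N ≤ 1 / 4 := by
    rw [div_le_iff₀ (by positivity)]
    linarith
  linarith

end QFun

open QFun Prog Data

theorem mainTheorem2 :
    ¬ ∃ S : QFun.QFE, S.IsQPT ∧ S.IsCorrect ∧ S.IsM1ADSimSecure := by
  rintro ⟨S, hqpt, hcor, hsec⟩
  obtain ⟨c, hc⟩ := exists_key_bound ((isQPT_iff _).1 hqpt.1) ((isQPT_iff _).1 hqpt.2.1)
  have hpos : ∀ n, 0 < sqFun^[c + 4] n := fun n => by
    rw [Function.iterate_succ_apply']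
    exact sqFun_pos _
  obtain ⟨ε, hε, hreal⟩ := real_ge hcor c (c + 4) hpos fun n => (hc n).2
  obtain ⟨Sim, -, hind⟩ := hsec (attack c (c + 4) S.dec) (attack_isQPT c (c + 4) hqpt.2.2.2)
  -- The distinguisher returns the output bit of the attack.
  have hδ := hind .snd ((isQPT_iff _).2 Poly.snd)
  obtain ⟨Q₂, hQ₂⟩ := exists_poly_iterate_sqFun (c + 2)
  obtain ⟨Q₃, hQ₃⟩ := exists_poly_iterate_sqFun (c + 3)
  -- In `ideal_le`, the number of tests is `N₀ = sqFun^[c + 2] n`, and `M = k ^ 2 + k` with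
  -- `k = sqFun^[c + 3] n`.
  let Q : Polynomial ℕ := 8 * Q₂ * (Q₃ ^ 2 + Q₃)
  have hsmall := ((hε.add hδ).polynomial_mul (Q.map (Nat.castRingHom ℝ))) 0
  simp only [pow_zero, one_mul] at hsmall
  obtain ⟨n, hn⟩ := (hsmall.eventually (gt_mem_nhds (show (0 : ℝ) < 1 / 2 by norm_num))).exists
  have hr := hreal n
  have hB : 0 < sqFun^[c] n := (hc n).1
  obtain ⟨N₀, hN₀⟩ : ∃ N₀, N₀ = sqFun^[c + 2] n := ⟨_, rfl⟩
  obtain ⟨k, hk⟩ : ∃ k, k = sqFun^[c + 3] n := ⟨_, rfl⟩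
  have hN₀B : N₀ = sqFun (sqFun (sqFun^[c] n)) := by
    rw [hN₀, Function.iterate_succ_apply', Function.iterate_succ_apply']
  have hkN : k = sqFun N₀ := by rw [hk, hN₀, Function.iterate_succ_apply']
  have hM : sqFun^[c + 4] n = 2 * (k ^ 2 + k) + 1 := by
    rw [Function.iterate_succ_apply', ← hk, sqFun]
    ring
  have hgrow : 4 * sqFun^[c] n + 2 ≤ N₀ := hN₀B ▸ le_sqFun_sqFun _
  have hNk : 2 * N₀ ^ 2 ≤ k := hkN ▸ two_mul_sq_le_sqFun N₀
  have hk₀ : 0 < k := hkN ▸ sqFun_pos _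
  have hideal := ideal_le S Sim n c (c + 4) hM (by positivity)
    (hNk.trans (Nat.le_add_left _ _)) hB
  have h1 := guess_loss_le hgrow
  have hQ : (Q.map (Nat.castRingHom ℝ)).eval (n : ℝ) = 8 * N₀ * ((k ^ 2 + k : ℕ) : ℝ) := by
    rw [Polynomial.eval_natCast_map]
    simp only [Q, Polynomial.eval_mul, Polynomial.eval_add, Polynomial.eval_pow,
      Polynomial.eval_ofNat, ← hQ₂, ← hQ₃, Nat.cast_id, eq_natCast]
    rw [← hN₀, ← hk]
    push_cast
    ring
  simp only [Pi.add_apply, hQ, accept_eq n (impl_real S _ n),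
    accept_eq n (impl_ideal S _ Sim n)] at hn
  generalize (realSM S (attack c (c + 4) S.dec) n).exp accF 0 (ket ∅) = r at *
  generalize (idealSM S (attack c (c + 4) S.dec) Sim n).exp accF 0 (ket ∅) = i at *
  have hK : (0 : ℝ) ≤ ((k ^ 2 + k : ℕ) : ℝ) := Nat.cast_nonneg _
  generalize ((k ^ 2 + k : ℕ) : ℝ) = K at *
  have h3 : 1 - i ≤ ε n + |r - i| := by linarith [le_abs_self (r - i)]
  have h4 : 8 * (N₀ : ℝ) * K * (1 - i) ≤
      8 * N₀ * K * (ε n + |r - i|) :=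
    mul_le_mul_of_nonneg_left h3 (by positivity)
  linarith
end
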